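/- Let $E=(E^0,E^1,r,s)$ be a finite directed graph without sinks and without sources (every vertex is the initial vertex of some edge and the final vertex of some edge), and let $n\ge 1$ be an integer. Paths are written from right to left: $ew$ is the path $w$ followed by the edge $e$, where $s(e)=r(w)$. Let $E^*$ be the set of finite paths, vertices being the paths of length $0$, and let $E^{<n}$ be the set of paths of length less than $n$. Every $w\in E^*$ factors uniquely as $w=w(n)v_k\cdots v_1$ with $|v_i|=n$ and $w(n)\in E^{<n}$. On $\ell^2(E^*)$, with orthonormal basis $\{\xi_w\}_{w\in E^*}$, a weighted shift with weights $\lambda(w)\in\mathbb C$ ($w\in E^*$, $|w|\ge 1$) is a family of bounded operators $(T_e)_{e\in E^1}$ with $T_e\xi_w=\lambda(ew)\xi_{ew}$ if $s(e)=r(w)$ and $T_e\xi_w=0$ otherwise. It has period $n$ if $\lambda(ew)=\lambda(e\,w(n))$ whenever $s(e)=r(w)$. Let $\mathcal A(n)$ be the $C^*$-algebra generated by the operators $T_e$ of all weighted shifts of period $n$. Let $R_x$ be the projection onto the closed span of $\{\xi_w: s(w)=x\}$, let $\mathfrak K$ be the set of compact operators on $\ell^2(E^*)$, let $\mathfrak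 K_E=\bigoplus_{x\in E^0}R_x\mathfrak K R_x$, and let $\mathcal B(n)=\mathcal A(n)/\mathfrak K_E$. For a finite directed graph $F$, let $\mathcal O(F)$ be its Cuntz–Krieger algebra, that is, the universal $C^*$-algebra generated by projections $p_x$ ($x\in F^0$) and partial isometries $s_e$ ($e\in F^1$) such that $p_xp_y=0$ for $x\ne y$, $s_e^*s_f=0$ for $e\neq f$, $s_e^*s_e=p_{s(e)}$, and $\sum_{r(e)=x}s_es_e^*=p_x$ whenever $r^{-1}(x)\ne\emptyset$. Let $E(n)$ be the graph with vertex set $E^{<n}$ and edge set $\{(e,w)\in E^1\times E^{<n}: s(e)=r(w)\}$, where $(e,w)$ has source $w$, and range $ew$ if $|w|<n-1$ and $r(e)$ if $|w|=n-1$. Let $E(=n)$ be the graph with vertex set $E^0$ whose edges are the paths $w$ of length $n$ in $E$, with source $s(w)$ and range $r(w)$. For $x\in E^0$ let $d_E(n,x)$ be the number of $w\in E^{<n}$ with $s(w)=x$, and let $d_E(n)=\sum_{x}d_E(n,x)=|E^{<n}|$. Then $\mathcal B(n)$ is $*$-isomorphic to the corner $$\Big(\bigoplus_{x\in E^0}p_x^{(d_E(n,x))}\Big)\,M_{d_E(n)}\big(\mathcal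 O(E(=n))\big)\,\Big(\bigoplus_{x\in E^0}p_x^{(d_E(n,x))}\Big),$$ where $\{p_x\}_{x\in E^0}$ are the vertex projections of $\mathcal O(E(=n))$ and $\bigoplus_{x}p_x^{(d_E(n,x))}$ is the diagonal matrix in which each $p_x$ occurs $d_E(n,x)$ times. Moreover, $\mathcal O(E(n))$ is $*$-isomorphic to the same corner. -/

import Mathlib

open scoped ENNReal

universe u

noncomputable section

/-! ### Quotients of `*`-algebras by self-adjoint ideals -/

/-- Self-adjoint two-sided ideals of a (possibly non-unital) complex `*`-algebra. -/
structure StarIdeal (A : Type u) [NonUnitalRing A] [StarRing A] [Module ℂ A] extends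
    Submodule ℂ A where
  mul_mem_left : ∀ a {b}, b ∈ carrier → a * b ∈ carrier
  mul_mem_right : ∀ a {b}, b ∈ carrier → b * a ∈ carrier
  star_mem : ∀ {b}, b ∈ carrier → star b ∈ carrier

namespace StarIdeal

variable {A : Type u} [NonUnitalRing A] [StarRing A] [Module ℂ A] (I : StarIdeal A)

/-- The quotient of a `*`-algebra by a self-adjoint two-sided ideal. -/
def Quotient : Type u := A ⧸ I.toSubmodule

namespace Quotient

instance : AddCommGroup I.Quotient := inferInstanceAs (AddCommGroup (A ⧸ I.toSubmodule))

instance : Module ℂ I.Quotient := inferInstanceAs (Module ℂ (A ⧸ I.toSubmodule))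

/-- The quotient map. -/
def mk : A →ₗ[ℂ] I.Quotient := I.toSubmodule.mkQ

theorem mk_surjective : Function.Surjective (mk I) := I.toSubmodule.mkQ_surjective

theorem mk_eq_mk {a b : A} : mk I a = mk I b ↔ a - b ∈ I.toSubmodule :=
  Submodule.Quotient.eq I.toSubmodule

instance : Mul I.Quotient where
  mul := Quotient.map₂ (· * ·) fun a a' ha b b' hb => by
    refine (Submodule.quotientRel_def _).2 ?_
    have ha := (Submodule.quotientRel_def _).1 ha
    have hb := (Submodule.quotientRel_def _).1 hb
    have : a * b - a' * b' = (a - a') * b + a' * (b - b') := by noncomm_ring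
    rw [this]
    exact I.toSubmodule.add_mem (I.mul_mem_right _ ha) (I.mul_mem_left _ hb)

theorem mk_mul (a b : A) : mk I (a * b) = mk I a * mk I b := rfl

instance [StarModule ℂ A] : Star I.Quotient where
  star := Quotient.map star fun a a' ha => by
    refine (Submodule.quotientRel_def _).2 ?_
    have ha := (Submodule.quotientRel_def _).1 ha
    rw [← star_sub]
    exact I.star_mem ha

theorem mk_star [StarModule ℂ A] (a : A) : mk I (star a) = star (mk I a) := rfl

instance : NonUnitalRing I.Quotient where
  left_distrib := by
    intro a b c
    obtain ⟨a, rfl⟩ := mk_surjective I a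
    obtain ⟨b, rfl⟩ := mk_surjective I b
    obtain ⟨c, rfl⟩ := mk_surjective I c
    simp only [← mk_mul, ← map_add, mul_add]
  right_distrib := by
    intro a b c
    obtain ⟨a, rfl⟩ := mk_surjective I a
    obtain ⟨b, rfl⟩ := mk_surjective I b
    obtain ⟨c, rfl⟩ := mk_surjective I c
    simp only [← mk_mul, ← map_add, add_mul]
  zero_mul := by
    intro a
    obtain ⟨a, rfl⟩ := mk_surjective I a
    rw [← map_zero (mk I), ← mk_mul, zero_mul]
  mul_zero := by
    intro a
    obtain ⟨a, rfl⟩ := mk_surjective I a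
    rw [← map_zero (mk I), ← mk_mul, mul_zero]
  mul_assoc := by
    intro a b c
    obtain ⟨a, rfl⟩ := mk_surjective I a
    obtain ⟨b, rfl⟩ := mk_surjective I b
    obtain ⟨c, rfl⟩ := mk_surjective I c
    simp only [← mk_mul, mul_assoc]

instance [StarModule ℂ A] : StarRing I.Quotient where
  star_involutive := by
    intro a
    obtain ⟨a, rfl⟩ := mk_surjective I a
    rw [← mk_star, ← mk_star, star_star]
  star_mul := by
    intro a b
    obtain ⟨a, rfl⟩ := mk_surjective I a
    obtain ⟨b, rfl⟩ := mk_surjective I b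
    simp only [← mk_mul, ← mk_star, star_mul]
  star_add := by
    intro a b
    obtain ⟨a, rfl⟩ := mk_surjective I a
    obtain ⟨b, rfl⟩ := mk_surjective I b
    simp only [← map_add, ← mk_star, star_add]

end Quotient

end StarIdeal

/-! ### Corners, and adjoints of compact operators -/

/-- The corner `p M p`, for a self-adjoint element `p` of a C⋆-algebra `M`. -/
def corner {M : Type*} [NonUnitalCStarAlgebra M] (p : M) (hp : IsSelfAdjoint p) :
    NonUnitalStarSubalgebra ℂ M where
  carrier := Set.range fun a => p * a * p
  zero_mem' := ⟨0, by simp⟩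
  add_mem' := by
    rintro _ _ ⟨a, rfl⟩ ⟨b, rfl⟩
    exact ⟨a + b, by simp [mul_add, add_mul]⟩
  mul_mem' := by
    rintro _ _ ⟨a, rfl⟩ ⟨b, rfl⟩
    exact ⟨a * (p * p) * b, by simp [mul_assoc]⟩
  smul_mem' := by
    rintro c _ ⟨a, rfl⟩
    exact ⟨c • a, by simp [mul_smul_comm, smul_mul_assoc]⟩
  star_mem' := by
    rintro _ ⟨a, rfl⟩
    exact ⟨star a, by simp [mul_assoc, hp.star_eq]⟩

theorem isCompactOperator_star {H : Type*} [NormedAddCommGroup H] [InnerProductSpace ℂ H]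
    [CompleteSpace H] {K : H →L[ℂ] H} (hK : IsCompactOperator K) :
    IsCompactOperator (star K : H →L[ℂ] H) := by
  have hKK : IsCompactOperator ((K * star K : H →L[ℂ] H) : H →ₗ[ℂ] H) := hK.comp_clm (star K)
  obtain ⟨C, hC, hsub⟩ := hKK.image_closedBall_subset_compact 1
  have htb := hC.totallyBounded.subset hsub
  refine (isCompactOperator_iff_isCompact_closure_image_closedBall
    ((star K : H →L[ℂ] H) : H →ₗ[ℂ] H) one_pos).2 (TotallyBounded.isCompact_of_isClosed
      (TotallyBounded.closure ?_) isClosed_closure)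
  rw [Metric.totallyBounded_iff]
  intro ε hε
  obtain ⟨t, hts, htf, hcov⟩ := Metric.finite_approx_of_totallyBounded htb (ε ^ 2 / 2) (by positivity)
  have hts' : ∀ y, ∃ z, y ∈ t → z ∈ Metric.closedBall 0 1 ∧ (K * star K) z = y := fun y => by
    by_cases hy : y ∈ t
    · obtain ⟨z, hz⟩ := hts hy
      exact ⟨z, fun _ => hz⟩
    · exact ⟨0, fun h => absurd h hy⟩
  choose g hg using hts'
  refine ⟨(fun y => star K (g y)) '' t, htf.image _, ?_⟩
  rintro _ ⟨x, hx, rfl⟩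
  obtain ⟨y, hy, hxy⟩ := Set.mem_iUnion₂.1 (hcov ⟨x, hx, rfl⟩)
  refine Set.mem_iUnion₂.2 ⟨_, ⟨y, hy, rfl⟩, ?_⟩
  have h1 : ‖(K * star K) (x - g y)‖ < ε ^ 2 / 2 := by
    rw [map_sub, ← dist_eq_norm]
    have := (hg y hy).2
    rw [← this] at hxy
    exact hxy
  have h2 : ‖x - g y‖ ≤ 2 := by
    have a1 : ‖x‖ ≤ 1 := by simpa using hx
    have a2 : ‖g y‖ ≤ 1 := by simpa using (hg y hy).1
    linarith [norm_sub_le x (g y)]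
  have h3 : ‖star K (x - g y)‖ ^ 2 ≤ ‖(K * star K) (x - g y)‖ * ‖x - g y‖ := by
    have e : inner ℂ ((K * star K) (x - g y)) (x - g y) =
        inner ℂ (star K (x - g y)) (star K (x - g y)) := by
      rw [ContinuousLinearMap.star_eq_adjoint, ContinuousLinearMap.adjoint_inner_right]
      rfl
    have := norm_inner_le_norm (𝕜 := ℂ) ((K * star K) (x - g y)) (x - g y)
    rw [e, inner_self_eq_norm_sq_to_K] at this
    simpa using this
  have h4 : ‖star K (x - g y)‖ ^ 2 < ε ^ 2 := by
    nlinarith [norm_nonneg (x - g y), norm_nonneg ((K * star K) (x - g y))]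
  have h5 := lt_of_pow_lt_pow_left₀ 2 hε.le h4
  change dist (star K x) (star K (g y)) < ε
  rwa [dist_eq_norm, ← map_sub]

/-! ### Directed graphs and paths -/

/-- A directed graph with vertex set `V` and edge set `E`, given by its source and range maps. -/
structure DirGraph (V E : Type u) where
  /-- the initial vertex of an edge -/
  src : E → V
  /-- the final vertex of an edge -/
  rng : E → V

namespace DirGraph

variable {V E : Type u} (G : DirGraph V E)

/-- The vertex reached from `x` by walking along a list of edges. Lists are written as paths are,
from right to left: the head of the list is the edge that is traversed last. -/
def finish (x : V) : List E → V
  | [] => x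
  | e :: _ => G.rng e

/-- The list `[e_k, …, e_1]` is a path `e_k ⋯ e_1` that starts at `x`. -/
def IsPathFrom (x : V) : List E → Prop
  | [] => True
  | e :: l => G.src e = G.finish x l ∧ IsPathFrom x l

/-- The finite paths of `G`, the vertices being the paths of length `0`. -/
@[ext]
structure Path where
  /-- the initial vertex of the path -/
  source : V
  /-- the edges of the path, the last one first -/
  edges : List E
  isPath : G.IsPathFrom source edges

namespace Path

variable {G}

/-- The final vertex of a path. -/
def range (w : G.Path) : V := G.finish w.source w.edges

/-- The length of a path. -/
def length (w : G.Path) : ℕ := w.edges.length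

/-- The path `ew`, for an edge `e` and a path `w` with `s(e) = r(w)`. -/
def cons (e : E) (w : G.Path) (h : G.src e = w.range) : G.Path :=
  ⟨w.source, e :: w.edges, h, w.isPath⟩

end Path

theorem isPathFrom_take (x : V) (k : ℕ) (l : List E) (h : G.IsPathFrom x l) :
    G.IsPathFrom (G.finish x (l.drop k)) (l.take k) := by
  induction l generalizing k with
  | nil => simp [IsPathFrom]
  | cons e l ih =>
    cases k with
    | zero => simp [IsPathFrom]
    | succ k =>
      refine ⟨?_, ih k h.2⟩
      rw [h.1]
      cases l with
      | nil => simp [finish]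
      | cons f l => cases k <;> simp [finish]

/-- The path `w(n)` in the factorization `w = w(n) v_k ⋯ v_1` with `|v_i| = n` and
`|w(n)| < n`: it consists of the last `|w| mod n` edges of `w`. -/
def Path.rem {G : DirGraph V E} (w : G.Path) (n : ℕ) : G.Path where
  source := G.finish w.source (w.edges.drop (w.length % n))
  edges := w.edges.take (w.length % n)
  isPath := G.isPathFrom_take _ _ _ w.isPath

theorem Path.range_rem {G : DirGraph V E} (w : G.Path) (n : ℕ) : (w.rem n).range = w.range := by
  obtain ⟨x, l, h⟩ := w
  simp only [Path.rem, Path.range, Path.length]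
  cases l with
  | nil => simp [finish]
  | cons e l => cases (e :: l).length % n <;> simp [finish]

/-- The set of paths of length strictly less than `n`. -/
abbrev PathLT (n : ℕ) : Type u := {w : G.Path // w.length < n}

/-- The set of paths of length `n`. -/
abbrev PathEq (n : ℕ) : Type u := {w : G.Path // w.length = n}

instance finite_pathLT [Finite V] [Finite E] (n : ℕ) : Finite (G.PathLT n) := by
  have : Finite {l : List E // l.length < n} := List.finite_length_lt E n
  refine Finite.of_injective (β := V × {l : List E // l.length < n})
    (fun w => (w.1.source, ⟨w.1.edges, w.2⟩)) fun w w' h => ?_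
  simp only [Prod.mk.injEq] at h
  exact Subtype.ext (Path.ext h.1 (congrArg Subtype.val h.2))

instance finite_pathEq [Finite V] [Finite E] (n : ℕ) : Finite (G.PathEq n) :=
  Finite.of_injective (β := G.PathLT (n + 1)) (fun w => ⟨w.1, by have := w.2; omega⟩)
    fun w w' h => Subtype.ext (by simpa using h)

/-- `d_E(n, x)`, the number of paths of length strictly less than `n` with initial vertex `x`. -/
def numPaths (n : ℕ) (x : V) : ℕ := Nat.card {w : G.PathLT n // w.1.source = x}

/-! ### The graphs `E(n)` and `E(=n)` -/

/-- The edges `(e, w)` of `E(n)`: pairs of an edge `e` and a path `w` with `|w| < n` and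
`s(e) = r(w)`. -/
abbrev StepEdge (n : ℕ) : Type u := {p : E × G.PathLT n // G.src p.1 = p.2.1.range}

/-- The graph `E(n)`: its vertices are the paths of length less than `n`, and an edge `(e, w)`
leads from `w` to `ew` if `|w| < n - 1`, and to the vertex `r(e)` if `|w| = n - 1`. -/
def stepGraph (n : ℕ) : DirGraph (G.PathLT n) (G.StepEdge n) where
  src p := p.1.2
  rng p :=
    if h : p.1.2.1.length + 1 < n then ⟨Path.cons p.1.1 p.1.2.1 p.2, h⟩
    else ⟨⟨G.rng p.1.1, [], trivial⟩, Nat.zero_lt_of_lt p.1.2.2⟩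

/-- The graph `E(=n)`: its vertices are those of `E`, and its edges are the paths of length `n`
in `E` (a path `w` stands for the pair `(w, s(w))`). -/
def powGraph (n : ℕ) : DirGraph V (G.PathEq n) where
  src w := w.1.source
  rng w := w.1.range

/-! ### Cuntz-Krieger families and the universal Cuntz-Krieger algebra -/

/-- Cuntz-Krieger `G`-families in a C⋆-algebra. -/
structure IsCKFamily [Finite E] {B : Type*} [NonUnitalCStarAlgebra B] (P : V → B) (S : E → B) :
    Prop where
  isProj : ∀ x, IsStarProjection (P x)
  partialIsometry : ∀ e, S e * star (S e) * S e = S e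
  orthogonal : ∀ x y, x ≠ y → P x * P y = 0
  star_mul_of_ne : ∀ e f, e ≠ f → star (S e) * S f = 0
  star_mul_self : ∀ e, star (S e) * S e = P (G.src e)
  sum_eq : ∀ x, (∃ e, G.rng e = x) →
    ∑ᶠ e ∈ {e : E | G.rng e = x}, S e * star (S e) = P x

/-- A Cuntz-Krieger `G`-family together with the C⋆-algebra in which it lives. -/
structure CKFamily [Finite E] where
  /-- the C⋆-algebra -/
  carrier : Type u
  [inst : NonUnitalCStarAlgebra carrier]
  /-- the vertex projections -/
  P : V → carrier
  /-- the edge partial isometries -/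
  S : E → carrier
  isCK : G.IsCKFamily P S

attribute [instance] CKFamily.inst

/-- Formal noncommutative `*`-polynomials without constant term in the symbols `p_x`, `s_e`. -/
inductive StarPoly (V E : Type u) : Type u
  | vertex (x : V)
  | edge (e : E)
  | zero
  | add (a b : StarPoly V E)
  | mul (a b : StarPoly V E)
  | smul (c : ℂ) (a : StarPoly V E)
  | star (a : StarPoly V E)

/-- The value of a formal `*`-polynomial at elements of a C⋆-algebra. -/
def StarPoly.eval {B : Type*} [NonUnitalCStarAlgebra B] (P : V → B) (S : E → B) :
    StarPoly V E → B
  | vertex x => P x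
  | edge e => S e
  | zero => 0
  | add a b => a.eval P S + b.eval P S
  | mul a b => a.eval P S * b.eval P S
  | smul c a => c • a.eval P S
  | star a => Star.star (a.eval P S)

theorem StarPoly.map_eval {A B : Type*} [NonUnitalCStarAlgebra A] [NonUnitalCStarAlgebra B]
    (φ : A →⋆ₙₐ[ℂ] B) (P : V → A) (S : E → A) (t : StarPoly V E) :
    φ (t.eval P S) = t.eval (fun x => φ (P x)) (fun e => φ (S e)) := by
  induction t with
  | vertex x => rfl
  | edge e => rfl
  | zero => exact map_zero φ
  | add a b iha ihb => simp [StarPoly.eval, iha, ihb]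
  | mul a b iha ihb => simp [StarPoly.eval, iha, ihb]
  | smul c a ih => simp [StarPoly.eval, ih]
  | star a ih => simp [StarPoly.eval, ih, map_star]

theorem StarPoly.exists_eval {A : Type*} [NonUnitalCStarAlgebra A] (P : V → A) (S : E → A) {a : A}
    (ha : a ∈ NonUnitalStarAlgebra.adjoin ℂ (Set.range P ∪ Set.range S)) :
    ∃ t : StarPoly V E, t.eval P S = a := by
  induction ha using NonUnitalStarAlgebra.adjoin_induction with
  | mem x hx =>
    rcases hx with ⟨x, rfl⟩ | ⟨e, rfl⟩
    · exact ⟨.vertex x, rfl⟩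
    · exact ⟨.edge e, rfl⟩
  | add x y _ _ hx hy =>
    obtain ⟨s, rfl⟩ := hx
    obtain ⟨t, rfl⟩ := hy
    exact ⟨.add s t, rfl⟩
  | zero => exact ⟨.zero, rfl⟩
  | mul x y _ _ hx hy =>
    obtain ⟨s, rfl⟩ := hx
    obtain ⟨t, rfl⟩ := hy
    exact ⟨.mul s t, rfl⟩
  | smul r x _ hx =>
    obtain ⟨s, rfl⟩ := hx
    exact ⟨.smul r s, rfl⟩
  | star x _ hx =>
    obtain ⟨s, rfl⟩ := hx
    exact ⟨.star s, rfl⟩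

section Universal

variable [Finite E]

variable {G} in
theorem IsCKFamily.norm_proj_le {B : Type*} [NonUnitalCStarAlgebra B] {P : V → B} {S : E → B}
    (h : G.IsCKFamily P S) (x : V) : ‖P x‖ ≤ 1 :=
  (h.isProj x).norm_le

variable {G} in
theorem IsCKFamily.norm_edge_le {B : Type*} [NonUnitalCStarAlgebra B] {P : V → B} {S : E → B}
    (h : G.IsCKFamily P S) (e : E) : ‖S e‖ ≤ 1 := by
  have h1 : ‖S e‖ * ‖S e‖ ≤ 1 := by
    rw [← CStarRing.norm_star_mul_self, h.star_mul_self]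
    exact h.norm_proj_le _
  nlinarith [norm_nonneg (S e)]

/-- The seminorm on formal `*`-polynomials that a Cuntz-Krieger family defines. -/
def CKFamily.seminorm (F : G.CKFamily) (t : StarPoly V E) : ℝ := ‖t.eval F.P F.S‖

/-- The set of all seminorms that Cuntz-Krieger families define. -/
abbrev CKIndex : Type u := {ν : StarPoly V E → ℝ // ∃ F : G.CKFamily, F.seminorm = ν}

/-- A Cuntz-Krieger family that defines a given seminorm. -/
def ckRep (i : G.CKIndex) : G.CKFamily := i.2.choose

theorem ckRep_seminorm (i : G.CKIndex) : (G.ckRep i).seminorm = i.1 := i.2.choose_spec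

/-- The C⋆-algebra of bounded families in the product of sufficiently many C⋆-algebras that
are equipped with a Cuntz-Krieger family. -/
abbrev CKProd : Type u := lp (fun i : G.CKIndex => (G.ckRep i).carrier) ∞

/-- The vertex projections of the direct sum of the Cuntz-Krieger families. -/
def ckProdP (x : V) : G.CKProd :=
  ⟨fun i => (G.ckRep i).P x, memℓp_infty ⟨1, by
    rintro _ ⟨i, rfl⟩
    exact (G.ckRep i).isCK.norm_proj_le x⟩⟩

/-- The edge partial isometries of the direct sum of the Cuntz-Krieger families. -/
def ckProdS (e : E) : G.CKProd :=
  ⟨fun i => (G.ckRep i).S e, memℓp_infty ⟨1, by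
    rintro _ ⟨i, rfl⟩
    exact (G.ckRep i).isCK.norm_edge_le e⟩⟩

/-- The C⋆-algebra that the direct sum of the Cuntz-Krieger families generates. -/
def ckSubalgebra : NonUnitalStarSubalgebra ℂ G.CKProd :=
  (NonUnitalStarAlgebra.adjoin ℂ (Set.range G.ckProdP ∪ Set.range G.ckProdS)).topologicalClosure

/-- The Cuntz-Krieger algebra `𝒪(G)`, universal for Cuntz-Krieger `G`-families: see
`existsUnique_ckLift`. -/
def CKAlgebra : Type u := G.ckSubalgebra

instance : NonUnitalCStarAlgebra G.CKAlgebra :=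
  NonUnitalStarSubalgebra.nonUnitalCStarAlgebra G.ckSubalgebra
    (h_closed := NonUnitalStarSubalgebra.isClosed_topologicalClosure _)

instance : PartialOrder G.CKAlgebra := CStarAlgebra.spectralOrder _

instance : StarOrderedRing G.CKAlgebra := CStarAlgebra.spectralOrderedRing _

/-- The vertex projections of the universal Cuntz-Krieger family. -/
def ckP (x : V) : G.CKAlgebra :=
  ⟨G.ckProdP x, NonUnitalStarSubalgebra.le_topologicalClosure _
    (NonUnitalStarAlgebra.subset_adjoin ℂ _ (Or.inl ⟨x, rfl⟩))⟩

/-- The edge partial isometries of the universal Cuntz-Krieger family. -/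
def ckS (e : E) : G.CKAlgebra :=
  ⟨G.ckProdS e, NonUnitalStarSubalgebra.le_topologicalClosure _
    (NonUnitalStarAlgebra.subset_adjoin ℂ _ (Or.inr ⟨e, rfl⟩))⟩

theorem coe_ckProdP (x : V) (i : G.CKIndex) : (G.ckProdP x) i = (G.ckRep i).P x := rfl

theorem coe_ckProdS (e : E) (i : G.CKIndex) : (G.ckProdS e) i = (G.ckRep i).S e := rfl

/-- Evaluation at a coordinate of the product. -/
def ckCoord (i : G.CKIndex) : G.CKProd →⋆ₙₐ[ℂ] (G.ckRep i).carrier where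
  toFun f := f i
  map_smul' _ _ := rfl
  map_zero' := rfl
  map_add' _ _ := rfl
  map_mul' _ _ := rfl
  map_star' _ := rfl

theorem ckProd_isCK : G.IsCKFamily G.ckProdP G.ckProdS where
  isProj x := ⟨lp.ext (funext fun i => ((G.ckRep i).isCK.isProj x).1),
    lp.ext (funext fun i => ((G.ckRep i).isCK.isProj x).2)⟩
  partialIsometry e := lp.ext (funext fun i => (G.ckRep i).isCK.partialIsometry e)
  orthogonal x y h := lp.ext (funext fun i => (G.ckRep i).isCK.orthogonal x y h)
  star_mul_of_ne e f h := lp.ext (funext fun i => (G.ckRep i).isCK.star_mul_of_ne e f h)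
  star_mul_self e := lp.ext (funext fun i => (G.ckRep i).isCK.star_mul_self e)
  sum_eq x h := lp.ext (funext fun i => by
    refine Eq.trans ?_ ((G.ckRep i).isCK.sum_eq x h)
    exact (AddMonoidHomClass.toAddMonoidHom (G.ckCoord i)).map_finsum_mem _ (Set.toFinite _))

/-- The generators of `𝒪(G)` form a Cuntz-Krieger family. -/
theorem isCKFamily_ck : G.IsCKFamily G.ckP G.ckS where
  isProj x := ⟨Subtype.ext (G.ckProd_isCK.isProj x).1, Subtype.ext (G.ckProd_isCK.isProj x).2⟩
  partialIsometry e := Subtype.ext (G.ckProd_isCK.partialIsometry e)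
  orthogonal x y h := Subtype.ext (G.ckProd_isCK.orthogonal x y h)
  star_mul_of_ne e f h := Subtype.ext (G.ckProd_isCK.star_mul_of_ne e f h)
  star_mul_self e := Subtype.ext (G.ckProd_isCK.star_mul_self e)
  sum_eq x h := Subtype.ext (by
    refine Eq.trans ?_ (G.ckProd_isCK.sum_eq x h)
    exact (AddMonoidHomClass.toAddMonoidHom (NonUnitalStarSubalgebraClass.subtype G.ckSubalgebra)).map_finsum_mem _ (Set.toFinite _))

theorem norm_eval_le {B : Type u} [NonUnitalCStarAlgebra B] {P : V → B} {S : E → B}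
    (h : G.IsCKFamily P S) (t : StarPoly V E) :
    ‖t.eval P S‖ ≤ ‖t.eval G.ckProdP G.ckProdS‖ := by
  let F : G.CKFamily := ⟨B, P, S, h⟩
  let i : G.CKIndex := ⟨F.seminorm, F, rfl⟩
  have h1 : CKFamily.seminorm G (G.ckRep i) t = ‖t.eval P S‖ := congrFun (G.ckRep_seminorm i) t
  have h2 := lp.norm_apply_le_norm (ENNReal.top_ne_zero) (t.eval G.ckProdP G.ckProdS) i
  have h3 := StarPoly.map_eval (G.ckCoord i) G.ckProdP G.ckProdS t
  rw [← h1]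
  refine le_trans (le_of_eq ?_) h2
  exact congrArg norm h3.symm

/-- The universal property of `𝒪(G)`. -/
theorem existsUnique_ckLift {B : Type u} [NonUnitalCStarAlgebra B] {P : V → B} {S : E → B}
    (h : G.IsCKFamily P S) :
    ∃! φ : G.CKAlgebra →⋆ₙₐ[ℂ] B, (∀ x, φ (G.ckP x) = P x) ∧ ∀ e, φ (G.ckS e) = S e := by
  let P₂ : V → G.CKProd × B := fun x => (G.ckProdP x, P x)
  let S₂ : E → G.CKProd × B := fun e => (G.ckProdS e, S e)
  let D₀ := NonUnitalStarAlgebra.adjoin ℂ (Set.range P₂ ∪ Set.range S₂)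
  let D := D₀.topologicalClosure
  have hDc : IsClosed (D : Set (G.CKProd × B)) := D₀.isClosed_topologicalClosure
  let _ : NonUnitalCStarAlgebra D := NonUnitalStarSubalgebra.nonUnitalCStarAlgebra D (h_closed := hDc)
  let f₁ : G.CKProd × B →⋆ₙₐ[ℂ] G.CKProd := NonUnitalStarAlgHom.fst ℂ _ _
  let f₂ : G.CKProd × B →⋆ₙₐ[ℂ] B := NonUnitalStarAlgHom.snd ℂ _ _
  have hnorm : ∀ d ∈ D, ‖d.2‖ ≤ ‖d.1‖ := by
    intro d hd
    refine closure_minimal (t := {d : G.CKProd × B | ‖d.2‖ ≤ ‖d.1‖}) ?_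
      (isClosed_le (by fun_prop) (by fun_prop)) hd
    intro d hd
    obtain ⟨t, rfl⟩ := StarPoly.exists_eval P₂ S₂ hd
    have e1 := StarPoly.map_eval f₁ P₂ S₂ t
    have e2 := StarPoly.map_eval f₂ P₂ S₂ t
    change ‖f₂ (t.eval P₂ S₂)‖ ≤ ‖f₁ (t.eval P₂ S₂)‖
    rw [e1, e2]
    exact G.norm_eval_le h t
  let ι : D →⋆ₙₐ[ℂ] G.CKProd × B := NonUnitalStarSubalgebraClass.subtype D
  let g : D →⋆ₙₐ[ℂ] G.CKProd := f₁.comp ι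
  have hgn : ∀ d : D, ‖g d‖ = ‖d‖ := fun d => by
    change ‖d.1.1‖ = max ‖d.1.1‖ ‖d.1.2‖
    exact (max_eq_left (hnorm _ d.2)).symm
  have hgi : Isometry g := AddMonoidHomClass.isometry_of_norm g hgn
  have hP₂ : ∀ x, P₂ x ∈ D := fun x => subset_closure
    (NonUnitalStarAlgebra.subset_adjoin ℂ _ (Or.inl ⟨x, rfl⟩))
  have hS₂ : ∀ e, S₂ e ∈ D := fun e => subset_closure
    (NonUnitalStarAlgebra.subset_adjoin ℂ _ (Or.inr ⟨e, rfl⟩))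
  have hle : G.ckSubalgebra ≤ NonUnitalStarAlgHom.range g := by
    refine NonUnitalStarSubalgebra.topologicalClosure_minimal _ ?_ ?_
    · refine NonUnitalStarAlgebra.adjoin_le ?_
      rintro _ (⟨x, rfl⟩ | ⟨e, rfl⟩)
      · exact ⟨⟨P₂ x, hP₂ x⟩, rfl⟩
      · exact ⟨⟨S₂ e, hS₂ e⟩, rfl⟩
    · exact hgi.isClosedEmbedding.isClosed_range
  let j : G.CKAlgebra →⋆ₙₐ[ℂ] G.CKProd := NonUnitalStarSubalgebraClass.subtype G.ckSubalgebra
  have hinj : Function.Injective g := hgi.injective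
  choose k hk' using fun a : G.CKAlgebra => hle a.2
  have hk : ∀ a, g (k a) = j a := hk'
  let φ : G.CKAlgebra →⋆ₙₐ[ℂ] B :=
    { toFun := fun a => (k a).1.2
      map_smul' := fun c a => by
        have : k (c • a) = c • k a := hinj (by rw [map_smul, hk, hk, map_smul])
        rw [this]; rfl
      map_zero' := by
        have : k 0 = 0 := hinj (by rw [map_zero, hk, map_zero])
        rw [this]; rfl
      map_add' := fun a b => by
        have : k (a + b) = k a + k b :=
          hinj (by rw [map_add, hk, hk, hk, map_add])
        rw [this]; rfl
      map_mul' := fun a b => by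
        have : k (a * b) = k a * k b :=
          hinj (by rw [map_mul, hk, hk, hk, map_mul])
        rw [this]; rfl
      map_star' := fun a => by
        have : k (star a) = star (k a) :=
          hinj (by rw [map_star, hk, hk, map_star])
        rw [this]; rfl }
  have hφ : (∀ x, φ (G.ckP x) = P x) ∧ ∀ e, φ (G.ckS e) = S e := by
    refine ⟨fun x => ?_, fun e => ?_⟩
    · have : k (G.ckP x) = ⟨P₂ x, hP₂ x⟩ := hinj (hk _)
      change (k (G.ckP x)).1.2 = _
      rw [this]
    · have : k (G.ckS e) = ⟨S₂ e, hS₂ e⟩ := hinj (hk _)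
      change (k (G.ckS e)).1.2 = _
      rw [this]
  refine ⟨φ, hφ, fun ψ hψ => ?_⟩
  let M : NonUnitalStarSubalgebra ℂ G.CKAlgebra := NonUnitalStarAlgHom.equalizer ψ φ
  have hM : IsClosed (M : Set G.CKAlgebra) := isClosed_eq
    (AddMonoidHomClass.continuous_of_bound ψ 1 fun a => by
      simpa using NonUnitalStarAlgHom.norm_apply_le ψ a)
    (AddMonoidHomClass.continuous_of_bound φ 1 fun a => by
      simpa using NonUnitalStarAlgHom.norm_apply_le φ a)
  have hjc : Topology.IsClosedEmbedding j :=
    (NonUnitalStarSubalgebra.isClosed_topologicalClosure _).isClosedEmbedding_subtypeVal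
  have hle' : G.ckSubalgebra ≤ M.map j := by
    refine NonUnitalStarSubalgebra.topologicalClosure_minimal _ ?_ ?_
    · refine NonUnitalStarAlgebra.adjoin_le ?_
      rintro _ (⟨x, rfl⟩ | ⟨e, rfl⟩)
      · exact ⟨G.ckP x, (hψ.1 x).trans (hφ.1 x).symm, rfl⟩
      · exact ⟨G.ckS e, (hψ.2 e).trans (hφ.2 e).symm, rfl⟩
    · exact hjc.isClosedMap _ hM
  ext a
  obtain ⟨b, hb, hba⟩ := hle' a.2
  have : b = a := hjc.injective hba
  exact this ▸ hb

end Universal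

/-! ### Periodic weighted shifts and the algebras `𝒜(n)` and `ℬ(n)` -/

/-- The Hilbert space `ℓ²(E^*)`. -/
abbrev FockSpace : Type u := lp (fun _ : G.Path => ℂ) 2

open Classical in
/-- The vectors `ξ_w` of the standard orthonormal basis. -/
def xi (w : G.Path) : G.FockSpace := lp.single 2 w 1

/-- `(T_e)` is the weighted shift on `ℓ²(E^*)` with weights `lam`: `T_e ξ_w = λ(ew) ξ_{ew}` if
`s(e) = r(w)`, and `T_e ξ_w = 0` otherwise. The values of `lam` at vertices play no role. -/
def IsWeightedShift (lam : G.Path → ℂ) (T : E → G.FockSpace →L[ℂ] G.FockSpace) : Prop :=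
  ∀ e w, (∀ h : G.src e = w.range, T e (G.xi w) = lam (w.cons e h) • G.xi (w.cons e h)) ∧
    (G.src e ≠ w.range → T e (G.xi w) = 0)

/-- The weights are of period `n`: `λ(ew)` depends on `w` only through `w(n)`. If `|ew|` is not
a multiple of `n` this says `λ(ew) = λ((ew)(n))`, since then `(ew)(n) = e w(n)`; if it is, then
`e w(n)` is the remainder of length `n` of `ew`. -/
def IsPeriodic (n : ℕ) (lam : G.Path → ℂ) : Prop :=
  ∀ e (w : G.Path) (h : G.src e = w.range),
    lam (w.cons e h) = lam ((w.rem n).cons e (h.trans (w.range_rem n).symm))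

/-- `𝒜(n)`, the C⋆-algebra generated by the operators of all weighted shifts of period `n`. -/
def shiftAlgebra (n : ℕ) : NonUnitalStarSubalgebra ℂ (G.FockSpace →L[ℂ] G.FockSpace) :=
  (NonUnitalStarAlgebra.adjoin ℂ
    {A | ∃ lam T e, G.IsPeriodic n lam ∧ G.IsWeightedShift lam T ∧ A = T e}).topologicalClosure

/-- The projection `R_x` onto the closed span of the vectors `ξ_w` with `s(w) = x`. -/
def sourceProj (x : V) : G.FockSpace →L[ℂ] G.FockSpace :=
  (Submodule.span ℂ {f | ∃ w : G.Path, w.source = x ∧ f = G.xi w}).topologicalClosure.starProjection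

/-- Membership in `𝔎_E = ⊕_x R_x 𝔎 R_x`, where `𝔎` is the set of compact operators. -/
def IsBlockCompact [Fintype V] (A : G.FockSpace →L[ℂ] G.FockSpace) : Prop :=
  ∃ K : V → G.FockSpace →L[ℂ] G.FockSpace, (∀ x, IsCompactOperator (K x)) ∧
    A = ∑ x, G.sourceProj x * K x * G.sourceProj x

theorem ext_xi {A B : G.FockSpace →L[ℂ] G.FockSpace} (h : ∀ w, A (G.xi w) = B (G.xi w)) :
    A = B := by
  classical
  ext1 f
  have hf := lp.hasSum_single (E := fun _ : G.Path => ℂ) ENNReal.ofNat_ne_top f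
  have hs : ∀ w, lp.single (E := fun _ : G.Path => ℂ) 2 w (f w) = f w • G.xi w := fun w => by
    rw [xi, ← lp.single_smul, smul_eq_mul, mul_one]
  have hA := hf.mapL A
  have hB := hf.mapL B
  refine hA.unique ?_
  convert hB using 2 with w
  rw [hs, map_smul, map_smul, h]

theorem sourceProj_xi_self (w : G.Path) : G.sourceProj w.source (G.xi w) = G.xi w :=
  Submodule.starProjection_eq_self_iff.2
    (Submodule.le_topologicalClosure _ (Submodule.subset_span ⟨w, rfl, rfl⟩))

theorem inner_xi_of_ne {v w : G.Path} (h : v ≠ w) : inner ℂ (G.xi v) (G.xi w) = 0 := by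
  classical
  rw [xi, lp.inner_single_left, xi]
  have : (lp.single (E := fun _ : G.Path => ℂ) 2 w (1 : ℂ)) v = 0 := lp.single_apply_ne _ _ _ h
  refine (congrArg (inner ℂ (1 : ℂ)) this).trans (inner_zero_right _)

theorem sourceProj_xi_of_ne {x : V} {w : G.Path} (h : w.source ≠ x) :
    G.sourceProj x (G.xi w) = 0 := by
  rw [sourceProj, Submodule.starProjection_apply_eq_zero_iff, Submodule.orthogonal_closure,
    Submodule.mem_orthogonal]
  intro f hf
  induction hf using Submodule.span_induction with
  | mem f hf =>
    obtain ⟨v, hv, rfl⟩ := hf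
    exact G.inner_xi_of_ne (fun e => h (e ▸ hv))
  | zero => simp
  | add f g _ _ hf hg => rw [inner_add_left, hf, hg, add_zero]
  | smul c f _ hf => rw [inner_smul_left, hf, mul_zero]

theorem star_sourceProj (x : V) : star (G.sourceProj x) = G.sourceProj x :=
  isSelfAdjoint_starProjection _

theorem shift_commute {lam : G.Path → ℂ} {T : E → G.FockSpace →L[ℂ] G.FockSpace}
    (hT : G.IsWeightedShift lam T) (e : E) (x : V) :
    G.sourceProj x * T e = T e * G.sourceProj x := by
  refine G.ext_xi fun w => ?_
  change G.sourceProj x (T e (G.xi w)) = T e (G.sourceProj x (G.xi w))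
  by_cases h : G.src e = w.range
  · rw [(hT e w).1 h, map_smul]
    by_cases hx : w.source = x
    · subst hx
      have := G.sourceProj_xi_self (w.cons e h)
      rw [G.sourceProj_xi_self w, (hT e w).1 h]
      exact congrArg _ this
    · have : G.sourceProj x (G.xi (w.cons e h)) = 0 := G.sourceProj_xi_of_ne hx
      rw [this, G.sourceProj_xi_of_ne hx, map_zero, smul_zero]
  · rw [(hT e w).2 h, map_zero]
    by_cases hx : w.source = x
    · subst hx
      rw [G.sourceProj_xi_self w, (hT e w).2 h]
    · rw [G.sourceProj_xi_of_ne hx, map_zero]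

theorem shiftAlgebra_commute (n : ℕ) {A : G.FockSpace →L[ℂ] G.FockSpace}
    (hA : A ∈ G.shiftAlgebra n) (x : V) : G.sourceProj x * A = A * G.sourceProj x := by
  have hle : G.shiftAlgebra n ≤ NonUnitalStarSubalgebra.centralizer ℂ {G.sourceProj x} := by
    refine NonUnitalStarSubalgebra.topologicalClosure_minimal _ ?_ (Set.isClosed_centralizer _)
    refine NonUnitalStarAlgebra.adjoin_le ?_
    rintro _ ⟨lam, T, e, -, hT, rfl⟩
    rw [SetLike.mem_coe, NonUnitalStarSubalgebra.mem_centralizer_iff]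
    rintro _ rfl
    rw [star_sourceProj]
    exact ⟨G.shift_commute hT e x, G.shift_commute hT e x⟩
  exact ((NonUnitalStarSubalgebra.mem_centralizer_iff ℂ).1 (hle hA) _ rfl).1

/-- The ideal `𝔎_E` of `𝒜(n)`: the elements of `𝒜(n)` that lie in `⊕_x R_x 𝔎 R_x`. (In fact
`𝒜(n)` contains all of `⊕_x R_x 𝔎 R_x`, as it contains the unweighted shifts.) -/
def compactIdeal [Fintype V] (n : ℕ) : StarIdeal (G.shiftAlgebra n) where
  carrier := {A | G.IsBlockCompact A}
  zero_mem' := ⟨0, fun _ => isCompactOperator_zero, by simp⟩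
  add_mem' := by
    rintro A B ⟨K, hK, hA⟩ ⟨L, hL, hB⟩
    refine ⟨K + L, fun x => (hK x).add (hL x), ?_⟩
    simp [hA, hB, mul_add, add_mul, Finset.sum_add_distrib]
  smul_mem' := by
    rintro c A ⟨K, hK, hA⟩
    refine ⟨c • K, fun x => (hK x).smul c, ?_⟩
    simp [hA, Finset.smul_sum]
  mul_mem_left := by
    rintro A B ⟨K, hK, hB⟩
    refine ⟨fun x => A.1 * K x, fun x => (hK x).clm_comp A.1, ?_⟩
    change A.1 * B.1 = _
    rw [hB, Finset.mul_sum]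
    refine Finset.sum_congr rfl fun x _ => ?_
    simp only [← mul_assoc]
    rw [G.shiftAlgebra_commute n A.2]
  mul_mem_right := by
    rintro A B ⟨K, hK, hB⟩
    refine ⟨fun x => K x * A.1, fun x => (hK x).comp_clm A.1, ?_⟩
    change B.1 * A.1 = _
    rw [hB, Finset.sum_mul]
    refine Finset.sum_congr rfl fun x _ => ?_
    simp only [mul_assoc]
    rw [G.shiftAlgebra_commute n A.2]
  star_mem := by
    rintro B ⟨K, hK, hB⟩
    refine ⟨fun x => star (K x), fun x => isCompactOperator_star (hK x), ?_⟩
    change star B.1 = _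
    rw [hB, star_sum]
    refine Finset.sum_congr rfl fun x _ => ?_
    simp only [star_mul, star_sourceProj, mul_assoc]

/-- `ℬ(n) = 𝒜(n) / 𝔎_E`. -/
abbrev BunceDeddens [Fintype V] (n : ℕ) : Type u := (G.compactIdeal n).Quotient

/-! ### The corner of the matrix algebra -/

/-- The index set of `M_{d_E(n)}`, divided into blocks of size `d_E(n, x)`. -/
abbrev BlockIndex (n : ℕ) : Type u := Σ x : V, Fin (G.numPaths n x)

open Classical in
/-- The projection `⊕_x p_x^{(d_E(n, x))}` in `M_{d_E(n)}(𝒪(E(=n)))`. -/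
def cornerProj [Fintype V] [Finite E] (n : ℕ) :
    CStarMatrix (G.BlockIndex n) (G.BlockIndex n) (G.powGraph n).CKAlgebra :=
  CStarMatrix.ofMatrix (Matrix.diagonal fun k => (G.powGraph n).ckP k.1)

theorem isSelfAdjoint_cornerProj [Fintype V] [Finite E] (n : ℕ) :
    IsSelfAdjoint (G.cornerProj n) := by
  classical
  ext i j
  rw [CStarMatrix.star_apply, cornerProj, CStarMatrix.ofMatrix_apply, CStarMatrix.ofMatrix_apply]
  by_cases h : i = j
  · subst h
    rw [Matrix.diagonal_apply_eq]
    exact ((G.powGraph n).isCKFamily_ck.isProj i.1).2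
  · rw [Matrix.diagonal_apply_ne _ h, Matrix.diagonal_apply_ne _ (Ne.symm h), star_zero]

/-- The algebra `(⊕_x p_x^{(d_E(n, x))}) M_{d_E(n)}(𝒪(E(=n))) (⊕_x p_x^{(d_E(n, x))})`. -/
abbrev cornerAlgebra [Fintype V] [Finite E] (n : ℕ) : NonUnitalStarSubalgebra ℂ
    (CStarMatrix (G.BlockIndex n) (G.BlockIndex n) (G.powGraph n).CKAlgebra) :=
  corner (G.cornerProj n) (G.isSelfAdjoint_cornerProj n)

end DirGraph

end

/-! Both isomorphisms come from 𝒪(E(n)), which is shown to be isomorphic to ℬ(n) and to the corner.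

For ℬ(n): the elementary shifts `stepOp`, sending ξ_v to ξ_{ev} when v(n) = w, and the projections
`remProj` satisfy the Cuntz-Krieger relations of E(n), except that the sum relation at w misses a
finite-rank projection onto vectors of vertices. Periodic weights depend only on the edge (e, v(n))
of E(n), so every T_e is a linear combination of elementary shifts, and 𝒪(E(n)) maps onto ℬ(n).

That this map is isometric is an averaging argument, with no uniqueness theorem for graph algebras.
Let t be a `*`-polynomial, A its value at the elementary shifts and s its value at the generators of
𝒪(E(n)). For long paths v, A ξ_v and s s_v are the same combination of vectors ξ_p and partial
isometries s_p respectively, with lengths changed by at most some d (`isLocalPair_eval`). Since E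
has no sources, the projections s_v s_v^* over one full period of lengths sum to the unit
(`sum_sum_level`). Summing s s_v s_v^* over L periods therefore writes L s as ∑ c_{pv} s_p s_v^*,
where c is a compression of A to long paths and p ranges over L + 2d periods. A Cauchy-Schwarz
inequality (`norm_sum_inner_smul_mul_star_sq_le`) bounds its squared norm by ‖A T_M‖² (L + 2d) L,
with T_M the projection onto paths of length at least M. Letting L tend to infinity gives ‖s‖ ≤ ‖A
T_M‖ for all M, and these bounds pass to the quotient norm of A.

For the corner: universality gives Φ from 𝒪(E(n)) to matrices over 𝒪(E(=n)), and ψ from 𝒪(E(=n)) to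
𝒪(E(n)). With s_i the partial isometry of the i-th path of length less than n, one has ψ(Φ(s)_{ij})
= s_i^* s s_j (`apply_entry`), and Φ(ψ(b)) is b compressed to the indices of the vertices
(`entry_map`). As ∑ s_i s_i^* is the unit, the first identity makes Φ injective; the second exhibits
a matrix a of the corner as the image of ∑ s_i ψ(a_{ij}) s_j^*. -/

noncomputable section

/-! ### Quotients by closed ideals as C⋆-algebras -/

namespace StarIdeal

variable {A : Type u} [NonUnitalCStarAlgebra A] (I : StarIdeal A)

/-- The quotient map as a `*`-homomorphism. -/
def Quotient.mkHom : A →⋆ₙₐ[ℂ] I.Quotient where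
  toFun := Quotient.mk I
  map_smul' := map_smul (Quotient.mk I)
  map_zero' := map_zero (Quotient.mk I)
  map_add' := map_add (Quotient.mk I)
  map_mul' := Quotient.mk_mul I
  map_star' := Quotient.mk_star I

/-- The quotient of a C⋆-algebra by a closed self-adjoint ideal that has a right approximate unit
of a special form is a C⋆-algebra. -/
@[reducible]
def quotientCStarAlgebra (hI : IsClosed (I.toSubmodule : Set A)) (p : ℕ → A)
    (hp : ∀ k, IsStarProjection (p k)) (hpI : ∀ k a, a - a * p k ∈ I.toSubmodule)
    (hlim : ∀ x ∈ I.toSubmodule, Filter.Tendsto (fun k => x * p k) Filter.atTop (nhds 0)) :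
    NonUnitalCStarAlgebra I.Quotient :=
  letI nacg : NormedAddCommGroup I.Quotient :=
    haveI := hI
    inferInstanceAs (NormedAddCommGroup (A ⧸ I.toSubmodule))
  have norm_lt : ∀ (x : I.Quotient) {ε : ℝ}, 0 < ε → ∃ a : A, Quotient.mk I a = x ∧ ‖a‖ < ‖x‖ + ε :=
    fun x ε hε => Submodule.Quotient.norm_mk_lt (S := I.toSubmodule) x hε
  have norm_le : ∀ a : A, ‖Quotient.mk I a‖ ≤ ‖a‖ :=
    fun a => Submodule.Quotient.norm_mk_le I.toSubmodule a
  letI nnr : NonUnitalNormedRing I.Quotient :=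
    { (inferInstance : NonUnitalRing I.Quotient), nacg with
      norm_mul_le := fun x y => by
        refine le_of_forall_pos_le_add fun ε hε => ?_
        -- Lifts of norm below ‖x‖ + δ and ‖y‖ + δ will be multiplied; continuity in δ supplies a δ
        -- > 0 that costs at most ε.
        have hc : Filter.Tendsto (fun δ : ℝ => (‖x‖ + δ) * (‖y‖ + δ)) (nhdsWithin 0 (Set.Ioi 0))
            (nhds ((‖x‖ + 0) * (‖y‖ + 0))) :=
          tendsto_nhdsWithin_of_tendsto_nhds (Continuous.tendsto (by fun_prop) _)
        have h1 := hc.eventually_lt_const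
          (show (‖x‖ + 0) * (‖y‖ + 0) < ‖x‖ * ‖y‖ + ε by simpa)
        obtain ⟨δ, hδ, hδ0⟩ := (h1.and self_mem_nhdsWithin).exists
        obtain ⟨a, rfl, ha⟩ := norm_lt x hδ0
        obtain ⟨b, rfl, hb⟩ := norm_lt y hδ0
        rw [← Quotient.mk_mul]
        refine (norm_le _).trans ((norm_mul_le a b).trans (le_trans ?_ hδ.le))
        gcongr }
  haveI : CompleteSpace I.Quotient := inferInstanceAs (CompleteSpace (A ⧸ I.toSubmodule))
  haveI : CStarRing I.Quotient :=
    { norm_mul_self_le := fun x => by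
        obtain ⟨a, rfl⟩ := Quotient.mk_surjective I x
        refine le_of_forall_pos_le_add fun ε hε => ?_
        obtain ⟨b, hb, hb'⟩ := norm_lt (star (Quotient.mk I a) * Quotient.mk I a) (half_pos hε)
        rw [← Quotient.mk_star, ← Quotient.mk_mul] at hb hb'
        have hx : star a * a - b ∈ I.toSubmodule := (Quotient.mk_eq_mk I).1 hb.symm
        -- The lift a may be replaced by a p_k, with ‖a p_k‖² = ‖p_k a^* a p_k‖. Here a^* a differs
        -- from its nearly norm-minimal lift b by an element of the ideal, which a suitable p_k
        -- makes small.
        obtain ⟨k, hk⟩ := ((hlim _ hx).norm.eventually_lt_const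
          (show ‖(0 : A)‖ < ε / 2 by rw [norm_zero]; exact half_pos hε)).exists
        have e : Quotient.mk I a = Quotient.mk I (a * p k) := (Quotient.mk_eq_mk I).2 (hpI k a)
        have hpk := (hp k).norm_le
        calc ‖Quotient.mk I a‖ * ‖Quotient.mk I a‖ ≤ ‖a * p k‖ * ‖a * p k‖ := by
              rw [e]; gcongr <;> exact norm_le _
          _ = ‖p k * (star a * a * p k)‖ := by
              rw [← CStarRing.norm_star_mul_self, star_mul, (hp k).2.star_eq]
              simp only [mul_assoc]
          _ ≤ 1 * ‖star a * a * p k‖ := (norm_mul_le _ _).trans (by gcongr)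
          _ = ‖b * p k + (star a * a - b) * p k‖ := by rw [one_mul, ← add_mul]; simp
          _ ≤ ‖b‖ * 1 + ε / 2 := by
              refine (norm_add_le _ _).trans (add_le_add ((norm_mul_le _ _).trans ?_) hk.le)
              gcongr
          _ ≤ ‖star (Quotient.mk I a) * Quotient.mk I a‖ + ε := by
              rw [← Quotient.mk_star, ← Quotient.mk_mul]; linarith }
  letI : NormedSpace ℂ I.Quotient :=
    { (inferInstance : Module ℂ I.Quotient) with
      norm_smul_le := fun c x => norm_smul_le (β := A ⧸ I.toSubmodule) c x }
  haveI : IsScalarTower ℂ I.Quotient I.Quotient := ⟨fun c x y => by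
    obtain ⟨x, rfl⟩ := Quotient.mk_surjective I x
    obtain ⟨y, rfl⟩ := Quotient.mk_surjective I y
    simp only [smul_eq_mul, ← Quotient.mk_mul, ← map_smul, smul_mul_assoc]⟩
  haveI : SMulCommClass ℂ I.Quotient I.Quotient := ⟨fun c x y => by
    obtain ⟨x, rfl⟩ := Quotient.mk_surjective I x
    obtain ⟨y, rfl⟩ := Quotient.mk_surjective I y
    simp only [smul_eq_mul, ← Quotient.mk_mul, ← map_smul, mul_smul_comm]⟩
  haveI : StarModule ℂ I.Quotient := ⟨fun c x => by
    obtain ⟨x, rfl⟩ := Quotient.mk_surjective I x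
    simp only [← Quotient.mk_star, ← map_smul, star_smul]⟩
  { toNonUnitalNormedRing := nnr
    toStarRing := inferInstance
    complete := CompleteSpace.complete
    norm_mul_self_le := CStarRing.norm_mul_self_le
    toNormedSpace := inferInstance
    smul_assoc := smul_assoc
    smul_comm := smul_comm
    star_smul := star_smul }

end StarIdeal
end

noncomputable section

namespace DirGraph

variable {V E : Type u} {G : DirGraph V E}

/-! ### Paths and their remainders -/

namespace Path

/-- A vertex, viewed as a path of length `0`. -/
def vertex (x : V) : G.Path := ⟨x, [], trivial⟩

theorem cons_inj {e e' : E} {v v' : G.Path} {h : G.src e = v.range} {h' : G.src e' = v'.range} :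
    cons e v h = cons e' v' h' ↔ e = e' ∧ v = v' := by
  rw [Path.ext_iff, Path.ext_iff (x := v)]
  simp only [cons, List.cons.injEq]
  tauto

theorem length_cons (e : E) (v : G.Path) (h : G.src e = v.range) :
    (cons e v h).length = v.length + 1 := rfl

theorem source_cons (e : E) (v : G.Path) (h : G.src e = v.range) :
    (cons e v h).source = v.source := rfl

theorem length_vertex (x : V) : (vertex x : G.Path).length = 0 := rfl

@[elab_as_elim]
theorem cons_induction {motive : G.Path → Prop} (vertex : ∀ x, motive (vertex x))
    (cons : ∀ e v h, motive v → motive (cons e v h)) (v : G.Path) : motive v := by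
  obtain ⟨x, l, h⟩ := v
  induction l with
  | nil => exact vertex x
  | cons e l ih => exact cons e ⟨x, l, h.2⟩ h.1 (ih h.2)

theorem eq_vertex_or_eq_cons (v : G.Path) :
    (∃ x, v = vertex x) ∨ ∃ e w h, v = cons e w h := by
  induction v using cons_induction with
  | vertex x => exact Or.inl ⟨x, rfl⟩
  | cons e v h _ => exact Or.inr ⟨e, v, h, rfl⟩

theorem eq_vertex_of_length_eq_zero {v : G.Path} (hv : v.length = 0) : v = vertex v.source := by
  rcases v.eq_vertex_or_eq_cons with ⟨x, rfl⟩ | ⟨e, w, h, rfl⟩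
  · rfl
  · exact absurd hv (Nat.succ_ne_zero _)

theorem length_rem (v : G.Path) (n : ℕ) : (v.rem n).length = v.length % n := by
  simp only [rem, length, List.length_take]
  exact min_eq_left (Nat.mod_le _ _)

theorem rem_of_lt {v : G.Path} {n : ℕ} (h : v.length < n) : v.rem n = v := by
  have h1 : v.length % n = v.length := Nat.mod_eq_of_lt h
  ext1
  · simp only [rem, h1]
    simp [length, finish]
  · simp only [rem, h1]
    simp [length]

end Path

variable {n : ℕ} (hn : 1 ≤ n)

/-- The remainder `v(n)` of a path, as a path of length less than `n`. -/
def remLT (v : G.Path) : G.PathLT n :=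
  ⟨v.rem n, by rw [Path.length_rem]; exact Nat.mod_lt _ hn⟩

/-- The edge `(e, v(n))` of `E(n)`. -/
def stepOf (e : E) (v : G.Path) (h : G.src e = v.range) : G.StepEdge n :=
  ⟨(e, remLT hn v), h.trans (v.range_rem n).symm⟩

theorem remLT_coe (w : G.PathLT n) : remLT hn w.1 = w := Subtype.ext (Path.rem_of_lt w.2)

theorem range_remLT (v : G.Path) : (remLT hn v).1.range = v.range := v.range_rem n

theorem length_remLT (v : G.Path) : (remLT hn v).1.length = v.length % n := v.length_rem n

theorem src_stepOf (e : E) (v : G.Path) (h : G.src e = v.range) :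
    (G.stepGraph n).src (stepOf hn e v h) = remLT hn v := rfl

/-- Prepending an edge advances the length modulo n by one, and E(n) returns to a vertex exactly
when the remainder is full. Thus v ↦ v(n) turns prepending edges in E into walking in E(n). -/
theorem rng_stepOf (e : E) (v : G.Path) (h : G.src e = v.range) :
    (G.stepGraph n).rng (stepOf hn e v h) = remLT hn (v.cons e h) := by
  have hl := Path.length_rem v n
  have hmod : (v.cons e h).length % n = if v.length % n + 1 < n then v.length % n + 1 else 0 := by
    rw [Path.length_cons, Nat.add_mod]
    -- The case n = 1 is separate because 1 % n is 1 only for n > 1.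
    rcases hn.eq_or_lt with rfl | h1
    · simp [Nat.mod_one]
    · rw [Nat.mod_eq_of_lt h1]
      split_ifs with h2
      · exact Nat.mod_eq_of_lt h2
      · have h3 := Nat.mod_lt v.length hn
        rw [show v.length % n + 1 = n by omega, Nat.mod_self]
  apply Subtype.ext
  simp only [stepGraph, stepOf, remLT]
  split_ifs with h1
  · rw [hl] at h1
    rw [if_pos h1] at hmod
    ext1
    · simp only [Path.cons, Path.rem] at hmod ⊢
      rw [hmod]; rfl
    · simp only [Path.cons, Path.rem] at hmod ⊢
      rw [hmod]; rfl
  · rw [hl] at h1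
    rw [if_neg h1] at hmod
    ext1
    · simp only [Path.cons, Path.rem] at hmod ⊢
      rw [hmod]; rfl
    · simp only [Path.cons, Path.rem] at hmod ⊢
      rw [hmod]; rfl

/-- The paths v and v(n) end at the same vertex, so equality of remainders already makes the edge
composable with v. -/
theorem eq_stepOf {v : G.Path} {α : G.StepEdge n} (h : remLT hn v = α.1.2) :
    ∃ h', α = stepOf hn α.1.1 v h' := by
  have h' : G.src α.1.1 = v.range := by rw [α.2, ← h, range_remLT]
  exact ⟨h', Subtype.ext (Prod.ext rfl h.symm)⟩

theorem stepOf_coe (α : G.StepEdge n) : stepOf hn α.1.1 α.1.2.1 α.2 = α :=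
  Subtype.ext (Prod.ext rfl (remLT_coe hn _))

theorem stepOf_eq_iff {e e' : E} {v v' : G.Path} {h : G.src e = v.range}
    {h' : G.src e' = v'.range} :
    stepOf hn e v h = stepOf hn e' v' h' ↔ e = e' ∧ remLT hn v = remLT hn v' := by
  simp only [stepOf, Subtype.mk.injEq, Prod.mk.injEq]

/-! ### Partial shifts on `ℓ²(E^*)` -/

theorem orthonormal_xi : Orthonormal ℂ G.xi := by
  classical
  refine ⟨fun v => ?_, fun v w h => G.inner_xi_of_ne h⟩
  rw [xi, lp.norm_single (by norm_num)]
  simp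

variable {ι : Type*}

/-- The isometry that maps the basis vector at `i` to `ξ_{f i}`. -/
def pathIsometry (f : ι → G.Path) (hf : Function.Injective f) :
    lp (fun _ : ι => ℂ) 2 →ₗᵢ[ℂ] G.FockSpace :=
  (orthonormal_xi.comp f hf).orthogonalFamily.linearIsometry

open Classical in
theorem pathIsometry_single (f : ι → G.Path) (hf : Function.Injective f) (i : ι) :
    pathIsometry f hf (lp.single 2 i 1) = G.xi (f i) := by
  rw [pathIsometry, OrthogonalFamily.linearIsometry_apply_single]
  simp

/-- The partial isometry that maps `ξ_{g i}` to `ξ_{f i}` and the other basis vectors to `0`. -/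
def partialShift (f g : ι → G.Path) (hf : Function.Injective f) (hg : Function.Injective g) :
    G.FockSpace →L[ℂ] G.FockSpace :=
  (pathIsometry f hf).toContinuousLinearMap ∘L
    ContinuousLinearMap.adjoint (pathIsometry g hg).toContinuousLinearMap

theorem partialShift_xi (f g : ι → G.Path) (hf : Function.Injective f)
    (hg : Function.Injective g) (i : ι) : partialShift f g hf hg (G.xi (g i)) = G.xi (f i) := by
  classical
  have h := ContinuousLinearMap.ext_iff.1 (LinearIsometry.adjoint_comp_self (pathIsometry g hg))
    (lp.single 2 i 1)
  change (pathIsometry f hf) (ContinuousLinearMap.adjoint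
    (pathIsometry g hg).toContinuousLinearMap (G.xi (g i))) = _
  rw [← pathIsometry_single f hf, ← pathIsometry_single g hg]
  exact congrArg _ h

theorem partialShift_xi_of_notMem (f g : ι → G.Path) (hf : Function.Injective f)
    (hg : Function.Injective g) {v : G.Path} (hv : ∀ i, g i ≠ v) :
    partialShift f g hf hg (G.xi v) = 0 := by
  classical
  have : ContinuousLinearMap.adjoint (pathIsometry g hg).toContinuousLinearMap (G.xi v) = 0 := by
    -- The i-th coordinate of the adjoint's value is an inner product of ξ_{g i} with ξ_v.
    apply lp.ext
    funext i
    have h1 := lp.inner_single_left (𝕜 := ℂ) (G := fun _ : ι => ℂ) i 1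
      (ContinuousLinearMap.adjoint (pathIsometry g hg).toContinuousLinearMap (G.xi v))
    rw [ContinuousLinearMap.adjoint_inner_right] at h1
    change inner ℂ (pathIsometry g hg (lp.single 2 i 1)) (G.xi v) = _ at h1
    rw [pathIsometry_single, G.inner_xi_of_ne (hv i)] at h1
    simpa using h1.symm
  exact (congrArg (pathIsometry f hf) this).trans (map_zero _)

theorem star_partialShift (f g : ι → G.Path) (hf : Function.Injective f)
    (hg : Function.Injective g) :
    star (partialShift f g hf hg) = partialShift g f hg hf := by
  rw [partialShift, ContinuousLinearMap.star_eq_adjoint, ContinuousLinearMap.adjoint_comp,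
    ContinuousLinearMap.adjoint_adjoint]
  rfl

/-- The projection onto the closed span of the `ξ_v` with `v ∈ s`. -/
def diagProj (s : Set G.Path) : G.FockSpace →L[ℂ] G.FockSpace :=
  partialShift (Subtype.val : s → G.Path) Subtype.val Subtype.val_injective Subtype.val_injective

theorem diagProj_xi_of_mem {s : Set G.Path} {v : G.Path} (hv : v ∈ s) :
    diagProj s (G.xi v) = G.xi v :=
  partialShift_xi _ _ _ _ (⟨v, hv⟩ : s)

theorem diagProj_xi_of_notMem {s : Set G.Path} {v : G.Path} (hv : v ∉ s) :
    diagProj s (G.xi v) = 0 :=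
  partialShift_xi_of_notMem _ _ _ _ fun i h => hv (h ▸ i.2)

open Classical in
theorem diagProj_xi (s : Set G.Path) (v : G.Path) :
    diagProj s (G.xi v) = if v ∈ s then G.xi v else 0 := by
  split_ifs with h
  · exact diagProj_xi_of_mem h
  · exact diagProj_xi_of_notMem h

theorem star_diagProj (s : Set G.Path) : star (diagProj s) = diagProj s :=
  star_partialShift _ _ _ _

theorem diagProj_mul (s t : Set G.Path) : diagProj s * diagProj t = diagProj (s ∩ t) := by
  classical
  refine G.ext_xi fun v => ?_
  change diagProj s (diagProj t (G.xi v)) = _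
  rw [diagProj_xi t, diagProj_xi (s ∩ t)]
  by_cases h : v ∈ t
  · simp [h, diagProj_xi]
  · simp [h]

theorem isStarProjection_diagProj (s : Set G.Path) : IsStarProjection (diagProj s) :=
  ⟨by rw [IsIdempotentElem, diagProj_mul, Set.inter_self], star_diagProj s⟩

theorem diagProj_univ : diagProj (Set.univ : Set G.Path) = 1 :=
  G.ext_xi fun _ => diagProj_xi_of_mem (Set.mem_univ _)

theorem diagProj_empty : diagProj (∅ : Set G.Path) = 0 :=
  G.ext_xi fun _ => diagProj_xi_of_notMem (Set.notMem_empty _)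

theorem diagProj_union {s t : Set G.Path} (h : Disjoint s t) :
    diagProj (s ∪ t) = diagProj s + diagProj t := by
  classical
  refine G.ext_xi fun v => ?_
  change _ = diagProj s (G.xi v) + diagProj t (G.xi v)
  simp only [diagProj_xi]
  have : v ∈ s → v ∉ t := fun hv => Set.disjoint_left.1 h hv
  by_cases h1 : v ∈ s
  · simp [h1, this h1]
  · simp [h1]

theorem isCompactOperator_diagProj {s : Set G.Path} (hs : s.Finite) :
    IsCompactOperator (diagProj s) := by
  classical
  induction s, hs using Set.Finite.induction_on with
  | empty => rw [diagProj_empty]; exact isCompactOperator_zero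
  | @insert v s hv _ ih =>
    rw [Set.insert_eq, diagProj_union (Set.disjoint_singleton_left.2 hv)]
    refine IsCompactOperator.add ?_ ih
    have : diagProj {v} = (ContinuousLinearMap.toSpanSingleton ℂ (G.xi v)) ∘L
        (innerSL ℂ (G.xi v)) := by
      refine G.ext_xi fun w => ?_
      rw [diagProj_xi, ContinuousLinearMap.comp_apply, innerSL_apply_apply,
        ContinuousLinearMap.toSpanSingleton_apply, Set.mem_singleton_iff]
      split_ifs with h
      · subst h
        rw [inner_self_eq_norm_sq_to_K, orthonormal_xi.1]
        simp
      · rw [G.inner_xi_of_ne (Ne.symm h), zero_smul]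
    rw [this]
    exact (isCompactOperator_of_locallyCompactSpace_rng
      (ContinuousLinearMap.toSpanSingleton ℂ (G.xi v))).comp_clm _

theorem finite_setOf_length_lt [Finite V] [Finite E] (M : ℕ) :
    {v : G.Path | v.length < M}.Finite :=
  haveI : Finite {v : G.Path | v.length < M} := G.finite_pathLT M
  Set.toFinite _

/-- The projection onto the closed span of the `ξ_v` with `M ≤ |v|`. -/
abbrev tailProj (G : DirGraph V E) (M : ℕ) : G.FockSpace →L[ℂ] G.FockSpace :=
  diagProj {v | M ≤ v.length}

theorem isCompactOperator_one_sub_tailProj [Finite V] [Finite E] (M : ℕ) :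
    IsCompactOperator (1 - tailProj G M : G.FockSpace →L[ℂ] G.FockSpace) := by
  have h : (1 - tailProj G M) = diagProj {v | v.length < M} := by
    rw [sub_eq_iff_eq_add, ← diagProj_univ, ← diagProj_union]
    · congr 1
      ext v
      simp [lt_or_ge]
    · exact Set.disjoint_left.2 fun v h1 h2 => not_lt.2 (show M ≤ v.length from h2) h1
  rw [h]
  exact isCompactOperator_diagProj (finite_setOf_length_lt M)

end DirGraph
end

noncomputable section

namespace DirGraph

variable {V E : Type u} {G : DirGraph V E} {n : ℕ} (hn : 1 ≤ n)

/-! ### The elementary periodic shifts -/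

/-- The map `v ↦ ev` on the paths `v` with `v(n) = w`. -/
def stepMap (α : G.StepEdge n) (v : {v : G.Path // remLT hn v = α.1.2}) : G.Path :=
  v.1.cons α.1.1 (eq_stepOf hn v.2).choose

theorem stepMap_injective (α : G.StepEdge n) : Function.Injective (stepMap hn α) :=
  fun _ _ h => Subtype.ext (Path.cons_inj.1 h).2

/-- The elementary shift of an edge `(e, w)` of `E(n)`: it maps `ξ_v` to `ξ_{ev}` if `v(n) = w`
and to `0` otherwise. -/
def stepOp (α : G.StepEdge n) : G.FockSpace →L[ℂ] G.FockSpace :=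
  partialShift (stepMap hn α) Subtype.val (stepMap_injective hn α) Subtype.val_injective

/-- The projection onto the closed span of the `ξ_v` with `v(n) = w`. -/
abbrev remProj (w : G.PathLT n) : G.FockSpace →L[ℂ] G.FockSpace := diagProj {v | remLT hn v = w}

theorem stepOp_stepOf_xi (e : E) (v : G.Path) (h : G.src e = v.range) :
    stepOp hn (stepOf hn e v h) (G.xi v) = G.xi (v.cons e h) :=
  partialShift_xi _ _ _ _ (⟨v, rfl⟩ : {v' : G.Path // remLT hn v' = (stepOf hn e v h).1.2})

theorem stepOp_xi_of_ne {α : G.StepEdge n} {v : G.Path} (h : remLT hn v ≠ α.1.2) :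
    stepOp hn α (G.xi v) = 0 :=
  partialShift_xi_of_notMem _ _ _ _ fun i hi => h (hi ▸ i.2)

-- A path of positive length lies in the range of exactly one elementary shift: its last edge and
-- the remainder of what precedes it determine the edge of E(n).
open Classical in
theorem star_stepOp_xi_cons (α : G.StepEdge n) (e : E) (v : G.Path) (h : G.src e = v.range) :
    star (stepOp hn α) (G.xi (v.cons e h)) = if stepOf hn e v h = α then G.xi v else 0 := by
  rw [stepOp, star_partialShift]
  split_ifs with h1
  · subst h1
    exact partialShift_xi _ _ _ _ (⟨v, rfl⟩ : {v' : G.Path // remLT hn v' = (stepOf hn e v h).1.2})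
  · refine partialShift_xi_of_notMem _ _ _ _ fun i hi => h1 ?_
    obtain ⟨h2, h3⟩ := Path.cons_inj.1 hi
    exact Subtype.ext (Prod.ext h2.symm (h3 ▸ i.2))

theorem star_stepOp_xi_vertex (α : G.StepEdge n) (x : V) :
    star (stepOp hn α) (G.xi (Path.vertex x)) = 0 := by
  rw [stepOp, star_partialShift]
  exact partialShift_xi_of_notMem _ _ _ _ fun i hi =>
    Nat.succ_ne_zero _ (congrArg Path.length hi)

theorem stepOp_xi_cases (α : G.StepEdge n) (v : G.Path) :
    (∃ e h, α = stepOf hn e v h ∧ stepOp hn α (G.xi v) = G.xi (v.cons e h)) ∨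
      (remLT hn v ≠ α.1.2 ∧ stepOp hn α (G.xi v) = 0) := by
  by_cases h : remLT hn v = α.1.2
  · obtain ⟨h', hα⟩ := eq_stepOf hn h
    refine Or.inl ⟨_, h', hα, ?_⟩
    conv_lhs => rw [hα]
    exact stepOp_stepOf_xi hn _ v h'
  · exact Or.inr ⟨h, stepOp_xi_of_ne hn h⟩

theorem star_stepOp_mul_self (α : G.StepEdge n) :
    star (stepOp hn α) * stepOp hn α = remProj hn ((G.stepGraph n).src α) := by
  refine G.ext_xi fun v => ?_
  change star (stepOp hn α) (stepOp hn α (G.xi v)) = _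
  rcases stepOp_xi_cases hn α v with ⟨e, h, rfl, h2⟩ | ⟨h1, h2⟩
  · rw [h2, star_stepOp_xi_cons, if_pos rfl, diagProj_xi_of_mem]
    rfl
  · rw [h2, map_zero, diagProj_xi_of_notMem]
    exact h1

theorem star_stepOp_mul_of_ne {α β : G.StepEdge n} (hαβ : α ≠ β) :
    star (stepOp hn α) * stepOp hn β = 0 := by
  refine G.ext_xi fun v => ?_
  change star (stepOp hn α) (stepOp hn β (G.xi v)) = 0
  rcases stepOp_xi_cases hn β v with ⟨e, h, rfl, h2⟩ | ⟨h1, h2⟩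
  · rw [h2, star_stepOp_xi_cons, if_neg (Ne.symm hαβ)]
  · rw [h2, map_zero]

theorem stepOp_mul_remProj (α : G.StepEdge n) :
    stepOp hn α * remProj hn ((G.stepGraph n).src α) = stepOp hn α := by
  refine G.ext_xi fun v => ?_
  change stepOp hn α (remProj hn _ (G.xi v)) = _
  by_cases h : remLT hn v = α.1.2
  · rw [diagProj_xi_of_mem]
    exact h
  · rw [diagProj_xi_of_notMem, map_zero, stepOp_xi_of_ne hn h]
    exact h

theorem stepOp_partialIsometry (α : G.StepEdge n) :
    stepOp hn α * star (stepOp hn α) * stepOp hn α = stepOp hn α := by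
  rw [mul_assoc, star_stepOp_mul_self, stepOp_mul_remProj]

theorem remProj_mul_of_ne {w w' : G.PathLT n} (h : w ≠ w') : remProj hn w * remProj hn w' = 0 := by
  rw [diagProj_mul, ← diagProj_empty]
  congr 1
  ext v
  simp only [Set.mem_inter_iff, Set.mem_ofPred_eq, Set.mem_empty_iff_false, iff_false]
  rintro ⟨rfl, h2⟩
  exact h h2

open Classical in
theorem stepOp_mul_diagProj_mul_star_xi_cons (α : G.StepEdge n) (s : Set G.Path) (e : E)
    (v : G.Path) (h : G.src e = v.range) :
    (stepOp hn α * diagProj s * star (stepOp hn α)) (G.xi (v.cons e h)) =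
      if stepOf hn e v h = α ∧ v ∈ s then G.xi (v.cons e h) else 0 := by
  change stepOp hn α (diagProj s (star (stepOp hn α) (G.xi (v.cons e h)))) = _
  rw [star_stepOp_xi_cons]
  by_cases h1 : stepOf hn e v h = α
  · subst h1
    rw [if_pos rfl, diagProj_xi]
    by_cases h2 : v ∈ s
    · rw [if_pos h2, if_pos ⟨rfl, h2⟩, stepOp_stepOf_xi]
    · rw [if_neg h2, if_neg (fun h => h2 h.2), map_zero]
  · rw [if_neg h1, if_neg (fun h => h1 h.1), map_zero, map_zero]

theorem stepOp_mul_diagProj_mul_star_xi_vertex (α : G.StepEdge n) (s : Set G.Path) (x : V) :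
    (stepOp hn α * diagProj s * star (stepOp hn α)) (G.xi (Path.vertex x)) = 0 := by
  change stepOp hn α (diagProj s (star (stepOp hn α) (G.xi _))) = _
  rw [star_stepOp_xi_vertex, map_zero, map_zero]

/-- The conjugated projections are diagonal with disjoint supports, as each ev is reached by one
elementary shift only. With q trivial this moves tail projections one step outward; with s
everything it computes the left side of the sum relation. -/
theorem sum_filter_stepOp_mul_star [Fintype (G.StepEdge n)] (s : Set G.Path)
    (q : G.StepEdge n → Prop) [DecidablePred q] :
    ∑ α with q α, stepOp hn α * diagProj s * star (stepOp hn α) =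
      diagProj {p | ∃ e v h, p = Path.cons e v h ∧ v ∈ s ∧ q (stepOf hn e v h)} := by
  classical
  refine G.ext_xi fun p => ?_
  rw [sum_apply]
  rcases p.eq_vertex_or_eq_cons with ⟨x, rfl⟩ | ⟨e, v, h, rfl⟩
  · rw [diagProj_xi_of_notMem]
    · exact Finset.sum_eq_zero fun α _ => stepOp_mul_diagProj_mul_star_xi_vertex hn α s x
    · rintro ⟨e, v, h, h1, -⟩
      exact Nat.succ_ne_zero _ (congrArg Path.length h1).symm
  · have hiff : (∃ e' v' h', Path.cons e v h = Path.cons e' v' h' ∧ v' ∈ s ∧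
        q (stepOf hn e' v' h')) ↔ v ∈ s ∧ q (stepOf hn e v h) := by
      constructor
      · rintro ⟨e', v', h', h1, h2⟩
        obtain ⟨rfl, rfl⟩ := Path.cons_inj.1 h1
        exact h2
      · exact fun h2 => ⟨e, v, h, rfl, h2⟩
    rw [diagProj_xi, Set.mem_ofPred_eq]
    simp only [hiff, stepOp_mul_diagProj_mul_star_xi_cons]
    by_cases hv : v ∈ s
    · simp [hv, Finset.sum_ite_eq]
    · simp [hv]

/-! ### Generators of `𝒜(n)` -/

theorem stepOp_mem (α : G.StepEdge n) : stepOp hn α ∈ G.shiftAlgebra n := by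
  classical
  refine NonUnitalStarSubalgebra.le_topologicalClosure _ (NonUnitalStarAlgebra.subset_adjoin ℂ _ ?_)
  -- The weight is the indicator of the paths ev with v(n) = w. It sees v through v(n) only, hence
  -- is periodic.
  refine ⟨fun p => if ∃ v h, p = Path.cons α.1.1 v h ∧ remLT hn v = α.1.2 then 1 else 0,
    fun e => if e = α.1.1 then stepOp hn α else 0, α.1.1, ?_, ?_, (if_pos rfl).symm⟩
  · intro e v h
    refine if_congr ⟨?_, ?_⟩ rfl rfl
    · rintro ⟨v', h', h1, h2⟩
      obtain ⟨rfl, rfl⟩ := Path.cons_inj.1 h1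
      exact ⟨_, _, rfl, (congrArg (remLT hn) (congrArg Subtype.val h2)).trans
        ((remLT_coe hn _))⟩
    · rintro ⟨v', h', h1, h2⟩
      obtain ⟨rfl, rfl⟩ := Path.cons_inj.1 h1
      refine ⟨v, h, rfl, ?_⟩
      rw [← h2]
      exact (remLT_coe hn (remLT hn v)).symm
  · intro e v
    refine ⟨fun h => ?_, fun h => ?_⟩
    · beta_reduce
      rcases stepOp_xi_cases hn α v with ⟨e', h', rfl, h2⟩ | ⟨h1, h2⟩
      · by_cases he : e = e'
        · subst he
          rw [if_pos (show e = (stepOf hn e v h').1.1 from rfl), if_pos ⟨v, h, rfl, rfl⟩, one_smul]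
          exact h2
        · rw [if_neg (show ¬ e = (stepOf hn e' v h').1.1 from he), if_neg, zero_smul]
          · rfl
          · rintro ⟨v', h'', h1, -⟩
            exact he (Path.cons_inj.1 h1).1
      · rw [if_neg (c := ∃ _, _), zero_smul]
        · split_ifs
          · exact h2
          · rfl
        · rintro ⟨v', h'', h3, h4⟩
          obtain ⟨rfl, rfl⟩ := Path.cons_inj.1 h3
          exact h1 h4
    · beta_reduce
      split_ifs with he
      · subst he
        refine stepOp_xi_of_ne hn fun h1 => h ?_
        rw [α.2, ← h1, range_remLT]
      · rfl

/-- A periodic weight is a function on the edges of E(n), so T_e is a finite combination of the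
elementary shifts lying over e. Hence these shifts generate 𝒜(n). -/
theorem shiftAlgebra_le [Finite V] [Finite E]
    (M : NonUnitalStarSubalgebra ℂ (G.FockSpace →L[ℂ] G.FockSpace))
    (hM : IsClosed (M : Set (G.FockSpace →L[ℂ] G.FockSpace))) (h : ∀ α, stepOp hn α ∈ M) :
    G.shiftAlgebra n ≤ M := by
  classical
  cases nonempty_fintype (G.StepEdge n)
  refine NonUnitalStarSubalgebra.topologicalClosure_minimal _ (NonUnitalStarAlgebra.adjoin_le ?_) hM
  rintro _ ⟨lam, T, e, hlam, hT, rfl⟩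
  have : T e = ∑ α : G.StepEdge n with α.1.1 = e,
      lam (Path.cons α.1.1 α.1.2.1 α.2) • stepOp hn α := by
    refine G.ext_xi fun v => ?_
    rw [sum_apply]
    by_cases hv : G.src e = v.range
    · rw [(hT e v).1 hv, Finset.sum_eq_single (stepOf hn e v hv)]
      · rw [smul_apply, stepOp_stepOf_xi]
        exact congrArg (· • _) (hlam e v hv)
      · intro α hα hne
        rw [smul_apply, stepOp_xi_of_ne, smul_zero]
        intro h1
        obtain ⟨h2, h3⟩ := eq_stepOf hn h1
        refine hne (h3.trans ?_)
        rw [stepOf_eq_iff]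
        exact ⟨(Finset.mem_filter.1 hα).2, rfl⟩
      · intro h1
        exact (h1 (Finset.mem_filter.2 ⟨Finset.mem_univ _, rfl⟩)).elim
    · rw [(hT e v).2 hv, Finset.sum_eq_zero]
      intro α hα
      rw [smul_apply, stepOp_xi_of_ne, smul_zero]
      intro h1
      refine hv ?_
      rw [← (Finset.mem_filter.1 hα).2, α.2, ← h1, range_remLT]
  rw [this]
  exact sum_mem fun α _ => SMulMemClass.smul_mem _ (h α)

/-- Since the range of w is not a sink, some edge of E(n) leaves w, and the initial projection of
its elementary shift is the projection sought. -/
theorem remProj_mem (no_sinks : ∀ x, ∃ e, G.src e = x) (w : G.PathLT n) :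
    remProj hn w ∈ G.shiftAlgebra n := by
  obtain ⟨e, he⟩ := no_sinks w.1.range
  have := star_stepOp_mul_self hn (⟨(e, w), he⟩ : G.StepEdge n)
  change _ = remProj hn w at this
  rw [← this]
  exact mul_mem (star_mem (stepOp_mem hn _)) (stepOp_mem hn _)

theorem sum_remProj [Fintype (G.PathLT n)] : ∑ w : G.PathLT n, remProj hn w = 1 := by
  classical
  refine G.ext_xi fun v => ?_
  rw [sum_apply]
  rw [Fintype.sum_eq_single (remLT hn v)]
  · exact diagProj_xi_of_mem rfl
  · exact fun w hw => diagProj_xi_of_notMem (Ne.symm hw)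

theorem one_mem_shiftAlgebra (hn : 1 ≤ n) [Finite V] [Finite E] (no_sinks : ∀ x, ∃ e, G.src e = x) :
    1 ∈ G.shiftAlgebra n := by
  classical
  cases nonempty_fintype (G.PathLT n)
  rw [← sum_remProj (G := G) hn]
  exact sum_mem fun w _ => remProj_mem hn no_sinks w

theorem tailProj_mem (hn : 1 ≤ n) [Finite V] [Finite E] (no_sinks : ∀ x, ∃ e, G.src e = x) (M : ℕ) :
    tailProj G M ∈ G.shiftAlgebra n := by
  classical
  cases nonempty_fintype (G.StepEdge n)
  induction M with
  | zero =>
    have : {v : G.Path | 0 ≤ v.length} = Set.univ := by ext; simp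
    rw [tailProj, this, diagProj_univ]
    exact one_mem_shiftAlgebra hn no_sinks
  | succ M ih =>
    have := sum_filter_stepOp_mul_star (G := G) hn {v | M ≤ v.length} fun _ => True
    -- Conjugating the M-th tail projection by all elementary shifts yields the next one.
    have hs : {p : G.Path | ∃ e v h, p = Path.cons e v h ∧ v ∈ {v : G.Path | M ≤ v.length} ∧ True}
        = {v | M + 1 ≤ v.length} := by
      ext p
      constructor
      · rintro ⟨e, v, h, rfl, h1, -⟩
        exact Nat.succ_le_succ h1
      · intro hp
        rcases p.eq_vertex_or_eq_cons with ⟨x, rfl⟩ | ⟨e, v, h, rfl⟩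
        · exact absurd hp (Nat.not_succ_le_zero M)
        · exact ⟨e, v, h, rfl, Nat.le_of_succ_le_succ hp, trivial⟩
    rw [hs] at this
    rw [tailProj, ← this]
    exact sum_mem fun α _ => mul_mem (mul_mem (stepOp_mem hn α) ih) (star_mem (stepOp_mem hn α))

/-- The range projections cover the paths of positive length with remainder w. Only the vertices
with that remainder are missed, and they are finitely many. -/
theorem isCompactOperator_sum_sub [Finite V] [Finite E] (w : G.PathLT n) :
    IsCompactOperator ((∑ᶠ α ∈ {α : G.StepEdge n | (G.stepGraph n).rng α = w},
      stepOp hn α * star (stepOp hn α)) - remProj hn w : G.FockSpace →L[ℂ] G.FockSpace) := by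
  classical
  cases nonempty_fintype (G.StepEdge n)
  have h1 := sum_filter_stepOp_mul_star (G := G) hn Set.univ fun α => (G.stepGraph n).rng α = w
  simp only [diagProj_univ, mul_one] at h1
  rw [finsum_mem_eq_finite_toFinset_sum _ (Set.toFinite _)]
  have h2 : (Set.toFinite {α : G.StepEdge n | (G.stepGraph n).rng α = w}).toFinset =
      Finset.univ.filter fun α => (G.stepGraph n).rng α = w := by ext; simp
  rw [h2, h1]
  set s : Set G.Path := {p | ∃ e v h, p = Path.cons e v h ∧ v ∈ Set.univ ∧
    (G.stepGraph n).rng (stepOf hn e v h) = w}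
  have h3 : {v : G.Path | remLT hn v = w} = s ∪ {v | v.length < 1 ∧ remLT hn v = w} := by
    ext p
    rcases p.eq_vertex_or_eq_cons with ⟨x, rfl⟩ | ⟨e, v, h, rfl⟩
    · simp only [s, Set.mem_ofPred_eq, Set.mem_union]
      constructor
      · exact fun h => Or.inr ⟨Nat.zero_lt_one, h⟩
      · rintro (⟨e, v, h, h1, -⟩ | h)
        · exact absurd (congrArg Path.length h1).symm (Nat.succ_ne_zero _)
        · exact h.2
    · simp only [s, Set.mem_ofPred_eq, Set.mem_union]
      constructor
      · exact fun h1 => Or.inl ⟨e, v, h, rfl, trivial, (rng_stepOf hn e v h).trans h1⟩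
      · rintro (⟨e', v', h', h1, -, h2⟩ | h1)
        · obtain ⟨rfl, rfl⟩ := Path.cons_inj.1 h1
          rwa [rng_stepOf] at h2
        · exact h1.2
  have h4 : Disjoint s {v | v.length < 1 ∧ remLT hn v = w} := by
    rw [Set.disjoint_left]
    rintro _ ⟨e, v, h, rfl, -⟩ ⟨h1, -⟩
    rw [Path.length_cons] at h1
    omega
  rw [remProj, h3, diagProj_union h4, sub_add_cancel_left]
  exact (isCompactOperator_diagProj ((finite_setOf_length_lt 1).subset fun v h => h.1)).neg

/-! ### The ideal of compact operators -/

theorem sum_sourceProj [Fintype V] : ∑ x, G.sourceProj x = 1 := by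
  classical
  refine G.ext_xi fun v => ?_
  rw [sum_apply, Finset.sum_eq_single v.source]
  · exact G.sourceProj_xi_self v
  · exact fun x _ hx => G.sourceProj_xi_of_ne (Ne.symm hx)
  · exact fun h => absurd (Finset.mem_univ _) h

theorem IsBlockCompact.isCompactOperator [Fintype V] {A : G.FockSpace →L[ℂ] G.FockSpace}
    (hA : G.IsBlockCompact A) : IsCompactOperator A := by
  obtain ⟨K, hK, rfl⟩ := hA
  have : ∀ s : Finset V, IsCompactOperator
      (∑ x ∈ s, G.sourceProj x * K x * G.sourceProj x : G.FockSpace →L[ℂ] G.FockSpace) := by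
    classical
    intro s
    induction s using Finset.induction_on with
    | empty => exact isCompactOperator_zero
    | insert x s hx ih =>
      rw [Finset.sum_insert hx]
      exact IsCompactOperator.add (((hK x).clm_comp (G.sourceProj x)).comp_clm (G.sourceProj x)) ih
  exact this _

/-- Elements of 𝒜(n) commute with the projections R_x, which sum to 1, so a compact A is block
compact with every block operator equal to A. Afterwards only compactness has to be tracked. -/
theorem isBlockCompact_iff [Fintype V] {A : G.FockSpace →L[ℂ] G.FockSpace}
    (hA : A ∈ G.shiftAlgebra n) : G.IsBlockCompact A ↔ IsCompactOperator A := by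
  refine ⟨IsBlockCompact.isCompactOperator, fun h => ⟨fun _ => A, fun _ => h, ?_⟩⟩
  have hidem : ∀ x, G.sourceProj x * G.sourceProj x = G.sourceProj x := fun x =>
    Submodule.isIdempotentElem_starProjection _
  simp only [mul_assoc, ← G.shiftAlgebra_commute n hA]
  simp only [← mul_assoc, hidem]
  rw [← Finset.sum_mul, sum_sourceProj, one_mul]

/-- On a finite combination of basis vectors the tail projections are eventually 0; density and the
uniform bound ‖T_M‖ ≤ 1 do the rest. -/
theorem tendsto_tailProj_apply [Finite V] [Finite E] (f : G.FockSpace) :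
    Filter.Tendsto (fun M => tailProj G M f) Filter.atTop (nhds 0) := by
  classical
  have hnorm : ∀ M, ‖tailProj G M‖ ≤ 1 := fun M => (isStarProjection_diagProj _).norm_le
  have hd : f ∈ closure (Submodule.span ℂ (Set.range G.xi) : Set G.FockSpace) := by
    have hf := lp.hasSum_single (E := fun _ : G.Path => ℂ) ENNReal.ofNat_ne_top f
    refine mem_closure_of_tendsto hf (Filter.Eventually.of_forall fun s => ?_)
    refine sum_mem fun w _ => ?_
    have : lp.single (E := fun _ : G.Path => ℂ) 2 w (f w) = f w • G.xi w := by
      rw [xi, ← lp.single_smul, smul_eq_mul, mul_one]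
    rw [this]
    exact Submodule.smul_mem _ _ (Submodule.subset_span ⟨w, rfl⟩)
  have hspan : ∀ g ∈ Submodule.span ℂ (Set.range G.xi), ∃ M₀, ∀ M ≥ M₀, tailProj G M g = 0 := by
    intro g hg
    induction hg using Submodule.span_induction with
    | mem g hg =>
      obtain ⟨v, rfl⟩ := hg
      exact ⟨v.length + 1, fun M hM => diagProj_xi_of_notMem fun h =>
        absurd (show M ≤ v.length from h) (by omega)⟩
    | zero => exact ⟨0, fun M _ => map_zero _⟩
    | add g g' _ _ h h' =>
      obtain ⟨a, ha⟩ := h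
      obtain ⟨b, hb⟩ := h'
      exact ⟨max a b, fun M hM => by
        rw [map_add, ha M (le_trans (le_max_left _ _) hM), hb M (le_trans (le_max_right _ _) hM),
          add_zero]⟩
    | smul c g _ h =>
      obtain ⟨a, ha⟩ := h
      exact ⟨a, fun M hM => by rw [map_smul, ha M hM, smul_zero]⟩
  rw [Metric.tendsto_atTop]
  intro ε hε
  obtain ⟨g, hg, hfg⟩ := Metric.mem_closure_iff.1 hd ε hε
  obtain ⟨M₀, hM₀⟩ := hspan g hg
  refine ⟨M₀, fun M hM => ?_⟩
  rw [dist_zero_right]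
  calc ‖tailProj G M f‖ = ‖tailProj G M (f - g)‖ := by rw [map_sub, hM₀ M hM, sub_zero]
    _ ≤ 1 * ‖f - g‖ := (ContinuousLinearMap.le_opNorm _ _).trans (by gcongr; exact hnorm M)
    _ < ε := by rwa [one_mul, ← dist_eq_norm]

/-- The adjoint of K T_M is T_M K^*, and strong convergence of contractions is uniform on the
totally bounded image of the unit ball under K^*. -/
theorem tendsto_mul_tailProj [Finite V] [Finite E] {K : G.FockSpace →L[ℂ] G.FockSpace}
    (hK : IsCompactOperator K) :
    Filter.Tendsto (fun M => K * tailProj G M) Filter.atTop (nhds 0) := by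
  have hnorm : ∀ M, ‖tailProj G M‖ ≤ 1 := fun M => (isStarProjection_diagProj _).norm_le
  obtain ⟨C, hC, hsub⟩ := (isCompactOperator_star hK).image_closedBall_subset_compact 1
  rw [Metric.tendsto_atTop]
  intro ε hε
  obtain ⟨t, htf, hcov⟩ := Metric.totallyBounded_iff.1 hC.totallyBounded (ε / 3) (by positivity)
  have hev : ∀ᶠ M in Filter.atTop, ∀ y ∈ t, ‖tailProj G M y‖ < ε / 3 := by
    rw [Filter.eventually_all_finite htf]
    intro y _
    exact ((tendsto_tailProj_apply y).norm).eventually_lt_const (by rw [norm_zero]; positivity)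
  obtain ⟨M₀, hM₀⟩ := Filter.eventually_atTop.1 hev
  refine ⟨M₀, fun M hM => ?_⟩
  rw [dist_zero_right, ← norm_star, star_mul, star_diagProj]
  refine lt_of_le_of_lt (ContinuousLinearMap.opNorm_le_of_unit_norm (C := 2 * (ε / 3))
    (by positivity) fun f hf => ?_) (by linarith)
  obtain ⟨y, hy, hxy⟩ := Set.mem_iUnion₂.1 (hcov (hsub ⟨f, by simp [hf], rfl⟩))
  have h1 : ‖star K f - y‖ < ε / 3 := by rw [← dist_eq_norm]; exact hxy
  calc ‖tailProj G M (star K f)‖ = ‖tailProj G M (star K f - y) + tailProj G M y‖ := by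
        rw [← map_add, sub_add_cancel]
    _ ≤ 1 * ‖star K f - y‖ + ‖tailProj G M y‖ := by
        refine (norm_add_le _ _).trans (add_le_add_left ?_ _)
        exact (ContinuousLinearMap.le_opNorm _ _).trans (by gcongr; exact hnorm M)
    _ ≤ 2 * (ε / 3) := by linarith [hM₀ M hM y hy]

end DirGraph
end

noncomputable section

namespace DirGraph

variable {V E : Type u} {G : DirGraph V E}

/-! ### Consequences of the Cuntz-Krieger relations -/

section CK

variable [Finite E] {B : Type*} [NonUnitalCStarAlgebra B] {P : V → B} {S : E → B}

theorem IsCKFamily.sum_filter_eq [Fintype E] [DecidableEq V] (h : G.IsCKFamily P S) {x : V}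
    (hx : ∃ e, G.rng e = x) : ∑ e with G.rng e = x, S e * star (S e) = P x := by
  rw [← h.sum_eq x hx, finsum_mem_eq_finite_toFinset_sum _ (Set.toFinite _)]
  congr 1
  ext; simp

theorem IsCKFamily.edge_mul_proj (h : G.IsCKFamily P S) (e : E) : S e * P (G.src e) = S e := by
  rw [← h.star_mul_self, ← mul_assoc, h.partialIsometry]

theorem IsCKFamily.proj_mul_edge (h : G.IsCKFamily P S) (e : E) : P (G.rng e) * S e = S e := by
  classical
  cases nonempty_fintype E
  rw [← h.sum_filter_eq ⟨e, rfl⟩, Finset.sum_mul, Finset.sum_eq_single e]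
  · exact h.partialIsometry e
  · intro f _ hf
    rw [mul_assoc, h.star_mul_of_ne f e hf, mul_zero]
  · exact fun h => absurd (by simp) h

theorem IsCKFamily.star_proj (h : G.IsCKFamily P S) (x : V) : star (P x) = P x := (h.isProj x).2

theorem IsCKFamily.proj_mul_self (h : G.IsCKFamily P S) (x : V) : P x * P x = P x := (h.isProj x).1

theorem IsCKFamily.isStarProjection_sum [Fintype V] (h : G.IsCKFamily P S) :
    IsStarProjection (∑ x, P x) := by
  classical
  refine ⟨?_, by rw [IsSelfAdjoint, star_sum]; simp only [h.star_proj]⟩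
  rw [IsIdempotentElem, Finset.sum_mul_sum]
  refine Finset.sum_congr rfl fun x _ => ?_
  rw [Finset.sum_eq_single x, h.proj_mul_self]
  · exact fun y _ hy => h.orthogonal x y hy.symm
  · exact fun h => absurd (Finset.mem_univ _) h

theorem IsCKFamily.sum_proj_mul_proj [Fintype V] (h : G.IsCKFamily P S) (x : V) :
    (∑ y, P y) * P x = P x := by
  classical
  rw [Finset.sum_mul, Finset.sum_eq_single x, h.proj_mul_self]
  · exact fun y _ hy => h.orthogonal y x hy
  · exact fun h => absurd (Finset.mem_univ _) h

end CK

/-! ### Density of the `*`-polynomials in the Cuntz-Krieger algebra -/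

section Density

variable [Finite E]

/-- This reduces closed conditions on 𝒪(G), namely identities between continuous maps and norm
inequalities, to formal polynomials, where induction is available. -/
theorem denseRange_eval : DenseRange fun t : StarPoly V E => t.eval G.ckP G.ckS := by
  let j : G.CKAlgebra →⋆ₙₐ[ℂ] G.CKProd := NonUnitalStarSubalgebraClass.subtype G.ckSubalgebra
  intro a
  refine Metric.mem_closure_iff.2 fun ε hε => ?_
  obtain ⟨b, hb, hab⟩ := Metric.mem_closure_iff.1 (show j a ∈ closure _ from a.2) ε hε
  obtain ⟨t, rfl⟩ := StarPoly.exists_eval _ _ hb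
  refine ⟨_, ⟨t, rfl⟩, ?_⟩
  have e := StarPoly.map_eval j G.ckP G.ckS t
  have : dist (j a) (j (t.eval G.ckP G.ckS)) < ε := by rw [e]; exact hab
  exact this

theorem sum_ckP_mul [Fintype V] (a : G.CKAlgebra) : (∑ x, G.ckP x) * a = a := by
  -- Left and right units are treated together because the induction step for the adjoint exchanges
  -- them.
  suffices h : ∀ t : StarPoly V E, (∑ x, G.ckP x) * t.eval G.ckP G.ckS = t.eval G.ckP G.ckS ∧
      t.eval G.ckP G.ckS * (∑ x, G.ckP x) = t.eval G.ckP G.ckS by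
    exact congrFun (denseRange_eval.equalizer (by fun_prop) (continuous_id)
      (funext fun t => (h t).1)) a
  have hck := G.isCKFamily_ck
  have hstar : star (∑ x, G.ckP x) = ∑ x, G.ckP x := hck.isStarProjection_sum.2
  have hP : ∀ x, G.ckP x * (∑ x, G.ckP x) = G.ckP x := fun x => by
    have := congrArg star (hck.sum_proj_mul_proj x)
    rwa [star_mul, hstar, hck.star_proj] at this
  intro t
  induction t with
  | vertex x => exact ⟨hck.sum_proj_mul_proj x, hP x⟩
  | edge e =>
    constructor
    · change _ * G.ckS e = G.ckS e
      rw [← hck.proj_mul_edge e, ← mul_assoc, hck.sum_proj_mul_proj]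
    · change G.ckS e * _ = G.ckS e
      rw [← hck.edge_mul_proj e, mul_assoc, hP]
  | zero => simp [StarPoly.eval]
  | add a b ha hb => simp only [StarPoly.eval, mul_add, add_mul, ha, hb, and_self]
  | mul a b ha hb =>
    simp only [StarPoly.eval]
    rw [← mul_assoc, ha.1, mul_assoc, hb.2]
    exact ⟨rfl, rfl⟩
  | smul c a ha => simp only [StarPoly.eval, mul_smul_comm, smul_mul_assoc, ha, and_self]
  | star a ha =>
    simp only [StarPoly.eval]
    constructor
    · conv_lhs => rw [← hstar, ← star_mul, ha.2]
    · conv_lhs => rw [← hstar, ← star_mul, ha.1]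

theorem mul_sum_ckP [Fintype V] (a : G.CKAlgebra) : a * (∑ x, G.ckP x) = a := by
  have h := congrArg star (sum_ckP_mul (star a))
  rwa [star_mul, star_star, show star (∑ x, G.ckP x) = ∑ x, G.ckP x from
    G.isCKFamily_ck.isStarProjection_sum.2] at h

end Density

/-! ### The partial isometries of paths -/

variable {n : ℕ} (hn : 1 ≤ n)

/-- The partial isometry of a path in a Cuntz-Krieger `E(n)`-family: it is `p_x` for a vertex `x`,
and `s_{(e, v(n))} s_v` for `ev`. -/
def pathElemAux {B : Type*} [Mul B] (P : G.PathLT n → B) (S : G.StepEdge n → B) (x : V) :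
    (l : List E) → G.IsPathFrom x l → B
  | [], _ => P (remLT hn (Path.vertex x))
  | e :: l, h => S (stepOf hn e ⟨x, l, h.2⟩ h.1) * pathElemAux P S x l h.2

/-- The partial isometry `s_v` of a path `v` in a Cuntz-Krieger `E(n)`-family. -/
def pathElem {B : Type*} [Mul B] (P : G.PathLT n → B) (S : G.StepEdge n → B) (v : G.Path) : B :=
  pathElemAux hn P S v.source v.edges v.isPath

section

variable {B : Type*} [NonUnitalCStarAlgebra B] {P : G.PathLT n → B} {S : G.StepEdge n → B}

theorem pathElem_vertex (x : V) :
    pathElem hn P S (Path.vertex x) = P (remLT hn (Path.vertex x)) := rfl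

theorem pathElem_cons (e : E) (v : G.Path) (h : G.src e = v.range) :
    pathElem hn P S (v.cons e h) = S (stepOf hn e v h) * pathElem hn P S v := rfl

variable [Finite V] [Finite E] (hck : (G.stepGraph n).IsCKFamily P S)
include hck

theorem proj_mul_pathElem (v : G.Path) :
    P (remLT hn v) * pathElem hn P S v = pathElem hn P S v := by
  induction v using Path.cons_induction with
  | vertex x => exact hck.proj_mul_self _
  | cons e v h _ => rw [pathElem_cons, ← mul_assoc, ← rng_stepOf, hck.proj_mul_edge]

theorem proj_mul_pathElem_of_ne {v : G.Path} {w : G.PathLT n} (h : remLT hn v ≠ w) :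
    P w * pathElem hn P S v = 0 := by
  rw [← proj_mul_pathElem hn hck, ← mul_assoc, hck.orthogonal _ _ (Ne.symm h), zero_mul]

theorem star_pathElem_mul_self (v : G.Path) :
    star (pathElem hn P S v) * pathElem hn P S v = P (remLT hn (Path.vertex v.source)) := by
  induction v using Path.cons_induction with
  | vertex x => rw [pathElem_vertex, hck.star_proj, hck.proj_mul_self]; rfl
  | cons e v h ih =>
    rw [pathElem_cons, star_mul, mul_assoc, ← mul_assoc (star (S _)), hck.star_mul_self,
      src_stepOf, proj_mul_pathElem hn hck, ih]
    rfl

theorem pathElem_mul_proj (v : G.Path) :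
    pathElem hn P S v * P (remLT hn (Path.vertex v.source)) = pathElem hn P S v := by
  induction v using Path.cons_induction with
  | vertex x => exact hck.proj_mul_self _
  | cons e v h ih => rw [pathElem_cons, mul_assoc, Path.source_cons, ih]

/-- Compare last edges: distinct edges of E(n) have orthogonal ranges, while equal ones cancel to a
projection that fixes the remaining path, so the induction passes to shorter paths. -/
theorem star_pathElem_mul_of_ne {v w : G.Path} (hl : v.length = w.length) (hvw : v ≠ w) :
    star (pathElem hn P S v) * pathElem hn P S w = 0 := by
  induction v using Path.cons_induction generalizing w with
  | vertex x =>
    rw [Path.eq_vertex_of_length_eq_zero hl.symm] at hvw ⊢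
    rw [pathElem_vertex, hck.star_proj, pathElem_vertex]
    refine hck.orthogonal _ _ fun h => hvw ?_
    have h := congrArg Subtype.val h
    simp only [remLT] at h
    rwa [Path.rem_of_lt (show (Path.vertex _ : G.Path).length < n from hn),
      Path.rem_of_lt (show (Path.vertex _ : G.Path).length < n from hn)] at h
  | cons e v h ih =>
    rcases w.eq_vertex_or_eq_cons with ⟨x, rfl⟩ | ⟨e', v', h', rfl⟩
    · exact absurd hl (Nat.succ_ne_zero _)
    rw [pathElem_cons, pathElem_cons, star_mul, mul_assoc, ← mul_assoc (star (S _))]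
    by_cases hs : stepOf hn e v h = stepOf hn e' v' h'
    · rw [← hs, hck.star_mul_self, src_stepOf, ((stepOf_eq_iff hn).1 hs).2,
        proj_mul_pathElem hn hck]
      refine ih (Nat.succ_injective hl) fun hv => hvw ?_
      exact Path.cons_inj.2 ⟨((stepOf_eq_iff hn).1 hs).1, hv⟩
    · rw [hck.star_mul_of_ne _ _ hs, zero_mul, mul_zero]

/-- The two elements lie under orthogonal vertex projections. Lengths may differ here, so this
covers any two distinct paths shorter than n. -/
theorem star_pathElem_mul_of_remLT_ne {v w : G.Path} (h : remLT hn v ≠ remLT hn w) :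
    star (pathElem hn P S v) * pathElem hn P S w = 0 := by
  rw [← proj_mul_pathElem hn hck v, star_mul, hck.star_proj, mul_assoc,
    proj_mul_pathElem_of_ne hn hck h.symm, mul_zero]

theorem edge_mul_pathElem_of_ne {α : G.StepEdge n} {v : G.Path} (h : remLT hn v ≠ α.1.2) :
    S α * pathElem hn P S v = 0 := by
  rw [← hck.edge_mul_proj, mul_assoc, proj_mul_pathElem_of_ne hn hck (w := (G.stepGraph n).src α) h,
    mul_zero]

-- The counterpart of `star_stepOp_xi_cons`: adjoints of edges act on s_p as adjoints of elementary
-- shifts act on ξ_p, for p of positive length.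
open Classical in
theorem star_edge_mul_pathElem_cons (α : G.StepEdge n) (e : E) (v : G.Path)
    (h : G.src e = v.range) : star (S α) * pathElem hn P S (v.cons e h) =
      if stepOf hn e v h = α then pathElem hn P S v else 0 := by
  rw [pathElem_cons, ← mul_assoc]
  split_ifs with h1
  · rw [← h1, hck.star_mul_self, src_stepOf, proj_mul_pathElem hn hck]
  · rw [hck.star_mul_of_ne _ _ (Ne.symm h1), zero_mul]

end

/-! ### Sums over the paths of given length -/

theorem exists_path_range (no_sources : ∀ x, ∃ e, G.rng e = x) (k : ℕ) (x : V) :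
    ∃ v : G.Path, v.length = k ∧ v.range = x := by
  induction k generalizing x with
  | zero => exact ⟨Path.vertex x, rfl, rfl⟩
  | succ k ih =>
    obtain ⟨e, rfl⟩ := no_sources x
    obtain ⟨v, hv, hv'⟩ := ih (G.src e)
    exact ⟨v.cons e hv'.symm, congrArg (· + 1) hv, rfl⟩

theorem remLT_of_dvd_length {v : G.Path} (hv : n ∣ v.length) :
    remLT hn v = remLT hn (Path.vertex v.range) := by
  have h1 : (remLT hn v).1.length = 0 := by rw [length_remLT]; exact Nat.mod_eq_zero_of_dvd hv
  have h2 := Path.eq_vertex_of_length_eq_zero h1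
  have h3 : (remLT hn v).1.source = v.range := by
    rw [← range_remLT hn v, h2]; rfl
  rw [← remLT_coe hn (remLT hn v), h2, h3]

theorem exists_stepEdge_rng (hn : 1 ≤ n) (no_sources : ∀ x, ∃ e, G.rng e = x) (w : G.PathLT n) :
    ∃ α, (G.stepGraph n).rng α = w := by
  suffices h : ∃ v : G.Path, remLT hn v = w ∧ v.length ≠ 0 by
    obtain ⟨v, rfl, hv⟩ := h
    rcases v.eq_vertex_or_eq_cons with ⟨x, rfl⟩ | ⟨e, v', h', rfl⟩
    · exact absurd rfl hv
    · exact ⟨_, rng_stepOf hn e v' h'⟩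
  rcases w.1.eq_vertex_or_eq_cons with ⟨x, hx⟩ | ⟨e, v', h', hw⟩
  -- Length exactly n makes the remainder a vertex while keeping the path nonempty.
  · obtain ⟨v, hv, hv'⟩ := exists_path_range no_sources n x
    refine ⟨v, ?_, by omega⟩
    rw [remLT_of_dvd_length hn (by rw [hv]), hv', ← hx, remLT_coe]
  · exact ⟨w.1, remLT_coe hn w, by rw [hw]; exact Nat.succ_ne_zero _⟩

theorem length_rng (hn : 1 ≤ n) (α : G.StepEdge n) :
    ((G.stepGraph n).rng α).1.length = (α.1.2.1.length + 1) % n := by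
  conv_lhs => rw [← stepOf_coe hn α, rng_stepOf, length_remLT, Path.length_cons]

variable [Finite V] [Finite E]

theorem finite_setOf_length_eq (k : ℕ) : {v : G.Path | v.length = k}.Finite :=
  haveI : Finite {v : G.Path | v.length = k} := G.finite_pathEq k
  Set.toFinite _

variable (G) in
/-- The finite set of the paths of length `k`. -/
def level (k : ℕ) : Finset G.Path := (finite_setOf_length_eq (G := G) k).toFinset

theorem mem_level {k : ℕ} {v : G.Path} : v ∈ G.level k ↔ v.length = k := by
  simp [level]

variable {B : Type*} [NonUnitalCStarAlgebra B] {P : G.PathLT n → B} {S : G.StepEdge n → B}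
  (hck : (G.stepGraph n).IsCKFamily P S)
include hck

theorem sum_level_zero [Fintype (G.PathLT n)] :
    ∑ v ∈ G.level 0, pathElem hn P S v * star (pathElem hn P S v) =
      ∑ w : G.PathLT n with w.1.length = 0, P w := by
  refine Finset.sum_bij' (fun v _ => remLT hn v) (fun w _ => w.1) ?_ ?_ ?_ ?_ ?_
  · intro v hv
    rw [mem_level] at hv
    simp [length_remLT, hv]
  · intro w hw
    rw [mem_level]
    exact (Finset.mem_filter.1 hw).2
  · intro v hv
    rw [mem_level] at hv
    exact Path.rem_of_lt (by omega)
  · exact fun w _ => remLT_coe hn w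
  · intro v hv
    rw [mem_level] at hv
    rw [Path.eq_vertex_of_length_eq_zero hv, pathElem_vertex, hck.star_proj, hck.proj_mul_self]

/-- A pair (α, v) contributes only if v(n) is the source of α, and such pairs correspond to the
paths of length k + 1. -/
theorem sum_level_succ [Fintype (G.StepEdge n)] (k : ℕ) :
    ∑ v ∈ G.level (k + 1), pathElem hn P S v * star (pathElem hn P S v) =
      ∑ α, S α * (∑ v ∈ G.level k, pathElem hn P S v * star (pathElem hn P S v)) * star (S α) := by
  classical
  simp only [Finset.mul_sum, Finset.sum_mul]
  rw [← Finset.sum_product', ← Finset.sum_filter_of_ne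
    (p := fun q : G.StepEdge n × G.Path => remLT hn q.2 = q.1.1.2)]
  · symm
    refine Finset.sum_bij (fun q hq => q.2.cons q.1.1.1
      (eq_stepOf hn (Finset.mem_filter.1 hq).2).choose) ?_ ?_ ?_ ?_
    · intro q hq
      have := (Finset.mem_product.1 (Finset.mem_filter.1 hq).1).2
      rw [mem_level] at this ⊢
      rw [Path.length_cons, this]
    · intro q hq q' hq' h
      obtain ⟨h1, h2⟩ := Path.cons_inj.1 h
      refine Prod.ext (Subtype.ext (Prod.ext h1 ?_)) h2
      rw [← (Finset.mem_filter.1 hq).2, ← (Finset.mem_filter.1 hq').2, h2]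
    · intro v hv
      rw [mem_level] at hv
      rcases v.eq_vertex_or_eq_cons with ⟨x, rfl⟩ | ⟨e, v', h', rfl⟩
      · exact absurd hv.symm (Nat.succ_ne_zero _)
      · refine ⟨(stepOf hn e v' h', v'), ?_, rfl⟩
        refine Finset.mem_filter.2 ⟨Finset.mem_product.2 ⟨Finset.mem_univ _, ?_⟩, rfl⟩
        rw [mem_level]
        exact Nat.succ_injective hv
    · rintro ⟨α, v⟩ hq
      obtain ⟨h1, h2⟩ := eq_stepOf hn (Finset.mem_filter.1 hq).2
      rw [pathElem_cons, ← h2, star_mul]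
      simp only [mul_assoc]
  · rintro ⟨α, v⟩ _ h
    by_contra h1
    refine h ?_
    rw [← mul_assoc, edge_mul_pathElem_of_ne hn hck h1, zero_mul, zero_mul]

/-- Conjugation by S_α turns the sum over one residue class of lengths into S_α S_α^* if α starts in
that class, and into 0 otherwise. Edges starting in a class are exactly those ending in the next
one, where the sum relation applies at every vertex because E(n) has no sources. -/
theorem sum_level [Fintype (G.PathLT n)] (no_sources : ∀ x, ∃ e, G.rng e = x) (k : ℕ) :
    ∑ v ∈ G.level k, pathElem hn P S v * star (pathElem hn P S v) =
      ∑ w : G.PathLT n with w.1.length = k % n, P w := by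
  classical
  cases nonempty_fintype (G.StepEdge n)
  induction k with
  | zero => rw [sum_level_zero hn hck, Nat.zero_mod]
  | succ k ih =>
    rw [sum_level_succ hn hck, ih]
    have h1 : ∀ α : G.StepEdge n, S α * (∑ w : G.PathLT n with w.1.length = k % n, P w) * star (S α)
        = if ((G.stepGraph n).rng α).1.length = (k + 1) % n then S α * star (S α) else 0 := by
      intro α
      have hiff : α.1.2.1.length = k % n ↔ ((G.stepGraph n).rng α).1.length = (k + 1) % n := by
        rw [length_rng hn, ← Nat.mod_eq_of_lt α.1.2.2]
        exact ⟨fun h => Nat.ModEq.add_right 1 ((Nat.mod_mod _ _).trans h),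
          fun h => (Nat.mod_mod _ _).symm.trans (Nat.ModEq.add_right_cancel' 1 h)⟩
      rw [← if_congr hiff rfl rfl, Finset.mul_sum]
      split_ifs with h
      · rw [Finset.sum_eq_single ((G.stepGraph n).src α), hck.edge_mul_proj]
        · intro w _ hw
          rw [← hck.edge_mul_proj α, mul_assoc, hck.orthogonal _ _ hw.symm, mul_zero]
        · exact fun h' => (h' (Finset.mem_filter.2 ⟨Finset.mem_univ _, h⟩)).elim
      · rw [Finset.sum_eq_zero, zero_mul]
        intro w hw
        rw [← hck.edge_mul_proj α, mul_assoc, hck.orthogonal, mul_zero]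
        rintro rfl
        exact h (Finset.mem_filter.1 hw).2
    rw [Finset.sum_congr rfl fun α _ => h1 α, ← Finset.sum_filter,
      ← Finset.sum_fiberwise_of_maps_to (g := (G.stepGraph n).rng)
        (t := Finset.univ.filter fun w : G.PathLT n => w.1.length = (k + 1) % n)
        fun α hα => by simpa using hα]
    refine Finset.sum_congr rfl fun w hw => ?_
    rw [← hck.sum_filter_eq (exists_stepEdge_rng hn no_sources w), Finset.filter_filter]
    refine Finset.sum_congr (Finset.filter_congr fun α _ => ?_) fun _ _ => rfl
    refine ⟨fun h => h.2, fun h => ⟨?_, h⟩⟩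
    rw [h]
    exact (Finset.mem_filter.1 hw).2

/-- Each block of n consecutive lengths meets every residue once and so contributes all vertex
projections of E(n) once. -/
theorem sum_sum_level [Fintype (G.PathLT n)] (no_sources : ∀ x, ∃ e, G.rng e = x) (a L : ℕ) :
    ∑ k ∈ Finset.Ico (n * a) (n * (a + L)), ∑ v ∈ G.level k,
      pathElem hn P S v * star (pathElem hn P S v) = L • ∑ w, P w := by
  induction L with
  | zero => simp
  | succ L ih =>
    rw [← Finset.sum_Ico_consecutive _ (Nat.mul_le_mul_left n (Nat.le_add_right a L))
      (Nat.mul_le_mul_left n (show a + L ≤ a + (L + 1) by omega)), ih, succ_nsmul]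
    congr 1
    rw [Finset.sum_Ico_eq_sum_range, ← Nat.mul_sub, show a + (L + 1) - (a + L) = 1 by omega, mul_one,
      ← Finset.sum_fiberwise_of_maps_to (g := fun w : G.PathLT n => w.1.length)
        (t := Finset.range n) fun w _ => Finset.mem_range.2 w.2]
    refine Finset.sum_congr rfl fun j hj => ?_
    rw [sum_level hn hck no_sources, Nat.mul_add_mod, Nat.mod_eq_of_lt (Finset.mem_range.1 hj)]

end DirGraph
end

noncomputable section

/-! ### A Cauchy-Schwarz inequality for matrices acting on tuples in a C⋆-algebra -/

section CauchySchwarz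

open Matrix in
theorem star_dotProduct_self {τ : Type*} [Fintype τ] (z : τ → ℂ) :
    star z ⬝ᵥ z = ((∑ i, ‖z i‖ ^ 2 : ℝ) : ℂ) := by
  rw [dotProduct, Complex.ofReal_sum]
  refine Finset.sum_congr rfl fun i _ => ?_
  rw [Pi.star_apply, RCLike.star_def, Complex.conj_mul', Complex.ofReal_pow]

-- With C the matrix of inner products, Bessel's inequality gives ‖C x‖ ≤ ‖A (∑ x_k η_k)‖ ≤ ‖A‖ ‖x‖.
open Matrix ComplexOrder in
theorem posSemidef_norm_sq_sub_conjTranspose_mul {ι κ H : Type*} [Fintype ι] [Fintype κ]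
    [DecidableEq κ] [NormedAddCommGroup H] [InnerProductSpace ℂ H] {ξ : ι → H} {η : κ → H}
    (hξ : Orthonormal ℂ ξ) (hη : Orthonormal ℂ η) (A : H →L[ℂ] H) :
    (((‖A‖ ^ 2 : ℝ) : ℂ) • (1 : Matrix κ κ ℂ) -
      (Matrix.of fun i k => inner ℂ (ξ i) (A (η k)))ᴴ *
        Matrix.of fun i k => inner ℂ (ξ i) (A (η k))).PosSemidef := by
  set C : Matrix ι κ ℂ := Matrix.of fun i k => inner ℂ (ξ i) (A (η k)) with hC
  refine .of_dotProduct_mulVec_nonneg ?_ fun x => ?_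
  · refine Matrix.IsHermitian.sub ?_ (Matrix.isHermitian_conjTranspose_mul_self C)
    rw [Matrix.IsHermitian, Matrix.conjTranspose_smul, Matrix.conjTranspose_one]
    simp
  · have h2 : star x ⬝ᵥ ((Cᴴ * C) *ᵥ x) = star (C *ᵥ x) ⬝ᵥ (C *ᵥ x) := by
      rw [← Matrix.mulVec_mulVec, Matrix.dotProduct_mulVec, Matrix.star_mulVec]
    have h3 : ∀ i, (C *ᵥ x) i = inner ℂ (ξ i) (A (∑ k, x k • η k)) := by
      intro i
      rw [map_sum, inner_sum, Matrix.mulVec, dotProduct]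
      refine Finset.sum_congr rfl fun k _ => ?_
      rw [map_smul, inner_smul_right, mul_comm]
      rfl
    have h4 : ‖∑ k, x k • η k‖ ^ 2 = ∑ k, ‖x k‖ ^ 2 := by
      have := hη.inner_sum x x Finset.univ
      rw [inner_self_eq_norm_sq_to_K] at this
      have h5 := star_dotProduct_self x
      rw [dotProduct] at h5
      simp only [Pi.star_apply, RCLike.star_def] at h5
      rw [h5] at this
      exact Complex.ofReal_injective ((Complex.ofReal_pow _ _).trans this)
    have h5 : ∑ i, ‖(C *ᵥ x) i‖ ^ 2 ≤ ‖A‖ ^ 2 * ∑ k, ‖x k‖ ^ 2 := by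
      simp only [h3]
      refine (hξ.sum_inner_products_le _).trans ?_
      rw [← h4, ← mul_pow]
      gcongr
      exact A.le_opNorm _
    rw [Matrix.sub_mulVec, dotProduct_sub, h2, star_dotProduct_self, Matrix.smul_mulVec, Matrix.one_mulVec,
      dotProduct_smul, star_dotProduct_self, smul_eq_mul, ← Complex.ofReal_mul, ← Complex.ofReal_sub]
    exact_mod_cast sub_nonneg.2 h5

variable {B : Type*} [NonUnitalCStarAlgebra B] [PartialOrder B] [StarOrderedRing B]

/-- This is Cauchy-Schwarz in the Hilbert C⋆-module of tuples. The inner product of x and a there is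
∑ a_i x_i^*, hence the tuple of adjoints of y as first vector. -/
theorem norm_sum_mul_sq_le {ι : Type*} [Fintype ι] (a y : ι → B) :
    ‖∑ i, a i * y i‖ ^ 2 ≤ ‖∑ i, a i * star (a i)‖ * ‖∑ i, star (y i) * y i‖ := by
  let x' : WithCStarModule B (ι → B) := (WithCStarModule.equiv B (ι → B)).symm (star y)
  let a' : WithCStarModule B (ι → B) := (WithCStarModule.equiv B (ι → B)).symm a
  have h := CStarModule.norm_inner_le (A := B) (WithCStarModule B (ι → B)) (x := x') (y := a')
  have h1 : inner B x' a' = ∑ i, a i * y i := by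
    rw [WithCStarModule.pi_inner]
    refine Finset.sum_congr rfl fun i _ => ?_
    rw [WithCStarModule.inner_def]
    exact congrArg (a i * ·) (star_star (y i))
  have h2 : ‖x'‖ ^ 2 = ‖∑ i, star (y i) * y i‖ := by
    rw [WithCStarModule.pi_norm_sq]
    refine congrArg norm (Finset.sum_congr rfl fun i _ => ?_)
    rw [WithCStarModule.inner_def]
    exact congrArg (star (y i) * ·) (star_star (y i))
  have h3 : ‖a'‖ ^ 2 = ‖∑ i, a i * star (a i)‖ := by
    rw [WithCStarModule.pi_norm_sq]
    rfl
  rw [h1] at h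
  rw [← h2, ← h3, ← mul_pow, mul_comm]
  gcongr

-- Absorbing the matrix into y_i = ∑_k C_{ik} b_k^* reduces the claim to `norm_sum_mul_sq_le` and
-- the operator inequality ∑ y_i^* y_i ≤ ‖A‖² ∑ b_k b_k^*.
open ComplexOrder in
theorem norm_sum_inner_smul_mul_star_sq_le {ι κ H : Type*} [Fintype ι] [Fintype κ]
    [NormedAddCommGroup H] [InnerProductSpace ℂ H] {ξ : ι → H} {η : κ → H}
    (hξ : Orthonormal ℂ ξ) (hη : Orthonormal ℂ η) (A : H →L[ℂ] H) (a : ι → B) (b : κ → B) :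
    ‖∑ k, ∑ i, inner ℂ (ξ i) (A (η k)) • (a i * star (b k))‖ ^ 2 ≤
      ‖A‖ ^ 2 * ‖∑ i, a i * star (a i)‖ * ‖∑ k, b k * star (b k)‖ := by
  classical
  let C : Matrix ι κ ℂ := Matrix.of fun i k => inner ℂ (ξ i) (A (η k))
  let y : ι → B := fun i => ∑ k, C i k • star (b k)
  have h1 : ∑ k, ∑ i, inner ℂ (ξ i) (A (η k)) • (a i * star (b k)) = ∑ i, a i * y i := by
    rw [Finset.sum_comm]
    refine Finset.sum_congr rfl fun i _ => ?_
    rw [Finset.mul_sum]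
    exact Finset.sum_congr rfl fun k _ => (mul_smul_comm _ _ _).symm
  have h2 : ∑ i, star (y i) * y i = ∑ k, ∑ l, (C.conjTranspose * C) k l • (b k * star (b l)) := by
    simp only [y, star_sum, Finset.sum_mul_sum, Matrix.mul_apply, Finset.sum_smul]
    rw [Finset.sum_comm]
    refine Finset.sum_congr rfl fun k _ => ?_
    rw [Finset.sum_comm]
    refine Finset.sum_congr rfl fun l _ => Finset.sum_congr rfl fun i _ => ?_
    rw [star_smul, star_star, smul_mul_smul_comm, Matrix.conjTranspose_apply]
  -- Splitting ‖A‖² - C^* C into positive rank-one matrices exhibits the difference of the two sides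
  -- as a sum of elements z z^* of B.
  obtain ⟨m, u, hu⟩ := Matrix.posSemidef_iff_eq_sum_vecMulVec.1
    (posSemidef_norm_sq_sub_conjTranspose_mul hξ hη A)
  have h3 : ((‖A‖ ^ 2 : ℝ) : ℂ) • ∑ k, b k * star (b k) - ∑ i, star (y i) * y i =
      ∑ j, (∑ k, u j k • b k) * star (∑ k, u j k • b k) := by
    have e : ((‖A‖ ^ 2 : ℝ) : ℂ) • ∑ k, b k * star (b k) - ∑ i, star (y i) * y i =
        ∑ k, ∑ l, (((‖A‖ ^ 2 : ℝ) : ℂ) • (1 : Matrix κ κ ℂ) - C.conjTranspose * C) k l •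
          (b k * star (b l)) := by
      rw [h2, Finset.smul_sum, ← Finset.sum_sub_distrib]
      refine Finset.sum_congr rfl fun k _ => ?_
      simp only [Matrix.sub_apply, sub_smul, Finset.sum_sub_distrib, Matrix.smul_apply,
        Matrix.one_apply]
      congr 1
      simp
    rw [e, hu]
    simp only [star_sum, Finset.sum_mul_sum, Matrix.sum_apply, Finset.sum_smul]
    symm
    rw [Finset.sum_comm]
    refine Finset.sum_congr rfl fun k _ => ?_
    rw [Finset.sum_comm]
    refine Finset.sum_congr rfl fun l _ => Finset.sum_congr rfl fun j _ => ?_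
    rw [Matrix.vecMulVec_apply, star_smul, smul_mul_smul_comm]
    rfl
  have h4 : ∑ i, star (y i) * y i ≤ ((‖A‖ ^ 2 : ℝ) : ℂ) • ∑ k, b k * star (b k) := by
    rw [← sub_nonneg, h3]
    exact Finset.sum_nonneg fun j _ => mul_star_self_nonneg _
  have h5 := CStarAlgebra.norm_le_norm_of_nonneg_of_le
    (Finset.sum_nonneg fun i _ => star_mul_self_nonneg (y i)) h4
  rw [norm_smul, Complex.norm_real, Real.norm_of_nonneg (by positivity)] at h5
  rw [h1]
  calc _ ≤ _ := norm_sum_mul_sq_le a y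
    _ ≤ ‖∑ i, a i * star (a i)‖ * (‖A‖ ^ 2 * ‖∑ k, b k * star (b k)‖) := by gcongr
    _ = _ := by ring

end CauchySchwarz
end

noncomputable section

namespace DirGraph

variable {V E : Type u} {G : DirGraph V E} {n : ℕ} (hn : 1 ≤ n)

/-! ### Comparison of the elementary shifts with a Cuntz-Krieger family -/

section Local

variable {B : Type*} [NonUnitalCStarAlgebra B] (P : G.PathLT n → B) (S : G.StepEdge n → B)

/-- The span of the pairs `(ξ_p, s_p)` of the paths `p` with `||p| - k| ≤ d`. -/
def pairSpan (k d : ℕ) : Submodule ℂ (G.FockSpace × B) :=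
  Submodule.span ℂ ((fun p => (G.xi p, pathElem hn P S p)) ''
    {p | k ≤ p.length + d ∧ p.length ≤ k + d})

/-- `A` and `s` act in the same way on the pairs `(ξ_v, s_v)` with `|v|` sufficiently large, and
change lengths by a bounded amount only. -/
def IsLocalPair (A : G.FockSpace →L[ℂ] G.FockSpace) (s : B) : Prop :=
  ∃ d, ∀ v : G.Path, d ≤ v.length →
    (A (G.xi v), s * pathElem hn P S v) ∈ pairSpan hn P S v.length d

theorem mem_pairSpan {p : G.Path} {k d : ℕ} (h1 : k ≤ p.length + d) (h2 : p.length ≤ k + d) :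
    (G.xi p, pathElem hn P S p) ∈ pairSpan hn P S k d :=
  Submodule.subset_span ⟨p, ⟨h1, h2⟩, rfl⟩

theorem pairSpan_mono {k l d d' : ℕ} (h1 : k + d ≤ l + d') (h2 : l + d ≤ k + d') :
    pairSpan (G := G) hn P S k d ≤ pairSpan hn P S l d' := by
  refine Submodule.span_mono (Set.image_mono ?_)
  rintro p ⟨h3, h4⟩
  constructor <;> omega

variable {P S}

theorem IsLocalPair.zero : IsLocalPair (G := G) hn P S 0 0 :=
  ⟨0, fun v _ => by rw [zero_mul]; exact zero_mem _⟩

theorem IsLocalPair.smul (c : ℂ) {A : G.FockSpace →L[ℂ] G.FockSpace} {s : B}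
    (h : IsLocalPair hn P S A s) : IsLocalPair hn P S (c • A) (c • s) := by
  obtain ⟨d, hd⟩ := h
  refine ⟨d, fun v hv => ?_⟩
  rw [smul_mul_assoc]
  exact Submodule.smul_mem _ c (hd v hv)

theorem IsLocalPair.add {A A' : G.FockSpace →L[ℂ] G.FockSpace} {s s' : B}
    (h : IsLocalPair hn P S A s) (h' : IsLocalPair hn P S A' s') :
    IsLocalPair hn P S (A + A') (s + s') := by
  obtain ⟨d, hd⟩ := h
  obtain ⟨d', hd'⟩ := h'
  refine ⟨d + d', fun v hv => ?_⟩
  rw [add_mul]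
  exact Submodule.add_mem _ (pairSpan_mono hn P S (by omega) (by omega) (hd v (by omega)))
    (pairSpan_mono hn P S (by omega) (by omega) (hd' v (by omega)))

theorem IsLocalPair.mul {A A' : G.FockSpace →L[ℂ] G.FockSpace} {s s' : B}
    (h : IsLocalPair hn P S A s) (h' : IsLocalPair hn P S A' s') :
    IsLocalPair hn P S (A * A') (s * s') := by
  obtain ⟨d, hd⟩ := h
  obtain ⟨d', hd'⟩ := h'
  -- The pair (A', s') shortens v by at most d', so the paths that occur still have length at least
  -- d and (A, s) is controlled on them.
  refine ⟨d + d', fun v hv => ?_⟩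
  let Λ : G.FockSpace × B →ₗ[ℂ] G.FockSpace × B :=
    LinearMap.prodMap (A : G.FockSpace →ₗ[ℂ] G.FockSpace) (LinearMap.mulLeft ℂ s)
  have hle : pairSpan (G := G) hn P S v.length d' ≤
      (pairSpan hn P S v.length (d + d')).comap Λ := by
    refine Submodule.span_le.2 ?_
    rintro _ ⟨p, ⟨h1, h2⟩, rfl⟩
    exact pairSpan_mono hn P S (by omega) (by omega) (hd p (by omega))
  have := hle (hd' v (by omega))
  rw [mul_assoc]
  exact this

variable [Finite V] [Finite E] (hck : (G.stepGraph n).IsCKFamily P S)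
include hck

theorem isLocalPair_proj (w : G.PathLT n) : IsLocalPair hn P S (remProj hn w) (P w) := by
  refine ⟨0, fun v _ => ?_⟩
  by_cases h : remLT hn v = w
  · subst h
    rw [diagProj_xi_of_mem (show v ∈ {v' | remLT hn v' = remLT hn v} from rfl), proj_mul_pathElem hn hck]
    exact mem_pairSpan hn P S le_rfl le_rfl
  · rw [diagProj_xi_of_notMem h, proj_mul_pathElem_of_ne hn hck h]
    exact zero_mem _

theorem isLocalPair_edge (α : G.StepEdge n) : IsLocalPair hn P S (stepOp hn α) (S α) := by
  refine ⟨1, fun v _ => ?_⟩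
  rcases stepOp_xi_cases hn α v with ⟨e, h, rfl, h2⟩ | ⟨h1, h2⟩
  · rw [h2, ← pathElem_cons]
    refine mem_pairSpan hn P S ?_ ?_ <;> rw [Path.length_cons]
    omega
  · rw [h2, edge_mul_pathElem_of_ne hn hck h1]
    exact zero_mem _

theorem isLocalPair_star_edge (α : G.StepEdge n) :
    IsLocalPair hn P S (star (stepOp hn α)) (star (S α)) := by
  classical
  -- Vertices must be excluded: the adjoint of an elementary shift kills their vectors, whereas
  -- S_α^* P_x is nonzero when α ends at x and S_α ≠ 0.
  refine ⟨1, fun v hv => ?_⟩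
  rcases v.eq_vertex_or_eq_cons with ⟨x, rfl⟩ | ⟨e, v', h', rfl⟩
  · exact absurd hv (by rw [Path.length_vertex]; omega)
  · rw [star_stepOp_xi_cons, star_edge_mul_pathElem_cons hn hck]
    split_ifs
    · refine mem_pairSpan hn P S ?_ ?_ <;> rw [Path.length_cons]
      omega
    · exact zero_mem _

/-- Locality is not visibly stable under adjoints, so the adjoint pair is carried through the
induction. -/
theorem isLocalPair_eval (t : StarPoly (G.PathLT n) (G.StepEdge n)) :
    IsLocalPair hn P S (t.eval (remProj hn) (stepOp hn)) (t.eval P S) ∧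
      IsLocalPair hn P S (star (t.eval (remProj hn) (stepOp hn))) (star (t.eval P S)) := by
  induction t with
  | vertex w =>
    refine ⟨isLocalPair_proj hn hck w, ?_⟩
    change IsLocalPair hn P S (star (remProj hn w)) (star (P w))
    rw [star_diagProj, hck.star_proj]
    exact isLocalPair_proj hn hck w
  | edge α => exact ⟨isLocalPair_edge hn hck α, isLocalPair_star_edge hn hck α⟩
  | zero =>
    simp only [StarPoly.eval, star_zero]
    exact ⟨IsLocalPair.zero hn, IsLocalPair.zero hn⟩
  | add a b ha hb =>
    simp only [StarPoly.eval, star_add]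
    exact ⟨ha.1.add hn hb.1, ha.2.add hn hb.2⟩
  | mul a b ha hb =>
    simp only [StarPoly.eval, star_mul]
    exact ⟨ha.1.mul hn hb.1, hb.2.mul hn ha.2⟩
  | smul c a ha =>
    simp only [StarPoly.eval, star_smul]
    exact ⟨ha.1.smul hn c, ha.2.smul hn _⟩
  | star a ha =>
    simp only [StarPoly.eval, star_star]
    exact ⟨ha.2, ha.1⟩

end Local

/-! ### The averaging estimate over long windows of path lengths -/

section Folner

variable [Finite V] [Finite E]

variable (G n) in
/-- The finite set of the paths `v` with `n a ≤ |v| < n b`. -/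
def window (a b : ℕ) : Finset G.Path :=
  (show {v : G.Path | n * a ≤ v.length ∧ v.length < n * b}.Finite from
    (finite_setOf_length_lt (n * b)).subset fun _ h => h.2).toFinset

theorem mem_window {a b : ℕ} {v : G.Path} :
    v ∈ window G n a b ↔ n * a ≤ v.length ∧ v.length < n * b := by
  simp [window]

variable {B : Type*} [NonUnitalCStarAlgebra B] {P : G.PathLT n → B} {S : G.StepEdge n → B}
  (hck : (G.stepGraph n).IsCKFamily P S)
include hck

theorem sum_window [Fintype (G.PathLT n)] (no_sources : ∀ x, ∃ e, G.rng e = x) (a L : ℕ) :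
    ∑ v ∈ window G n a (a + L), pathElem hn P S v * star (pathElem hn P S v) =
      L • ∑ w, P w := by
  classical
  rw [← sum_sum_level hn hck no_sources a L, ← Finset.sum_fiberwise_of_maps_to
    (g := Path.length) (t := Finset.Ico (n * a) (n * (a + L)))
    fun v hv => Finset.mem_Ico.2 (mem_window.1 hv)]
  refine Finset.sum_congr rfl fun k hk => Finset.sum_congr ?_ fun _ _ => rfl
  ext v
  rw [Finset.mem_filter, mem_window, mem_level]
  rw [Finset.mem_Ico] at hk
  constructor
  · exact fun h => h.2
  · rintro rfl
    exact ⟨hk, rfl⟩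

variable [PartialOrder B] [StarOrderedRing B]

/-- Summing s s_v s_v^* over L periods gives L s; expanding each s s_v by the coefficients of A ξ_v
puts this in the form bounded by the matrix Cauchy-Schwarz inequality. -/
theorem sq_norm_le_of_isLocalPair [Fintype (G.PathLT n)] (no_sources : ∀ x, ∃ e, G.rng e = x)
    {A : G.FockSpace →L[ℂ] G.FockSpace} {s : B} (hs : s * ∑ w, P w = s) {d : ℕ}
    (hd : ∀ v : G.Path, d ≤ v.length →
      (A (G.xi v), s * pathElem hn P S v) ∈ pairSpan hn P S v.length d) (M L : ℕ) :
    (L * ‖s‖) ^ 2 ≤ ‖A * tailProj G M‖ ^ 2 * (L + 2 * d : ℕ) * L := by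
  classical
  -- The inner window `W'` has L periods. `W` adds d periods on each side, hence at least d lengths,
  -- so it contains every path that A can reach from `W'`.
  set W := window G n M (M + (L + 2 * d))
  set W' := window G n (M + d) (M + d + L)
  have hnorm : ∀ k : ℕ, ‖k • ∑ w, P w‖ ≤ k := fun k => by
    refine (norm_nsmul_le).trans ?_
    have := hck.isStarProjection_sum.norm_le
    exact mul_le_of_le_one_right (Nat.cast_nonneg k) this
  have hnd : d ≤ n * d := Nat.le_mul_of_pos_left d hn
  have hnM : M ≤ n * M := Nat.le_mul_of_pos_left M hn
  have key : ∀ v ∈ W', s * pathElem hn P S v =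
      ∑ p ∈ W, inner ℂ (G.xi p) (A (G.xi v)) • pathElem hn P S p := by
    intro v hv
    obtain ⟨hv1, hv2⟩ := mem_window.1 hv
    rw [Nat.mul_add] at hv1
    rw [Nat.mul_add, Nat.mul_add] at hv2
    have hmem := hd v (by omega)
    -- On the generators (ξ_q, s_q) the second component is recovered linearly from the coordinates
    -- of the first; hence it is on their span.
    have hle : pairSpan (G := G) hn P S v.length d ≤ LinearMap.eqLocus (LinearMap.snd ℂ _ _)
        (∑ p ∈ W, ((innerSL ℂ (G.xi p) : G.FockSpace →ₗ[ℂ] ℂ).smulRight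
          (pathElem hn P S p)).comp (LinearMap.fst ℂ G.FockSpace B)) := by
      refine Submodule.span_le.2 ?_
      rintro _ ⟨q, ⟨h1, h2⟩, rfl⟩
      have hq : q ∈ W := by
        refine mem_window.2 ?_
        rw [Nat.mul_add, Nat.mul_add, show n * (2 * d) = n * d + n * d by ring]
        omega
      change pathElem hn P S q = _
      rw [LinearMap.sum_apply, Finset.sum_eq_single q]
      · change _ = inner ℂ (G.xi q) (G.xi q) • pathElem hn P S q
        rw [inner_self_eq_norm_sq_to_K, orthonormal_xi.1]
        simp
      · intro p _ hp
        change inner ℂ (G.xi p) (G.xi q) • pathElem hn P S p = 0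
        rw [G.inner_xi_of_ne hp, zero_smul]
      · exact fun h => absurd hq h
    have := hle hmem
    rw [LinearMap.mem_eqLocus] at this
    refine this.trans ?_
    rw [LinearMap.sum_apply]
    rfl
  -- Paths in `W'` have length at least n M ≥ M, so A can be replaced by its restriction to the tail
  -- without changing the coefficients.
  have htail : ∀ v ∈ W', (A * tailProj G M) (G.xi v) = A (G.xi v) := by
    intro v hv
    obtain ⟨hv1, -⟩ := mem_window.1 hv
    rw [Nat.mul_add] at hv1
    change A (tailProj G M (G.xi v)) = _
    rw [diagProj_xi_of_mem]
    exact show M ≤ v.length by omega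
  have hsum : ∑ v : W', ∑ p : W, inner ℂ (G.xi p) ((A * tailProj G M) (G.xi v)) •
      (pathElem hn P S p.1 * star (pathElem hn P S v.1)) = (L : ℕ) • s := by
    have e : L • s = s * L • ∑ w, P w := by rw [mul_smul_comm, hs]
    rw [e, ← sum_window hn hck no_sources (M + d) L, Finset.mul_sum, ← Finset.sum_coe_sort W']
    refine Finset.sum_congr rfl fun v _ => ?_
    rw [← mul_assoc, key v.1 v.2, Finset.sum_mul, ← Finset.sum_coe_sort W, htail v.1 v.2]
    exact Finset.sum_congr rfl fun p _ => (smul_mul_assoc _ _ _).symm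
  have h := norm_sum_inner_smul_mul_star_sq_le
    (orthonormal_xi.comp (Subtype.val : W → G.Path) Subtype.val_injective)
    (orthonormal_xi.comp (Subtype.val : W' → G.Path) Subtype.val_injective)
    (A * tailProj G M) (fun p => pathElem hn P S p.1) (fun v => pathElem hn P S v.1)
  simp only [Function.comp_apply] at h
  rw [hsum, Finset.sum_coe_sort W fun p => pathElem hn P S p * star (pathElem hn P S p),
    Finset.sum_coe_sort W' fun p => pathElem hn P S p * star (pathElem hn P S p),
    sum_window hn hck no_sources, sum_window hn hck no_sources] at h
  have e : ‖(L : ℕ) • s‖ = L * ‖s‖ := by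
    rw [← Nat.cast_smul_eq_nsmul ℂ, norm_smul]
    simp
  rw [e] at h
  refine h.trans ?_
  gcongr
  · exact hnorm _
  · exact hnorm _

theorem norm_eval_le_norm_mul_tailProj [Fintype (G.PathLT n)]
    (no_sources : ∀ x, ∃ e, G.rng e = x) (t : StarPoly (G.PathLT n) (G.StepEdge n))
    (ht : t.eval P S * ∑ w, P w = t.eval P S) (M : ℕ) :
    ‖t.eval P S‖ ≤ ‖t.eval (remProj hn) (stepOp hn) * tailProj G M‖ := by
  obtain ⟨d, hd⟩ := (isLocalPair_eval hn hck t).1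
  set s := t.eval P S
  set C := ‖t.eval (remProj hn) (stepOp hn) * tailProj G M‖
  -- The boundary cost 2d is negligible against L + 1 periods; the shift by one keeps the
  -- denominator nonzero.
  have h : ∀ L : ℕ, ‖s‖ ^ 2 ≤ C ^ 2 * (1 + (2 * d : ℕ) / ((L : ℝ) + 1)) := by
    intro L
    have h1 := sq_norm_le_of_isLocalPair hn hck no_sources ht hd M (L + 1)
    have hL : (0 : ℝ) < (L : ℝ) + 1 := by positivity
    have h2 : ((L : ℝ) + 1) ^ 2 * ‖s‖ ^ 2 ≤
        ((L : ℝ) + 1) ^ 2 * (C ^ 2 * (1 + (2 * d : ℕ) / ((L : ℝ) + 1))) := by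
      calc _ = (((L + 1 : ℕ) : ℝ) * ‖s‖) ^ 2 := by push_cast; ring
        _ ≤ _ := h1
        _ = _ := by push_cast; field_simp; rfl
    exact le_of_mul_le_mul_left h2 (by positivity)
  have hlim : Filter.Tendsto (fun L : ℕ => C ^ 2 * (1 + (2 * d : ℕ) / ((L : ℝ) + 1)))
      Filter.atTop (nhds (C ^ 2 * (1 + 0))) := by
    refine Filter.Tendsto.const_mul _ (Filter.Tendsto.const_add _ ?_)
    have := tendsto_one_div_add_atTop_nhds_zero_nat (𝕜 := ℝ)
    simpa [div_eq_mul_inv] using this.const_mul ((2 * d : ℕ) : ℝ)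
  have h3 := ge_of_tendsto' hlim h
  rw [add_zero, mul_one] at h3
  exact le_of_sq_le_sq h3 (norm_nonneg _)

end Folner

end DirGraph
end

noncomputable section

namespace DirGraph

variable {V E : Type u} {G : DirGraph V E} {n : ℕ}

/-! ### `ℬ(n)` as a C⋆-algebra -/

theorem isClosed_shiftAlgebra :
    IsClosed (G.shiftAlgebra n : Set (G.FockSpace →L[ℂ] G.FockSpace)) :=
  NonUnitalStarSubalgebra.isClosed_topologicalClosure _

@[reducible]
def shiftAlgebraCStarAlgebra : NonUnitalCStarAlgebra (G.shiftAlgebra n) :=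
  NonUnitalStarSubalgebra.nonUnitalCStarAlgebra (G.shiftAlgebra n)
    (h_closed := isClosed_shiftAlgebra)

attribute [local instance] shiftAlgebraCStarAlgebra

theorem mem_compactIdeal_iff [Fintype V] {A : G.shiftAlgebra n} :
    A ∈ (G.compactIdeal n).toSubmodule ↔ IsCompactOperator A.1 :=
  isBlockCompact_iff A.2

theorem isClosed_compactIdeal [Fintype V] :
    IsClosed ((G.compactIdeal n).toSubmodule : Set (G.shiftAlgebra n)) := by
  have h : ((G.compactIdeal n).toSubmodule : Set (G.shiftAlgebra n)) =
      Subtype.val ⁻¹' {A : G.FockSpace →L[ℂ] G.FockSpace | IsCompactOperator A} := by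
    ext A
    exact mem_compactIdeal_iff
  rw [h]
  exact isClosed_setOfPred_isCompactOperator.preimage continuous_subtype_val

/-- The C⋆-algebra structure of `ℬ(n)`. -/
@[reducible]
def bunceDeddensCStarAlgebra [Fintype V] [Finite E] (hn : 1 ≤ n)
    (no_sinks : ∀ x, ∃ e, G.src e = x) : NonUnitalCStarAlgebra (G.BunceDeddens n) :=
  StarIdeal.quotientCStarAlgebra (G.compactIdeal n) isClosed_compactIdeal
    -- The complements 1 - T_M are compact, so A and A T_M have the same class, while K T_M tends to
    -- 0 for compact K.
    (fun M => ⟨tailProj G M, tailProj_mem hn no_sinks M⟩)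
    (fun M => ⟨Subtype.ext (isStarProjection_diagProj _).1,
      Subtype.ext (isStarProjection_diagProj _).2⟩)
    (fun M A => mem_compactIdeal_iff.2 (by
      have : (A.1 - A.1 * tailProj G M) = A.1 * (1 - tailProj G M) := by rw [mul_sub, mul_one]
      change IsCompactOperator (A.1 - A.1 * tailProj G M : G.FockSpace →L[ℂ] G.FockSpace)
      rw [this]
      exact (isCompactOperator_one_sub_tailProj M).clm_comp A.1))
    (fun K hK => tendsto_subtype_rng.2 (tendsto_mul_tailProj (mem_compactIdeal_iff.1 hK)))

/-- Any other lift differs from A by a compact K, and K T_M is negligible for large M, so a bound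
valid for all M survives the change of lift. -/
theorem norm_mk_bunceDeddens_le [Fintype V] [Finite E] (hn : 1 ≤ n)
    (no_sinks : ∀ x, ∃ e, G.src e = x) {A : G.shiftAlgebra n} {r : ℝ}
    (hr : ∀ M, r ≤ ‖A.1 * tailProj G M‖) :
    letI := bunceDeddensCStarAlgebra hn no_sinks
    r ≤ ‖(StarIdeal.Quotient.mk (G.compactIdeal n) A : G.BunceDeddens n)‖ := by
  let := bunceDeddensCStarAlgebra hn no_sinks
  refine le_of_forall_pos_le_add fun ε hε => ?_
  obtain ⟨A', hA', hlt⟩ := Submodule.Quotient.norm_mk_lt (S := (G.compactIdeal n).toSubmodule)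
    (StarIdeal.Quotient.mk (G.compactIdeal n) A) (half_pos hε)
  have hK : IsCompactOperator (A - A').1 :=
    mem_compactIdeal_iff.1 ((StarIdeal.Quotient.mk_eq_mk (G.compactIdeal n)).1 hA'.symm)
  obtain ⟨M, hM⟩ := ((tendsto_mul_tailProj hK).norm.eventually_lt_const
    (show ‖(0 : G.FockSpace →L[ℂ] G.FockSpace)‖ < ε / 2 by rw [norm_zero]; exact half_pos hε)).exists
  have h1 : ‖tailProj G M‖ ≤ 1 := (isStarProjection_diagProj _).norm_le
  calc r ≤ ‖A.1 * tailProj G M‖ := hr M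
    _ = ‖A'.1 * tailProj G M + (A - A').1 * tailProj G M‖ := by
        rw [← add_mul]; congr 2; exact (add_sub_cancel A'.1 A.1).symm
    _ ≤ ‖A'.1‖ * 1 + ε / 2 := by
        refine (norm_add_le _ _).trans (add_le_add ((norm_mul_le _ _).trans ?_) hM.le)
        gcongr
    _ ≤ _ := by
        have : ‖A'.1‖ < ‖(StarIdeal.Quotient.mk (G.compactIdeal n) A : G.BunceDeddens n)‖ + ε / 2 :=
          hlt
        linarith

variable [Fintype V] [Finite E] (hn : 1 ≤ n) (no_sinks : ∀ x, ∃ e, G.src e = x)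

/-- The image of a vertex projection in `ℬ(n)`. -/
def bunceDeddensP (w : G.PathLT n) : G.BunceDeddens n :=
  StarIdeal.Quotient.mkHom (G.compactIdeal n) ⟨remProj hn w, remProj_mem hn no_sinks w⟩

/-- The image of an elementary shift in `ℬ(n)`. -/
def bunceDeddensS (α : G.StepEdge n) : G.BunceDeddens n :=
  StarIdeal.Quotient.mkHom (G.compactIdeal n) ⟨stepOp hn α, stepOp_mem hn α⟩

theorem isCKFamily_bunceDeddens :
    letI := bunceDeddensCStarAlgebra hn no_sinks
    (G.stepGraph n).IsCKFamily (bunceDeddensP hn no_sinks) (bunceDeddensS hn) := by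
  let := bunceDeddensCStarAlgebra hn no_sinks
  let q := StarIdeal.Quotient.mkHom (G.compactIdeal n)
  refine ⟨fun w => ⟨?_, ?_⟩, fun α => ?_, fun w w' h => ?_, fun α β h => ?_, fun α => ?_,
    fun w _ => ?_⟩
  · exact congrArg q (Subtype.ext (isStarProjection_diagProj _).1)
  · exact congrArg q (Subtype.ext (isStarProjection_diagProj _).2)
  · exact congrArg q (Subtype.ext (stepOp_partialIsometry hn α))
  · exact (congrArg q (Subtype.ext (remProj_mul_of_ne hn h))).trans (map_zero q)
  · exact (congrArg q (Subtype.ext (star_stepOp_mul_of_ne hn h))).trans (map_zero q)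
  · exact congrArg q (Subtype.ext (star_stepOp_mul_self hn α))
  · have h1 : ∑ᶠ α ∈ {α : G.StepEdge n | (G.stepGraph n).rng α = w},
        bunceDeddensS hn α * star (bunceDeddensS hn α) =
        q (∑ᶠ α ∈ {α : G.StepEdge n | (G.stepGraph n).rng α = w},
          (⟨stepOp hn α, stepOp_mem hn α⟩ : G.shiftAlgebra n) *
            star ⟨stepOp hn α, stepOp_mem hn α⟩) :=
      ((AddMonoidHomClass.toAddMonoidHom q).map_finsum_mem _ (Set.toFinite _)).symm
    rw [h1]
    refine (StarIdeal.Quotient.mk_eq_mk _).2 (mem_compactIdeal_iff.2 ?_)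
    have h2 := isCompactOperator_sum_sub hn w
    let j := NonUnitalStarSubalgebraClass.subtype (G.shiftAlgebra n)
    let F : G.StepEdge n → G.shiftAlgebra n := fun α =>
      ⟨stepOp hn α, stepOp_mem hn α⟩ * star ⟨stepOp hn α, stepOp_mem hn α⟩
    have h3 : j (∑ᶠ α ∈ {α : G.StepEdge n | (G.stepGraph n).rng α = w}, F α) =
        ∑ᶠ α ∈ {α : G.StepEdge n | (G.stepGraph n).rng α = w}, j (F α) :=
      (AddMonoidHomClass.toAddMonoidHom j).map_finsum_mem _ (Set.toFinite _)
    have h4 : ∀ α, j (F α) = stepOp hn α * star (stepOp hn α) := fun _ => rfl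
    simp only [← h4] at h2
    rw [← h3] at h2
    exact h2

theorem eval_bunceDeddens (t : StarPoly (G.PathLT n) (G.StepEdge n)) :
    letI := bunceDeddensCStarAlgebra hn no_sinks
    ∃ h : t.eval (remProj hn) (stepOp hn) ∈ G.shiftAlgebra n,
      t.eval (bunceDeddensP hn no_sinks) (bunceDeddensS hn) =
        StarIdeal.Quotient.mk (G.compactIdeal n) ⟨t.eval (remProj hn) (stepOp hn), h⟩ := by
  let := bunceDeddensCStarAlgebra hn no_sinks
  let P' : G.PathLT n → G.shiftAlgebra n := fun w => ⟨remProj hn w, remProj_mem hn no_sinks w⟩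
  let S' : G.StepEdge n → G.shiftAlgebra n := fun α => ⟨stepOp hn α, stepOp_mem hn α⟩
  have h1 := StarPoly.map_eval (NonUnitalStarSubalgebraClass.subtype (G.shiftAlgebra n)) P' S' t
  have h2 := StarPoly.map_eval (StarIdeal.Quotient.mkHom (G.compactIdeal n)) P' S' t
  change (t.eval P' S').1 = t.eval (remProj hn) (stepOp hn) at h1
  refine ⟨h1 ▸ (t.eval P' S').2, ?_⟩
  refine h2.symm.trans ?_
  exact congrArg (StarIdeal.Quotient.mk (G.compactIdeal n)) (Subtype.ext h1)

/-- `ℬ(n)` is isomorphic to the Cuntz-Krieger algebra of `E(n)`. -/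
theorem nonempty_stepGraph_ckAlgebra_equiv_bunceDeddens
    (hn : 1 ≤ n) (no_sinks : ∀ x, ∃ e, G.src e = x) (no_sources : ∀ x, ∃ e, G.rng e = x) :
    Nonempty ((G.stepGraph n).CKAlgebra ≃⋆ₐ[ℂ] G.BunceDeddens n) := by
  classical
  cases nonempty_fintype (G.PathLT n)
  let := bunceDeddensCStarAlgebra hn no_sinks
  obtain ⟨Ψ, ⟨hP, hS⟩, -⟩ := (G.stepGraph n).existsUnique_ckLift
    (isCKFamily_bunceDeddens hn no_sinks)
  have heval : ∀ t : StarPoly (G.PathLT n) (G.StepEdge n),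
      Ψ (t.eval (G.stepGraph n).ckP (G.stepGraph n).ckS) =
        t.eval (bunceDeddensP hn no_sinks) (bunceDeddensS hn) := by
    intro t
    rw [StarPoly.map_eval]
    simp only [hP, hS]
  have hcont : Continuous Ψ := AddMonoidHomClass.continuous_of_bound Ψ 1 fun a => by
    simpa using NonUnitalStarAlgHom.norm_apply_le Ψ a
  -- On polynomials this is the averaging estimate in 𝒪(E(n)), where the sum of the vertex
  -- projections is the unit, combined with the description of the quotient norm.
  have hnorm : ∀ a, ‖a‖ ≤ ‖Ψ a‖ := by
    intro a
    refine (denseRange_eval (G := G.stepGraph n)).induction_on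
      (p := fun a => ‖a‖ ≤ ‖Ψ a‖) a
      (isClosed_le continuous_norm (continuous_norm.comp hcont)) fun t => ?_
    rw [heval]
    obtain ⟨h, ht⟩ := eval_bunceDeddens hn no_sinks t
    rw [ht]
    exact norm_mk_bunceDeddens_le hn no_sinks fun M => norm_eval_le_norm_mul_tailProj hn
      (G.stepGraph n).isCKFamily_ck no_sources t (mul_sum_ckP _) M
  have hiso : Isometry Ψ := AddMonoidHomClass.isometry_of_norm Ψ fun a =>
    le_antisymm (NonUnitalStarAlgHom.norm_apply_le Ψ a) (hnorm a)
  have hsurj : Function.Surjective Ψ := by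
    let q := StarIdeal.Quotient.mkHom (G.compactIdeal n)
    let j := NonUnitalStarSubalgebraClass.subtype (G.shiftAlgebra n)
    have hq : Continuous q := AddMonoidHomClass.continuous_of_bound q 1 fun a => by
      simpa using NonUnitalStarAlgHom.norm_apply_le q a
    -- The range of an isometry is closed, so its preimage is a closed `*`-subalgebra; it contains
    -- the generators of 𝒜(n).
    let M := (NonUnitalStarAlgHom.range Ψ).comap q
    have hM : IsClosed (M : Set (G.shiftAlgebra n)) :=
      hiso.isClosedEmbedding.isClosed_range.preimage hq
    have hle : G.shiftAlgebra n ≤ M.map j := by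
      refine shiftAlgebra_le hn _ ?_ fun α => ?_
      · exact isClosed_shiftAlgebra.isClosedEmbedding_subtypeVal.isClosedMap _ hM
      · exact ⟨⟨stepOp hn α, stepOp_mem hn α⟩, ⟨(G.stepGraph n).ckS α, hS α⟩, rfl⟩
    intro b
    obtain ⟨A, rfl⟩ := StarIdeal.Quotient.mk_surjective _ b
    obtain ⟨A', hA', h⟩ := hle A.2
    have : A' = A := Subtype.ext h
    exact this ▸ hA'
  exact ⟨StarAlgEquiv.ofBijective Ψ ⟨hiso.injective, hsurj⟩⟩

end DirGraph
end

noncomputable section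

/-! ### Matrix units -/

section MatrixUnits

open Classical in
/-- The matrix whose only nonzero entry is `a`, in position `(i, j)`. -/
def CStarMatrix.single {ι A : Type*} [Zero A] (i j : ι) (a : A) : CStarMatrix ι ι A :=
  CStarMatrix.ofMatrix (Matrix.single i j a)

namespace CStarMatrix

variable {ι A : Type*} [NonUnitalCStarAlgebra A]

open Classical in
theorem single_apply (i j k l : ι) (a : A) :
    single i j a k l = if i = k ∧ j = l then a else 0 := rfl

theorem star_single (i j : ι) (a : A) : star (single i j a) = single j i (star a) := by
  classical
  exact Matrix.conjTranspose_single i j a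

theorem single_zero (i j : ι) : single i j (0 : A) = 0 := by
  classical
  exact Matrix.single_zero i j

theorem single_sum (i j : ι) {κ : Type*} (s : Finset κ) (f : κ → A) :
    single i j (∑ k ∈ s, f k) = ∑ k ∈ s, single i j (f k) := by
  classical
  exact map_sum (Matrix.singleAddMonoidHom i j) f s

theorem continuous_entry (i j : ι) :
    Continuous fun X : CStarMatrix ι ι A => X i j :=
  (continuous_apply_apply i j : Continuous fun X : ι → ι → A => X i j)

variable [Fintype ι]

theorem single_mul_single (i j k : ι) (a b : A) :
    single i j a * single j k b = single i k (a * b) := by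
  classical
  exact Matrix.single_mul_single_same (c := a) i j k b

theorem single_mul_single_of_ne (i j : ι) {k l : ι} (h : j ≠ k) (a b : A) :
    single i j a * single k l b = 0 := by
  classical
  exact Matrix.single_mul_single_of_ne (c := a) i j k h b

theorem single_mul_mul_single (i j k l : ι) (a b : A) (X : CStarMatrix ι ι A) :
    single i k a * X * single l j b = single i j (a * X k l * b) := by
  classical
  exact Matrix.single_mul_mul_single i k l j a X b

theorem sum_single (X : CStarMatrix ι ι A) : X = ∑ i, ∑ j, single i j (X i j) := by
  classical
  exact Matrix.matrix_eq_sum_single X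

end CStarMatrix

end MatrixUnits

namespace DirGraph

variable {V E : Type u} {G : DirGraph V E} {n : ℕ}

/-! ### The Cuntz-Krieger family of `E(=n)` in `𝒪(E(n))` -/

/-- A vertex, viewed as a path of length less than `n`. -/
def vertexLT (hn : 1 ≤ n) (x : V) : G.PathLT n := ⟨Path.vertex x, hn⟩

theorem remLT_vertex (hn : 1 ≤ n) (x : V) : remLT hn (Path.vertex x : G.Path) = vertexLT hn x :=
  Subtype.ext (Path.rem_of_lt hn)

theorem vertexLT_injective (hn : 1 ≤ n) :
    Function.Injective (vertexLT hn : V → G.PathLT n) := fun _ _ h =>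
  congrArg Path.source (congrArg Subtype.val h)

theorem remLT_pathEq (hn : 1 ≤ n) (μ : G.PathEq n) : remLT hn μ.1 = vertexLT hn μ.1.range := by
  rw [remLT_of_dvd_length hn (by rw [μ.2]), remLT_vertex]

section PowFamily

variable [Finite V] [Finite E] {B : Type*} [NonUnitalCStarAlgebra B] {P : G.PathLT n → B}
  {S : G.StepEdge n → B}

theorem isCKFamily_powGraph (hn : 1 ≤ n) (hck : (G.stepGraph n).IsCKFamily P S)
    (no_sources : ∀ x, ∃ e, G.rng e = x) :
    (G.powGraph n).IsCKFamily (fun x => P (vertexLT hn x)) (fun μ => pathElem hn P S μ.1) where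
  isProj x := hck.isProj _
  partialIsometry μ := by
    rw [mul_assoc, star_pathElem_mul_self hn hck, pathElem_mul_proj hn hck]
  orthogonal x y h := hck.orthogonal _ _ fun h' => h (vertexLT_injective hn h')
  star_mul_of_ne μ ν h := star_pathElem_mul_of_ne hn hck (μ.2.trans ν.2.symm)
    fun h' => h (Subtype.ext h')
  star_mul_self μ := by rw [star_pathElem_mul_self hn hck, remLT_vertex]; rfl
  sum_eq x _ := by
    classical
    cases nonempty_fintype (G.PathLT n)
    cases nonempty_fintype (G.PathEq n)
    -- Length n has residue 0, so the level sum runs over the vertices of E. Multiplying by P_x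
    -- keeps P_x on one side and the paths ending at x on the other.
    have h := congrArg (P (vertexLT hn x) * ·) (sum_level hn hck no_sources n)
    simp only [Finset.mul_sum, Nat.mod_self] at h
    rw [finsum_mem_eq_finite_toFinset_sum _ (Set.toFinite _)]
    rw [Finset.sum_eq_single (vertexLT hn x), hck.proj_mul_self] at h
    · rw [← h]
      symm
      rw [← Finset.sum_filter_of_ne (p := fun v : G.Path => v.range = x)]
      · refine Finset.sum_bij' (fun v hv => ⟨v, mem_level.1 (Finset.mem_filter.1 hv).1⟩)
          (fun μ _ => μ.1) ?_ ?_ (fun _ _ => rfl) (fun _ _ => rfl) ?_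
        · intro v hv
          rw [Set.Finite.mem_toFinset]
          exact (Finset.mem_filter.1 hv).2
        · intro μ hμ
          rw [Set.Finite.mem_toFinset] at hμ
          exact Finset.mem_filter.2 ⟨mem_level.2 μ.2, hμ⟩
        · intro v hv
          have h1 : remLT hn v = vertexLT hn x :=
            (remLT_pathEq hn ⟨v, mem_level.1 (Finset.mem_filter.1 hv).1⟩).trans
              (congrArg _ (Finset.mem_filter.1 hv).2)
          rw [← mul_assoc, ← h1, proj_mul_pathElem hn hck]
      · intro v hv h1
        by_contra h2
        refine h1 ?_
        rw [← mul_assoc, proj_mul_pathElem_of_ne hn hck, zero_mul]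
        rw [remLT_pathEq hn ⟨v, mem_level.1 hv⟩]
        exact fun h' => h2 (vertexLT_injective hn h')
    · exact fun w _ hw => hck.orthogonal _ _ hw.symm
    · exact fun h' => (h' (Finset.mem_filter.2 ⟨Finset.mem_univ _, rfl⟩)).elim

/-- The paths shorter than n form the first period. Their partial isometries thus give a
decomposition of the unit, along which elements become matrices. -/
theorem sum_pathLT_mul_star (hn : 1 ≤ n) (hck : (G.stepGraph n).IsCKFamily P S)
    (no_sources : ∀ x, ∃ e, G.rng e = x) [Fintype (G.PathLT n)] :
    ∑ w : G.PathLT n, pathElem hn P S w.1 * star (pathElem hn P S w.1) = ∑ w, P w := by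
  have h := sum_window hn hck no_sources 0 1
  rw [one_smul] at h
  rw [← h]
  refine Finset.sum_bij' (fun w _ => w.1) (fun v hv => ⟨v, by simpa using (mem_window.1 hv).2⟩)
    ?_ ?_ ?_ ?_ ?_
  · intro w _
    rw [mem_window]
    simpa using w.2
  all_goals intros; first | rfl | exact Finset.mem_univ _

end PowFamily

/-! ### The Cuntz-Krieger family of `E(n)` in the corner -/

theorem stepGraph_rng_of_lt {α : G.StepEdge n} (h : α.1.2.1.length + 1 < n) :
    (G.stepGraph n).rng α = ⟨Path.cons α.1.1 α.1.2.1 α.2, h⟩ := dif_pos h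

theorem stepGraph_rng_of_not_lt (hn : 1 ≤ n) {α : G.StepEdge n} (h : ¬ α.1.2.1.length + 1 < n) :
    (G.stepGraph n).rng α = vertexLT hn (G.rng α.1.1) := dif_neg h

theorem stepEdge_ext {α β : G.StepEdge n}
    (h : Path.cons α.1.1 α.1.2.1 α.2 = Path.cons β.1.1 β.1.2.1 β.2) : α = β :=
  Subtype.ext (Prod.ext (Path.cons_inj.1 h).1 (Subtype.ext (Path.cons_inj.1 h).2))

section Corner

variable [Fintype V] [Finite E]

variable (G n) in
/-- An enumeration of the paths of length less than `n` that is compatible with the division of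
the index set into blocks. -/
def blockEquiv : G.PathLT n ≃ G.BlockIndex n :=
  (Equiv.sigmaFiberEquiv fun w : G.PathLT n => w.1.source).symm.trans
    (Equiv.sigmaCongrRight fun _ => Finite.equivFin _)

theorem blockEquiv_fst (w : G.PathLT n) : (blockEquiv G n w).1 = w.1.source := rfl

theorem source_blockEquiv_symm (i : G.BlockIndex n) : ((blockEquiv G n).symm i).1.source = i.1 := by
  rw [← blockEquiv_fst, Equiv.apply_symm_apply]

/-- The path `ew` of length `n`, for an edge `(e, w)` of `E(n)` with `|w| = n - 1`. -/
def longPath (α : G.StepEdge n) (h : ¬ α.1.2.1.length + 1 < n) : G.PathEq n :=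
  ⟨Path.cons α.1.1 α.1.2.1 α.2, le_antisymm α.1.2.2 (not_lt.1 h)⟩

/-- The nonzero entry of the matrix of an edge `(e, w)` of `E(n)`: it is `s_{ew}` if `|ew| = n`,
and `p_{s(w)}` otherwise. -/
def edgeEntry (α : G.StepEdge n) : (G.powGraph n).CKAlgebra :=
  if h : α.1.2.1.length + 1 < n then (G.powGraph n).ckP α.1.2.1.source
  else (G.powGraph n).ckS (longPath α h)

theorem edgeEntry_of_lt {α : G.StepEdge n} (h : α.1.2.1.length + 1 < n) :
    edgeEntry α = (G.powGraph n).ckP α.1.2.1.source := dif_pos h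

theorem edgeEntry_of_not_lt {α : G.StepEdge n} (h : ¬ α.1.2.1.length + 1 < n) :
    edgeEntry α = (G.powGraph n).ckS (longPath α h) := dif_neg h

theorem star_edgeEntry_mul_self (α : G.StepEdge n) :
    star (edgeEntry α) * edgeEntry α = (G.powGraph n).ckP α.1.2.1.source := by
  have hck := (G.powGraph n).isCKFamily_ck
  by_cases h : α.1.2.1.length + 1 < n
  · rw [edgeEntry_of_lt h, hck.star_proj, hck.proj_mul_self]
  · rw [edgeEntry_of_not_lt h, hck.star_mul_self]
    rfl

theorem edgeEntry_mul_proj (α : G.StepEdge n) :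
    edgeEntry α * (G.powGraph n).ckP α.1.2.1.source = edgeEntry α := by
  have hck := (G.powGraph n).isCKFamily_ck
  by_cases h : α.1.2.1.length + 1 < n
  · rw [edgeEntry_of_lt h, hck.proj_mul_self]
  · rw [edgeEntry_of_not_lt h]
    exact hck.edge_mul_proj (longPath α h)

/-- An edge ending at a path of positive length is determined by that path, so distinct edges with
the same range end at a vertex and have distinct paths of length n as entries. -/
theorem star_edgeEntry_mul_of_ne (hn : 1 ≤ n) {α β : G.StepEdge n} (hαβ : α ≠ β)
    (hr : (G.stepGraph n).rng α = (G.stepGraph n).rng β) :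
    star (edgeEntry α) * edgeEntry β = 0 := by
  have hl := congrArg (fun w : G.PathLT n => w.1.length) hr
  by_cases h : α.1.2.1.length + 1 < n <;> by_cases h' : β.1.2.1.length + 1 < n
  · rw [stepGraph_rng_of_lt h, stepGraph_rng_of_lt h'] at hr
    exact absurd (stepEdge_ext (congrArg Subtype.val hr)) hαβ
  · rw [stepGraph_rng_of_lt h, stepGraph_rng_of_not_lt hn h'] at hl
    exact absurd hl (Nat.succ_ne_zero _)
  · rw [stepGraph_rng_of_not_lt hn h, stepGraph_rng_of_lt h'] at hl
    exact absurd hl.symm (Nat.succ_ne_zero _)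
  · rw [edgeEntry_of_not_lt h, edgeEntry_of_not_lt h']
    refine (G.powGraph n).isCKFamily_ck.star_mul_of_ne _ _ fun h1 => hαβ ?_
    exact stepEdge_ext (congrArg Subtype.val h1)

/-- A path of positive length has a single incoming edge, whose entry is a projection. The edges
into a vertex x correspond to the paths of length n ending at x, so there the claim is the sum
relation of E(=n). -/
theorem sum_edgeEntry_mul_star [Fintype (G.StepEdge n)] [DecidableEq (G.PathLT n)] (hn : 1 ≤ n)
    (no_sources : ∀ x, ∃ e, G.rng e = x) (w : G.PathLT n) :
    ∑ α with (G.stepGraph n).rng α = w, edgeEntry α * star (edgeEntry α) =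
      (G.powGraph n).ckP w.1.source := by
  classical
  have hck := (G.powGraph n).isCKFamily_ck
  obtain ⟨w, hw⟩ := w
  rcases w.eq_vertex_or_eq_cons with ⟨x, rfl⟩ | ⟨e, v, h, rfl⟩
  · cases nonempty_fintype (G.PathEq n)
    obtain ⟨μ₀, hμ₀, hμ₀'⟩ := exists_path_range no_sources n x
    have hx : ∃ μ, (G.powGraph n).rng μ = x := ⟨⟨μ₀, hμ₀⟩, hμ₀'⟩
    change _ = (G.powGraph n).ckP x
    rw [← hck.sum_filter_eq hx]
    have hnlt : ∀ α : G.StepEdge n, (G.stepGraph n).rng α = ⟨Path.vertex x, hw⟩ →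
        ¬ α.1.2.1.length + 1 < n := by
      intro α hα h
      rw [stepGraph_rng_of_lt h] at hα
      exact Nat.succ_ne_zero _ (congrArg (fun w : G.PathLT n => w.1.length) hα)
    refine Finset.sum_bij (fun α hα => longPath α (hnlt α (Finset.mem_filter.1 hα).2)) ?_ ?_ ?_ ?_
    · intro α hα
      have h1 := (Finset.mem_filter.1 hα).2
      rw [stepGraph_rng_of_not_lt hn (hnlt α h1)] at h1
      exact Finset.mem_filter.2 ⟨Finset.mem_univ _, vertexLT_injective hn h1⟩
    · intro α hα β hβ h
      exact stepEdge_ext (congrArg Subtype.val h)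
    · rintro ⟨μ, hμ⟩ hμx
      have hμx := (Finset.mem_filter.1 hμx).2
      rcases μ.eq_vertex_or_eq_cons with ⟨y, rfl⟩ | ⟨e, v, h, rfl⟩
      · exact absurd hμ (by rw [Path.length_vertex]; omega)
      · have hv : v.length + 1 = n := hμ
        let α : G.StepEdge n := ⟨(e, ⟨v, by omega⟩), h⟩
        have hα : ¬ α.1.2.1.length + 1 < n := fun h' => absurd hv h'.ne
        refine ⟨α, Finset.mem_filter.2 ⟨Finset.mem_univ _, ?_⟩, rfl⟩
        rw [stepGraph_rng_of_not_lt hn hα]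
        exact congrArg (vertexLT hn) hμx
    · intro α hα
      rw [edgeEntry_of_not_lt]
  · have hv : v.length + 1 < n := hw
    let β : G.StepEdge n := ⟨(e, ⟨v, by omega⟩), h⟩
    have hβ : (G.stepGraph n).rng β = ⟨Path.cons e v h, hw⟩ := stepGraph_rng_of_lt hv
    rw [Finset.sum_eq_single β]
    · rw [edgeEntry_of_lt hv, hck.star_proj, hck.proj_mul_self]
      rfl
    · intro α hα hne
      have hα := (Finset.mem_filter.1 hα).2
      exfalso
      by_cases h1 : α.1.2.1.length + 1 < n
      · rw [stepGraph_rng_of_lt h1] at hα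
        exact hne (stepEdge_ext (congrArg Subtype.val hα))
      · rw [stepGraph_rng_of_not_lt hn h1] at hα
        exact Nat.succ_ne_zero _ (congrArg (fun w : G.PathLT n => w.1.length) hα).symm
    · exact fun h' => (h' (Finset.mem_filter.2 ⟨Finset.mem_univ _, hβ⟩)).elim

/-- The matrices of the vertices of `E(n)`. -/
def matrixP (w : G.PathLT n) :
    CStarMatrix (G.BlockIndex n) (G.BlockIndex n) (G.powGraph n).CKAlgebra :=
  CStarMatrix.single (blockEquiv G n w) (blockEquiv G n w) ((G.powGraph n).ckP w.1.source)

/-- The matrices of the edges of `E(n)`. -/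
def matrixS (α : G.StepEdge n) :
    CStarMatrix (G.BlockIndex n) (G.BlockIndex n) (G.powGraph n).CKAlgebra :=
  CStarMatrix.single (blockEquiv G n ((G.stepGraph n).rng α)) (blockEquiv G n α.1.2) (edgeEntry α)

theorem isCKFamily_matrix (hn : 1 ≤ n) (no_sources : ∀ x, ∃ e, G.rng e = x) :
    (G.stepGraph n).IsCKFamily (matrixP (G := G)) (matrixS (G := G)) := by
  classical
  have hck := (G.powGraph n).isCKFamily_ck
  refine ⟨fun w => ⟨?_, ?_⟩, fun α => ?_, fun w w' h => ?_, fun α β h => ?_, fun α => ?_,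
    fun w _ => ?_⟩
  · rw [IsIdempotentElem, matrixP, CStarMatrix.single_mul_single, hck.proj_mul_self]
  · rw [IsSelfAdjoint, matrixP, CStarMatrix.star_single, hck.star_proj]
  · rw [matrixS, CStarMatrix.star_single, CStarMatrix.single_mul_single,
      CStarMatrix.single_mul_single, mul_assoc, star_edgeEntry_mul_self, edgeEntry_mul_proj]
  · exact CStarMatrix.single_mul_single_of_ne _ _ (fun h' => h ((blockEquiv G n).injective h')) _ _
  · rw [matrixS, CStarMatrix.star_single, matrixS]
    by_cases hr : (G.stepGraph n).rng α = (G.stepGraph n).rng β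
    · rw [hr, CStarMatrix.single_mul_single, star_edgeEntry_mul_of_ne hn h hr,
        CStarMatrix.single_zero]
    · exact CStarMatrix.single_mul_single_of_ne _ _
        (fun h' => hr ((blockEquiv G n).injective h')) _ _
  · rw [matrixS, CStarMatrix.star_single, CStarMatrix.single_mul_single, star_edgeEntry_mul_self]
    rfl
  · cases nonempty_fintype (G.StepEdge n)
    rw [finsum_mem_eq_finite_toFinset_sum _ (Set.toFinite _), matrixP,
      ← sum_edgeEntry_mul_star hn no_sources w, CStarMatrix.single_sum]
    refine Finset.sum_congr (by ext; simp) fun α hα => ?_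
    rw [matrixS, CStarMatrix.star_single, CStarMatrix.single_mul_single,
      (Finset.mem_filter.1 hα).2]

end Corner

end DirGraph
end

noncomputable section

namespace DirGraph

variable {V E : Type u} {G : DirGraph V E} {n : ℕ}

section CornerIso

variable [Fintype V] [Finite E]

/-! ### `𝒪(E(n))` is a corner of the matrix algebra over `𝒪(E(=n))` -/

variable (G n) in
/-- The matrix algebra `M_{d_E(n)}(𝒪(E(=n)))`. -/
abbrev BlockMatrix : Type u :=
  CStarMatrix (G.BlockIndex n) (G.BlockIndex n) (G.powGraph n).CKAlgebra

/-- The partial isometry in `𝒪(E(n))` of the path with index `i`. -/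
def blockElem (hn : 1 ≤ n) (i : G.BlockIndex n) : (G.stepGraph n).CKAlgebra :=
  pathElem hn (G.stepGraph n).ckP (G.stepGraph n).ckS ((blockEquiv G n).symm i).1

theorem continuous_nonUnitalStarAlgHom {A B : Type*} [NonUnitalCStarAlgebra A]
    [NonUnitalCStarAlgebra B] (φ : A →⋆ₙₐ[ℂ] B) : Continuous φ :=
  AddMonoidHomClass.continuous_of_bound φ 1 fun a => by
    simpa using NonUnitalStarAlgHom.norm_apply_le φ a

theorem star_blockElem_mul (hn : 1 ≤ n) (i j : G.BlockIndex n) [DecidableEq (G.BlockIndex n)] :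
    star (blockElem hn i) * blockElem hn j =
      if i = j then (G.stepGraph n).ckP (vertexLT hn i.1) else 0 := by
  have hck := (G.stepGraph n).isCKFamily_ck
  split_ifs with h
  · subst h
    rw [blockElem, star_pathElem_mul_self hn hck, source_blockEquiv_symm, remLT_vertex]
  · refine star_pathElem_mul_of_remLT_ne hn hck fun h' => h ?_
    rw [remLT_coe, remLT_coe] at h'
    exact (blockEquiv G n).symm.injective h'

theorem blockElem_blockEquiv (hn : 1 ≤ n) (w : G.PathLT n) :
    blockElem hn (blockEquiv G n w) =
      pathElem hn (G.stepGraph n).ckP (G.stepGraph n).ckS w.1 := by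
  rw [blockElem, Equiv.symm_apply_apply]

theorem sum_blockElem_mul_star (hn : 1 ≤ n) (no_sources : ∀ x, ∃ e, G.rng e = x)
    [Fintype (G.PathLT n)] :
    ∑ i : G.BlockIndex n, blockElem hn i * star (blockElem hn i) =
      ∑ w, (G.stepGraph n).ckP w := by
  rw [← sum_pathLT_mul_star hn (G.stepGraph n).isCKFamily_ck no_sources,
    ← (blockEquiv G n).sum_comp]
  simp only [blockElem_blockEquiv]

/-- Compatible `*`-homomorphisms between `𝒪(E(n))`, `𝒪(E(=n))` and the matrix algebra. -/
structure IsCornerPair (hn : 1 ≤ n) (Φ : (G.stepGraph n).CKAlgebra →⋆ₙₐ[ℂ] BlockMatrix G n)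
    (ψ : (G.powGraph n).CKAlgebra →⋆ₙₐ[ℂ] (G.stepGraph n).CKAlgebra) : Prop where
  map_ckP : ∀ w, Φ ((G.stepGraph n).ckP w) = matrixP w
  map_ckS : ∀ α, Φ ((G.stepGraph n).ckS α) = matrixS α
  apply_ckP : ∀ x, ψ ((G.powGraph n).ckP x) = (G.stepGraph n).ckP (vertexLT hn x)
  apply_ckS : ∀ μ, ψ ((G.powGraph n).ckS μ) =
    pathElem hn (G.stepGraph n).ckP (G.stepGraph n).ckS μ.1

theorem exists_isCornerPair (hn : 1 ≤ n) (no_sources : ∀ x, ∃ e, G.rng e = x) :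
    ∃ (Φ : (G.stepGraph n).CKAlgebra →⋆ₙₐ[ℂ] BlockMatrix G n)
      (ψ : (G.powGraph n).CKAlgebra →⋆ₙₐ[ℂ] (G.stepGraph n).CKAlgebra), IsCornerPair hn Φ ψ := by
  obtain ⟨Φ, ⟨h1, h2⟩, -⟩ := (G.stepGraph n).existsUnique_ckLift (isCKFamily_matrix hn no_sources)
  obtain ⟨ψ, ⟨h3, h4⟩, -⟩ := (G.powGraph n).existsUnique_ckLift
    (isCKFamily_powGraph hn (G.stepGraph n).isCKFamily_ck no_sources)
  exact ⟨Φ, ψ, h1, h2, h3, h4⟩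

/-! ### Injectivity and range of the map into matrices -/

namespace IsCornerPair

variable {hn : 1 ≤ n} {Φ : (G.stepGraph n).CKAlgebra →⋆ₙₐ[ℂ] BlockMatrix G n}
  {ψ : (G.powGraph n).CKAlgebra →⋆ₙₐ[ℂ] (G.stepGraph n).CKAlgebra} (h : IsCornerPair hn Φ ψ)
include h

/-- Prepending e to w either gives another path shorter than n or completes a path of length n,
which is then the value of ψ on the entry. This is the edge case of `apply_entry_eval`. -/
theorem apply_edgeEntry (α : G.StepEdge n) :
    (G.stepGraph n).ckS α * blockElem hn (blockEquiv G n α.1.2) =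
      blockElem hn (blockEquiv G n ((G.stepGraph n).rng α)) * ψ (edgeEntry α) := by
  have hck := (G.stepGraph n).isCKFamily_ck
  have e : (G.stepGraph n).ckS α * pathElem hn (G.stepGraph n).ckP (G.stepGraph n).ckS α.1.2.1 =
      pathElem hn (G.stepGraph n).ckP (G.stepGraph n).ckS (Path.cons α.1.1 α.1.2.1 α.2) := by
    rw [pathElem_cons, stepOf_coe]
  rw [blockElem_blockEquiv, blockElem_blockEquiv, e]
  by_cases hα : α.1.2.1.length + 1 < n
  · rw [stepGraph_rng_of_lt hα, edgeEntry_of_lt hα, h.apply_ckP, ← remLT_vertex]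
    exact (pathElem_mul_proj hn hck (Path.cons α.1.1 α.1.2.1 α.2)).symm
  · rw [stepGraph_rng_of_not_lt hn hα, edgeEntry_of_not_lt hα, h.apply_ckS]
    change _ = (G.stepGraph n).ckP (remLT hn (Path.vertex (G.rng α.1.1))) * _
    rw [remLT_vertex, ← proj_mul_pathElem hn hck (longPath α hα).1, remLT_pathEq,
      ← mul_assoc]
    change _ = (G.stepGraph n).ckP (vertexLT hn (G.rng α.1.1)) *
      (G.stepGraph n).ckP (vertexLT hn (G.rng α.1.1)) * _
    rw [hck.proj_mul_self]
    have := proj_mul_pathElem hn hck (longPath α hα).1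
    rw [remLT_pathEq] at this
    exact this.symm

theorem apply_edgeEntry' (α : G.StepEdge n) :
    (G.stepGraph n).ckP (vertexLT hn ((G.stepGraph n).rng α).1.source) * ψ (edgeEntry α) =
      ψ (edgeEntry α) := by
  have hck := (G.stepGraph n).isCKFamily_ck
  by_cases hα : α.1.2.1.length + 1 < n
  · rw [stepGraph_rng_of_lt hα, edgeEntry_of_lt hα, h.apply_ckP]
    exact hck.proj_mul_self _
  · rw [stepGraph_rng_of_not_lt hn hα, edgeEntry_of_not_lt hα, h.apply_ckS]
    have := proj_mul_pathElem hn hck (longPath α hα).1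
    rwa [remLT_pathEq] at this

/-- The assignment s ↦ (s_i^* s s_j) is multiplicative because ∑ s_k s_k^* is the unit, so only
vertices and edges need a computation. -/
theorem apply_entry_eval (no_sources : ∀ x, ∃ e, G.rng e = x)
    (t : StarPoly (G.PathLT n) (G.StepEdge n)) : ∀ i j : G.BlockIndex n,
    ψ (Φ (t.eval (G.stepGraph n).ckP (G.stepGraph n).ckS) i j) =
      star (blockElem hn i) * t.eval (G.stepGraph n).ckP (G.stepGraph n).ckS * blockElem hn j := by
  classical
  cases nonempty_fintype (G.PathLT n)
  have hck := (G.stepGraph n).isCKFamily_ck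
  have hstep : ∀ (w : G.PathLT n) (j : G.BlockIndex n), blockEquiv G n w ≠ j →
      (G.stepGraph n).ckP w * blockElem hn j = 0 := fun w j hj => by
    refine proj_mul_pathElem_of_ne hn hck fun h' => hj ?_
    rw [remLT_coe] at h'
    rw [← h', Equiv.apply_symm_apply]
  induction t with
  | vertex w =>
    intro i j
    simp only [StarPoly.eval]
    rw [h.map_ckP, matrixP, CStarMatrix.single_apply]
    by_cases hj : blockEquiv G n w = j
    · subst hj
      have e : (G.stepGraph n).ckP w * blockElem hn (blockEquiv G n w) =
          blockElem hn (blockEquiv G n w) := by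
        have := proj_mul_pathElem hn hck w.1
        rwa [remLT_coe, ← blockElem_blockEquiv] at this
      rw [mul_assoc, e, star_blockElem_mul]
      by_cases hi : i = blockEquiv G n w
      · subst hi
        rw [if_pos ⟨rfl, rfl⟩, if_pos rfl, h.apply_ckP]
        rfl
      · rw [if_neg (fun h' => hi h'.1.symm), if_neg hi, map_zero]
    · rw [if_neg (fun h' => hj h'.2), map_zero, mul_assoc, hstep w j hj, mul_zero]
  | edge α =>
    intro i j
    simp only [StarPoly.eval]
    rw [h.map_ckS, matrixS, CStarMatrix.single_apply, mul_assoc]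
    by_cases hj : blockEquiv G n α.1.2 = j
    · subst hj
      rw [h.apply_edgeEntry, ← mul_assoc, star_blockElem_mul]
      by_cases hi : i = blockEquiv G n ((G.stepGraph n).rng α)
      · subst hi
        rw [if_pos ⟨rfl, rfl⟩, if_pos rfl]
        exact (h.apply_edgeEntry' α).symm
      · rw [if_neg (fun h' => hi h'.1.symm), if_neg hi, map_zero, zero_mul]
    · rw [if_neg (fun h' => hj h'.2), map_zero, ← hck.edge_mul_proj α, mul_assoc,
        hstep ((G.stepGraph n).src α) j hj, mul_zero, mul_zero]
  | zero =>
    intro i j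
    simp only [StarPoly.eval, map_zero, CStarMatrix.zero_apply, mul_zero, zero_mul]
  | add a b ha hb =>
    intro i j
    simp only [StarPoly.eval, map_add, CStarMatrix.add_apply, mul_add, add_mul, ha, hb]
  | mul a b ha hb =>
    intro i j
    simp only [StarPoly.eval, map_mul, CStarMatrix.mul_apply, map_sum, ha, hb]
    set x := a.eval (G.stepGraph n).ckP (G.stepGraph n).ckS
    set y := b.eval (G.stepGraph n).ckP (G.stepGraph n).ckS
    calc _ = star (blockElem hn i) * (x * (∑ k : G.BlockIndex n,
          blockElem hn k * star (blockElem hn k))) * y * blockElem hn j := by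
          simp only [Finset.mul_sum, Finset.sum_mul, mul_assoc]
      _ = _ := by rw [sum_blockElem_mul_star hn no_sources, mul_sum_ckP, ← mul_assoc]
  | smul c a ha =>
    intro i j
    simp only [StarPoly.eval, map_smul, CStarMatrix.smul_apply, ha, mul_smul_comm, smul_mul_assoc]
  | star a ha =>
    intro i j
    simp only [StarPoly.eval, map_star, CStarMatrix.star_apply, ha, star_mul, star_star, mul_assoc]

theorem apply_entry (no_sources : ∀ x, ∃ e, G.rng e = x) (s : (G.stepGraph n).CKAlgebra)
    (i j : G.BlockIndex n) : ψ (Φ s i j) = star (blockElem hn i) * s * blockElem hn j := by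
  have h1 : Continuous fun s => ψ (Φ s i j) := (continuous_nonUnitalStarAlgHom ψ).comp
    ((CStarMatrix.continuous_entry i j).comp (continuous_nonUnitalStarAlgHom Φ))
  have h2 : Continuous fun s => star (blockElem hn i) * s * blockElem hn j := by fun_prop
  exact congrFun (denseRange_eval.equalizer h1 h2
    (funext fun t => h.apply_entry_eval no_sources t i j)) s

/-- The element s is recovered from its matrix as ∑ s_i (s_i^* s s_j) s_j^*. -/
theorem injective (no_sources : ∀ x, ∃ e, G.rng e = x) : Function.Injective Φ := by
  classical
  cases nonempty_fintype (G.PathLT n)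
  refine (injective_iff_map_eq_zero Φ).2 fun s hs => ?_
  have h1 : ∀ i j, star (blockElem hn i) * s * blockElem hn j = 0 := fun i j => by
    rw [← h.apply_entry no_sources, hs, CStarMatrix.zero_apply, map_zero]
  rw [← sum_ckP_mul s, ← mul_sum_ckP ((∑ w, (G.stepGraph n).ckP w) * s),
    ← sum_blockElem_mul_star hn no_sources, Finset.mul_sum]
  refine Finset.sum_eq_zero fun j _ => ?_
  rw [Finset.sum_mul, Finset.sum_mul]
  refine Finset.sum_eq_zero fun i _ => ?_
  calc _ = blockElem hn i * (star (blockElem hn i) * s * blockElem hn j) *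
        star (blockElem hn j) := by simp only [mul_assoc]
    _ = 0 := by rw [h1, mul_zero, zero_mul]

/-- Every edge of E(n) walked along a short path has the vertex projection of the source as entry,
so only the matrix position moves. In `map_pathElem_pathEq` the n-th edge closes the period and
contributes the generator of E(=n). -/
theorem map_pathElem_of_lt {v : G.Path} (hv : v.length < n) :
    Φ (pathElem hn (G.stepGraph n).ckP (G.stepGraph n).ckS v) =
      CStarMatrix.single (blockEquiv G n ⟨v, hv⟩) (blockEquiv G n (vertexLT hn v.source))
        ((G.powGraph n).ckP v.source) := by
  induction v using Path.cons_induction with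
  | vertex x => rw [pathElem_vertex, h.map_ckP, remLT_vertex]; rfl
  | cons e v he ih =>
    have hv' : v.length + 1 < n := hv
    have hr : remLT hn v = ⟨v, by omega⟩ := Subtype.ext (Path.rem_of_lt (by omega))
    have hα : (stepOf hn e v he).1.2.1.length + 1 < n := by
      change (remLT hn v).1.length + 1 < n
      rwa [hr]
    rw [pathElem_cons, map_mul, h.map_ckS, ih (by omega), matrixS, rng_stepOf, edgeEntry_of_lt hα]
    change CStarMatrix.single _ (blockEquiv G n (remLT hn v))
      ((G.powGraph n).ckP (remLT hn v).1.source) * _ = _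
    rw [hr, CStarMatrix.single_mul_single, (G.powGraph n).isCKFamily_ck.proj_mul_self]
    congr 2
    exact Subtype.ext (Path.rem_of_lt hv)

theorem map_pathElem_pathEq (μ : G.PathEq n) :
    Φ (pathElem hn (G.stepGraph n).ckP (G.stepGraph n).ckS μ.1) =
      CStarMatrix.single (blockEquiv G n (vertexLT hn μ.1.range))
        (blockEquiv G n (vertexLT hn μ.1.source)) ((G.powGraph n).ckS μ) := by
  obtain ⟨μ, hμ⟩ := μ
  rcases μ.eq_vertex_or_eq_cons with ⟨x, rfl⟩ | ⟨e, v, he, rfl⟩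
  · exact absurd hμ (by rw [Path.length_vertex]; omega)
  · have hv : v.length + 1 = n := hμ
    have hlt : v.length < n := by omega
    have hr : remLT hn v = ⟨v, hlt⟩ := Subtype.ext (Path.rem_of_lt hlt)
    have hα : ¬ (stepOf hn e v he).1.2.1.length + 1 < n := by
      change ¬ (remLT hn v).1.length + 1 < n
      rw [hr]
      exact fun h' => absurd hv h'.ne
    have hp : longPath (stepOf hn e v he) hα = ⟨Path.cons e v he, hμ⟩ :=
      Subtype.ext ((Path.cons_inj (h := (stepOf hn e v he).2) (h' := he)).2
        ⟨rfl, congrArg Subtype.val hr⟩)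
    rw [pathElem_cons, map_mul, h.map_ckS, h.map_pathElem_of_lt hlt, matrixS, rng_stepOf,
      edgeEntry_of_not_lt hα, hp, remLT_pathEq hn ⟨Path.cons e v he, hμ⟩]
    change CStarMatrix.single _ (blockEquiv G n (remLT hn v)) _ * _ = _
    rw [hr, CStarMatrix.single_mul_single]
    congr 1
    exact (G.powGraph n).isCKFamily_ck.edge_mul_proj ⟨Path.cons e v he, hμ⟩

open Classical in
omit h in
variable (hn) in
/-- The vertex projection `p_x` at the index of the path `x` of length `0`, and `0` at the other
indices. -/
def _root_.DirGraph.vertexEntry (i : G.BlockIndex n) : (G.powGraph n).CKAlgebra :=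
  if i = blockEquiv G n (vertexLT hn i.1) then (G.powGraph n).ckP i.1 else 0

omit h in
theorem _root_.DirGraph.vertexEntry_blockEquiv (x : V) :
    vertexEntry hn (blockEquiv G n (vertexLT hn x)) = (G.powGraph n).ckP x := if_pos rfl

omit h in
theorem _root_.DirGraph.vertexEntry_of_ne {i : G.BlockIndex n}
    (hi : ∀ x, i ≠ blockEquiv G n (vertexLT hn x)) : vertexEntry hn i = 0 := if_neg (hi _)

omit h in
theorem _root_.DirGraph.vertexEntry_mul_of_ne {i : G.BlockIndex n} {x : V}
    (hi : i ≠ blockEquiv G n (vertexLT hn x)) : vertexEntry hn i * (G.powGraph n).ckP x = 0 := by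
  by_cases h1 : ∃ y, i = blockEquiv G n (vertexLT hn y)
  · obtain ⟨y, rfl⟩ := h1
    rw [vertexEntry_blockEquiv]
    exact (G.powGraph n).isCKFamily_ck.orthogonal _ _ fun h2 => hi (by rw [h2])
  · rw [vertexEntry_of_ne fun y hy => h1 ⟨y, hy⟩, zero_mul]

omit h in
theorem _root_.DirGraph.star_vertexEntry (i : G.BlockIndex n) :
    star (vertexEntry hn i) = vertexEntry hn i := by
  rw [vertexEntry]
  split_ifs
  · exact (G.powGraph n).isCKFamily_ck.star_proj _
  · exact star_zero _

omit h in
theorem _root_.DirGraph.mul_vertexEntry_of_ne {i : G.BlockIndex n} {x : V}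
    (hi : i ≠ blockEquiv G n (vertexLT hn x)) : (G.powGraph n).ckP x * vertexEntry hn i = 0 := by
  have := congrArg star (vertexEntry_mul_of_ne hi)
  rwa [star_mul, star_vertexEntry, (G.powGraph n).isCKFamily_ck.star_proj, star_zero] at this

omit h in
theorem _root_.DirGraph.vertexEntry_mul_self (i : G.BlockIndex n) :
    vertexEntry hn i * vertexEntry hn i = vertexEntry hn i := by
  rw [vertexEntry]
  split_ifs
  · exact (G.powGraph n).isCKFamily_ck.proj_mul_self _
  · exact mul_zero _

omit h in
variable (hn) in
theorem _root_.DirGraph.sum_vertexEntry :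
    ∑ i : G.BlockIndex n, vertexEntry hn i = ∑ x, (G.powGraph n).ckP x := by
  classical
  have hinj : Function.Injective fun x : V => blockEquiv G n (vertexLT hn x) :=
    (blockEquiv G n).injective.comp (vertexLT_injective hn)
  symm
  refine Fintype.sum_of_injective _ hinj _ _ (fun i hi => ?_) fun x => ?_
  · exact vertexEntry_of_ne fun x hx => hi ⟨x, hx.symm⟩
  · exact (vertexEntry_blockEquiv x).symm

/-- The entries `vertexEntry` are projections summing to the unit of 𝒪(E(=n)), so the compression on
the right is multiplicative and the claim reduces to generators. -/
theorem entry_map_eval (t : StarPoly V (G.PathEq n)) : ∀ i j : G.BlockIndex n,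
    Φ (ψ (t.eval (G.powGraph n).ckP (G.powGraph n).ckS)) i j =
      vertexEntry hn i * t.eval (G.powGraph n).ckP (G.powGraph n).ckS * vertexEntry hn j := by
  classical
  have hck := (G.powGraph n).isCKFamily_ck
  induction t with
  | vertex x =>
    intro i j
    simp only [StarPoly.eval]
    rw [h.apply_ckP, h.map_ckP, matrixP, CStarMatrix.single_apply]
    by_cases hi : i = blockEquiv G n (vertexLT hn x)
    · by_cases hj : j = blockEquiv G n (vertexLT hn x)
      · rw [if_pos ⟨hi.symm, hj.symm⟩, hi, hj, vertexEntry_blockEquiv, hck.proj_mul_self,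
          hck.proj_mul_self]
        rfl
      · rw [if_neg (fun h' => hj h'.2.symm), mul_assoc, mul_vertexEntry_of_ne hj, mul_zero]
    · rw [if_neg (fun h' => hi h'.1.symm), vertexEntry_mul_of_ne hi, zero_mul]
  | edge μ =>
    intro i j
    simp only [StarPoly.eval]
    rw [h.apply_ckS, h.map_pathElem_pathEq, CStarMatrix.single_apply]
    have e1 : (G.powGraph n).ckP μ.1.range * (G.powGraph n).ckS μ = (G.powGraph n).ckS μ :=
      hck.proj_mul_edge μ
    have e2 : (G.powGraph n).ckS μ * (G.powGraph n).ckP μ.1.source = (G.powGraph n).ckS μ :=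
      hck.edge_mul_proj μ
    by_cases hi : i = blockEquiv G n (vertexLT hn μ.1.range)
    · by_cases hj : j = blockEquiv G n (vertexLT hn μ.1.source)
      · rw [if_pos ⟨hi.symm, hj.symm⟩, hi, hj, vertexEntry_blockEquiv, vertexEntry_blockEquiv,
          e1, e2]
      · rw [if_neg (fun h' => hj h'.2.symm), ← e2, mul_assoc, mul_assoc, mul_vertexEntry_of_ne hj,
          mul_zero, mul_zero]
    · rw [if_neg (fun h' => hi h'.1.symm), ← e1, ← mul_assoc, vertexEntry_mul_of_ne hi, zero_mul,
        zero_mul]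
  | zero =>
    intro i j
    simp only [StarPoly.eval, map_zero, CStarMatrix.zero_apply, mul_zero, zero_mul]
  | add a b ha hb =>
    intro i j
    simp only [StarPoly.eval, map_add, CStarMatrix.add_apply, mul_add, add_mul, ha, hb]
  | mul a b ha hb =>
    intro i j
    simp only [StarPoly.eval, map_mul, CStarMatrix.mul_apply, ha, hb]
    set x := a.eval (G.powGraph n).ckP (G.powGraph n).ckS
    set y := b.eval (G.powGraph n).ckP (G.powGraph n).ckS
    calc _ = ∑ k : G.BlockIndex n, vertexEntry hn i * x * (vertexEntry hn k * vertexEntry hn k) *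
          y * vertexEntry hn j := by simp only [mul_assoc]
      _ = vertexEntry hn i * (x * (∑ k : G.BlockIndex n, vertexEntry hn k)) * y *
          vertexEntry hn j := by
          simp only [vertexEntry_mul_self, Finset.mul_sum, Finset.sum_mul, mul_assoc]
      _ = _ := by rw [sum_vertexEntry, mul_sum_ckP, ← mul_assoc]
  | smul c a ha =>
    intro i j
    simp only [StarPoly.eval, map_smul, CStarMatrix.smul_apply, ha, mul_smul_comm, smul_mul_assoc]
  | star a ha =>
    intro i j
    simp only [StarPoly.eval, map_star, CStarMatrix.star_apply, ha, star_mul, star_vertexEntry,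
      mul_assoc]

theorem entry_map (b : (G.powGraph n).CKAlgebra) (i j : G.BlockIndex n) :
    Φ (ψ b) i j = vertexEntry hn i * b * vertexEntry hn j := by
  have h1 : Continuous fun b => Φ (ψ b) i j := (CStarMatrix.continuous_entry i j).comp
    ((continuous_nonUnitalStarAlgHom Φ).comp (continuous_nonUnitalStarAlgHom ψ))
  have h2 : Continuous fun b => vertexEntry hn i * b * vertexEntry hn j := by fun_prop
  exact congrFun (denseRange_eval.equalizer h1 h2
    (funext fun t => h.entry_map_eval t i j)) b

theorem map_blockElem (i : G.BlockIndex n) :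
    Φ (blockElem hn i) = CStarMatrix.single i (blockEquiv G n (vertexLT hn i.1))
      ((G.powGraph n).ckP i.1) := by
  rw [blockElem, h.map_pathElem_of_lt ((blockEquiv G n).symm i).2, source_blockEquiv_symm]
  congr 1
  exact Equiv.apply_symm_apply _ _

/-- Since Φ carries the unit to the corner projection, its whole image lies in the corner. -/
theorem map_unit [Fintype (G.PathLT n)] : Φ (∑ w, (G.stepGraph n).ckP w) = G.cornerProj n := by
  classical
  rw [map_sum]
  simp only [h.map_ckP]
  have h1 : ∀ w : G.PathLT n, matrixP w = CStarMatrix.single (blockEquiv G n w)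
      (blockEquiv G n w) ((G.powGraph n).ckP (blockEquiv G n w).1) := fun _ => rfl
  simp only [h1]
  rw [(blockEquiv G n).sum_comp fun i => CStarMatrix.single i i ((G.powGraph n).ckP i.1),
    CStarMatrix.sum_single (G.cornerProj n)]
  refine Finset.sum_congr rfl fun i _ => ?_
  rw [Finset.sum_eq_single i]
  · congr 1
    exact (Matrix.diagonal_apply_eq (fun k : G.BlockIndex n => (G.powGraph n).ckP k.1) i).symm
  · intro j _ hj
    have : G.cornerProj n i j = 0 := Matrix.diagonal_apply_ne _ hj.symm
    rw [this, CStarMatrix.single_zero]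
  · exact fun h' => (h' (Finset.mem_univ _)).elim

theorem mem_corner (s : (G.stepGraph n).CKAlgebra) : Φ s ∈ G.cornerAlgebra n := by
  classical
  cases nonempty_fintype (G.PathLT n)
  refine ⟨Φ s, ?_⟩
  change G.cornerProj n * Φ s * G.cornerProj n = Φ s
  rw [← h.map_unit, ← map_mul, ← map_mul, sum_ckP_mul, mul_sum_ckP]

theorem exists_map_eq {a : BlockMatrix G n} (ha : a ∈ G.cornerAlgebra n) : ∃ s, Φ s = a := by
  classical
  have hck := (G.powGraph n).isCKFamily_ck
  have hentry : ∀ i j, (G.powGraph n).ckP i.1 * a i j * (G.powGraph n).ckP j.1 = a i j := by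
    obtain ⟨b, rfl⟩ := ha
    intro i j
    have e : (G.cornerProj n * b * G.cornerProj n) i j =
        (G.powGraph n).ckP i.1 * b i j * (G.powGraph n).ckP j.1 := by
      let d : Matrix (G.BlockIndex n) (G.BlockIndex n) (G.powGraph n).CKAlgebra :=
        Matrix.diagonal fun k => (G.powGraph n).ckP k.1
      let c : Matrix (G.BlockIndex n) (G.BlockIndex n) (G.powGraph n).CKAlgebra := b
      change (d * c * d) i j = _
      rw [Matrix.mul_diagonal, Matrix.diagonal_mul]
    change _ * (G.cornerProj n * b * G.cornerProj n) i j * _ =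
      (G.cornerProj n * b * G.cornerProj n) i j
    rw [e, mul_assoc, mul_assoc, mul_assoc, hck.proj_mul_self, ← mul_assoc, hck.proj_mul_self,
      ← mul_assoc]
  -- The image of ψ(a_{ij}) has the entry a_{ij} at the position of the two source vertices. The
  -- images of s_i and s_j^* pick out that entry and carry it to position (i, j).
  refine ⟨∑ i, ∑ j, blockElem hn i * ψ (a i j) * star (blockElem hn j), ?_⟩
  rw [map_sum]
  conv_rhs => rw [CStarMatrix.sum_single a]
  refine Finset.sum_congr rfl fun i _ => ?_
  rw [map_sum]
  refine Finset.sum_congr rfl fun j _ => ?_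
  rw [map_mul, map_mul, map_star, h.map_blockElem, h.map_blockElem, CStarMatrix.star_single,
    CStarMatrix.single_mul_mul_single, h.entry_map, vertexEntry_blockEquiv, vertexEntry_blockEquiv,
    hck.star_proj, hentry, hentry]

end IsCornerPair

theorem nonempty_stepGraph_ckAlgebra_equiv_cornerAlgebra (hn : 1 ≤ n)
    (no_sources : ∀ x, ∃ e, G.rng e = x) :
    Nonempty ((G.stepGraph n).CKAlgebra ≃⋆ₐ[ℂ] G.cornerAlgebra n) := by
  obtain ⟨Φ, ψ, h⟩ := exists_isCornerPair hn no_sources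
  refine ⟨StarAlgEquiv.ofBijective (NonUnitalStarAlgHom.codRestrict Φ (G.cornerAlgebra n)
    h.mem_corner) ⟨fun s t hst => ?_, fun a => ?_⟩⟩
  · exact h.injective no_sources (congrArg Subtype.val hst)
  · obtain ⟨s, hs⟩ := h.exists_map_eq a.2
    exact ⟨s, Subtype.ext hs⟩

end CornerIso

end DirGraph
end

theorem mainTheorem11 {V E : Type u} [Fintype V] [Finite E] (G : DirGraph V E)
    (no_sinks : ∀ x, ∃ e, G.src e = x) (no_sources : ∀ x, ∃ e, G.rng e = x)
    (n : ℕ) (hn : 1 ≤ n) :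
    Nonempty (G.BunceDeddens n ≃⋆ₐ[ℂ] G.cornerAlgebra n) ∧
      Nonempty ((G.stepGraph n).CKAlgebra ≃⋆ₐ[ℂ] G.cornerAlgebra n) := by
  obtain ⟨e⟩ := DirGraph.nonempty_stepGraph_ckAlgebra_equiv_cornerAlgebra hn no_sources
  obtain ⟨f⟩ := DirGraph.nonempty_stepGraph_ckAlgebra_equiv_bunceDeddens hn no_sinks no_sources
  exact ⟨⟨f.symm.trans e⟩, ⟨e⟩⟩
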